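/- Let $(x,y)$ be a square-integrable random vector in $\mathbb{R}^d\times\mathbb{R}$ such that $H:=E(xx^T)$ is positive-definite. For $\theta\in\mathbb{R}^d$ set $L(\theta):=\tfrac12E((y-x^T\theta)^2)$, and let $\theta^*$ be the unique solution of $H\theta^*=E(yx)$, i.e. the minimizer of $L$. Assume that there are $\sigma,R>0$ such that the following expectations exist and, in the Loewner order, $$E\bigl((y-x^T\theta^*)^2xx^T\bigr)\preccurlyeq\sigma^2H,\qquad E\bigl(\|x\|^2xx^T\bigr)\preccurlyeq R^2H .$$ Let $\theta_0\in\mathbb{R}^d$, $0<\gamma<2/R^2$, $0<\alpha\le1/2$, $\delta>1$, $q\in(0,1]$, let $k\ge2$ be an integer, and let $s$ be $\alpha k$ rounded down or up to an integer. Let $\lambda_{\min}$ be the smallest eigenvalue of $H$ and set $$c:=\frac{\sigma^2d}{(2-\gamma R^2)^2}+\frac{\|\theta_0-\theta^*\|^2}{\gamma(2-\gamma R^2)},\quad \xi:=\gamma(2-\gamma R^2)\lambda_{\min},\quad p_l:=\frac1{2^l(l+1)^\delta}-\frac1{2^{l+1}(l+2)^\delta}\ \ (l\ge0).$$ Let $((x_t,y_t),t\in\mathbb{Z})$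 be independent copies of $(x,y)$. For $m\in\mathbb{Z}$ let $\theta_{m:m}:=\theta_0$ and $\theta_{m:t+1}:=\theta_{m:t}-\gamma(x_t^T\theta_{m:t}-y_t)x_t$ for $t\ge m$, and set $$\bar\theta_k:=\frac1{k-s}\sum_{t=s}^{k-1}\theta_{0:t},\quad f_{\mathrm{avg},k,0}:=\frac1{k-s}\sum_{t=s}^{k-1}\theta_{-t:0},\quad f_{\mathrm{avg},k,l}:=\frac1{k2^l}\sum_{t=k(2^l-1)}^{k(2^{l+1}-1)-1}\theta_{-t:0}\ \ (l\ge1).$$ Let $N$ be independent of $((x_t,y_t),t\in\mathbb{Z})$ with $\Pr(N=l)=p_l$ for $l\ge0$, and set $Z_{\mathrm{avg},k}:=(f_{\mathrm{avg},k,N+1}-f_{\mathrm{avg},k,N})/p_N$. Let $Q$ be a Bernoulli variable independent of $\bar\theta_k$ with $\Pr(Q=1)=q$, and set $\hat f_{\mathrm{avg},k}:=\bar\theta_k+q^{-1}QZ'_{\mathrm{avg},k}$, where $Z'_{\mathrm{avg},k}$ is a copy of $Z_{\mathrm{avg},k}$ independent of $(\bar\theta_k,Q)$. The running time of a simulation is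 the number of copies of $(x,y)$ that it draws. For $m\le m'\le0$, the average of $\theta_{h:0}$ over $m\le h\le m'$ is computed in one pass over $(x_t,y_t)$, $m\le t\le-1$, as $\eta_0$, where $\eta_m:=\theta_0$ and, with $\eta'_t:=\eta_t-\gamma(x_t^T\eta_t-y_t)x_t$, $\eta_{t+1}:=\frac{(t+1-m)\eta'_t+\theta_0}{t+2-m}$ if $t<m'$ and $\eta_{t+1}:=\eta'_t$ if $t\ge m'$. Given $N$, $Z_{\mathrm{avg},k}$ is simulated by this recursion, run for the levels $N+1$ and $N$ on the same samples; $\hat f_{\mathrm{avg},k}$ is simulated by computing $\bar\theta_k$ and, only if $Q=1$, simulating from fresh inputs a copy $Z'_{\mathrm{avg},k}$. Let $T_{\mathrm{avg},k}$ and $\hat T_{\mathrm{avg},k}$ be the expected running times of these simulations of $Z_{\mathrm{avg},k}$ and $\hat f_{\mathrm{avg},k}$. Then: 1. For $l\ge0$, if $\tau$ is uniformly distributed on $\{s,\dots,k-1\}$ (if $l=0$) or on $\{k(2^l-1),\dots,k(2^{l+1}-1)-1\}$ (if $l\ge1$) and independent of $((x_t,y_t),t\in\mathbb{Z})$, then,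 for any integer $j\ge k(2^{l+1}-1)$, almost surely $f_{\mathrm{avg},k,l}=E\bigl(\theta_{-\tau:0}\mid(x_t,y_t),-j\le t\le0\bigr)$. 2. These simulations return $Z_{\mathrm{avg},k}$ and $\hat f_{\mathrm{avg},k}$, and $T_{\mathrm{avg},k}\le\dfrac{4\delta k}{\delta-1}$ and $\hat T_{\mathrm{avg},k}\le k+qT_{\mathrm{avg},k}$. 3. $\hat f_{\mathrm{avg},k}$ is square-integrable and $E(\hat f_{\mathrm{avg},k})=\theta^*$. 4. $E(L(\hat f_{\mathrm{avg},k}))$ is finite and $$E(L(\hat f_{\mathrm{avg},k}))-L(\theta^*)\le\frac1{2qk}\left(\frac{27c}{\alpha}+6c\left(4\ln\left(\frac{4\delta+8}{\alpha\xi}\right)\right)^{\delta+1}\right).$$ -/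

import Mathlib

open MeasureTheory ProbabilityTheory
open scoped ENNReal Matrix

namespace AvgStartSGD

noncomputable section

/-- Covariate / parameter vectors: column vectors with the Euclidean norm. -/
abbrev Vec (d : ℕ) : Type := EuclideanSpace ℝ (Fin d)

/-- A sample `(x, y)`. -/
abbrev Sample (d : ℕ) : Type := Vec d × ℝ

/-! ### The regression problem attached to a random pair `(x, y)` -/

section Regression

variable {Ω₀ : Type*} [MeasurableSpace Ω₀] {d : ℕ}

/-- The least squares risk `L(θ) = E((y - xᵀθ)²) / 2`. -/
def risk (P₀ : Measure Ω₀) (x : Ω₀ → Vec d) (y : Ω₀ → ℝ) (θ : Vec d) : ℝ :=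
  (1 / 2) * ∫ ω, (y ω - inner ℝ (x ω) θ) ^ 2 ∂P₀

/-- The Hessian matrix `H = E(x xᵀ)`. -/
def hessian (P₀ : Measure Ω₀) (x : Ω₀ → Vec d) : Matrix (Fin d) (Fin d) ℝ :=
  Matrix.of fun i j => ∫ ω, x ω i * x ω j ∂P₀

/-- The normal equation `H θ = E(y x)`. -/
def NormalEq (P₀ : Measure Ω₀) (x : Ω₀ → Vec d) (y : Ω₀ → ℝ) (θ : Vec d) : Prop :=
  ∀ i, (hessian P₀ x *ᵥ θ.ofLp) i = ∫ ω, y ω * x ω i ∂P₀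

/-- The matrix `E(w x xᵀ)` exists, and `E(w x xᵀ) ≼ a H` in the Loewner order. -/
def WeightedMomentLE (P₀ : Measure Ω₀) (x : Ω₀ → Vec d) (w : Ω₀ → ℝ) (a : ℝ) : Prop :=
  (∀ i j, Integrable (fun ω => w ω * (x ω i * x ω j)) P₀) ∧
    (a • hessian P₀ x - Matrix.of fun i j => ∫ ω, w ω * (x ω i * x ω j) ∂P₀).PosSemidef

/-- The standing moment assumption:
`E((y - xᵀθ*)² x xᵀ) ≼ σ² H` and `E(‖x‖² x xᵀ) ≼ R² H`. -/
def MomentAssumption (P₀ : Measure Ω₀) (x : Ω₀ → Vec d) (y : Ω₀ → ℝ) (θstar : Vec d)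
    (σ R : ℝ) : Prop :=
  WeightedMomentLE P₀ x (fun ω => (y ω - inner ℝ (x ω) θstar) ^ 2) (σ ^ 2) ∧
    WeightedMomentLE P₀ x (fun ω => ‖x ω‖ ^ 2) (R ^ 2)

end Regression

/-- The smallest eigenvalue of a real symmetric matrix (its spectrum is finite). -/
def lambdaMin {d : ℕ} (H : Matrix (Fin d) (Fin d) ℝ) : ℝ := sInf (spectrum ℝ H)

/-- `c = σ² d / (2 - γR²)² + ‖θ₀ - θ*‖² / (γ (2 - γR²))`. -/
def constC {d : ℕ} (γ σ R : ℝ) (θ₀ θstar : Vec d) : ℝ :=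
  σ ^ 2 * d / (2 - γ * R ^ 2) ^ 2 + ‖θ₀ - θstar‖ ^ 2 / (γ * (2 - γ * R ^ 2))

/-- `ξ = γ (2 - γR²) λ_min`. -/
def constXi {d : ℕ} (γ R : ℝ) (H : Matrix (Fin d) (Fin d) ℝ) : ℝ :=
  γ * (2 - γ * R ^ 2) * lambdaMin H

/-- `p_l = 1 / (2^l (l+1)^δ) - 1 / (2^(l+1) (l+2)^δ)`. -/
def levelProb (δ : ℝ) (l : ℕ) : ℝ :=
  1 / (2 ^ l * ((l : ℝ) + 1) ^ δ) - 1 / (2 ^ (l + 1) * ((l : ℝ) + 2) ^ δ)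

/-! ### Stochastic gradient descent and the estimators

Below `z : ℤ → Sample d` is a realization of the sequence `(x_t, y_t)`, `t ∈ ℤ`. -/

section Estimators

variable {d : ℕ}

/-- One step `θ ↦ θ - γ (xᵀθ - y) x`. -/
def sgdStep (γ : ℝ) (z : Sample d) (θ : Vec d) : Vec d :=
  θ - (γ * (inner ℝ z.1 θ - z.2)) • z.1

/-- `θ_{m : m+n}`: the iterate after `n` steps, started from `θ₀` at time `m`. -/
def sgdIter (γ : ℝ) (θ₀ : Vec d) (z : ℤ → Sample d) (m : ℤ) : ℕ → Vec d
  | 0 => θ₀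
  | n + 1 => sgdStep γ (z (m + n)) (sgdIter γ θ₀ z m n)

/-- `θ_{m : t}` for `t ≥ m`. -/
def theta (γ : ℝ) (θ₀ : Vec d) (z : ℤ → Sample d) (m t : ℤ) : Vec d :=
  sgdIter γ θ₀ z m (t - m).toNat

/-- The time-average estimator `(k - s)⁻¹ ∑_{t=s}^{k-1} θ_t` with burn-in `s`. -/
def thetaBar (γ : ℝ) (θ₀ : Vec d) (k s : ℕ) (z : ℤ → Sample d) : Vec d :=
  ((k : ℝ) - s)⁻¹ • ∑ t ∈ Finset.Ico s k, theta γ θ₀ z 0 t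

/-- Smallest possible value of `τ(k, l)`. -/
def lagLo (k s : ℕ) : ℕ → ℕ
  | 0 => s
  | l + 1 => k * (2 ^ (l + 1) - 1)

/-- Largest possible value of `τ(k, l)`. -/
def lagHi (k l : ℕ) : ℕ := k * (2 ^ (l + 1) - 1) - 1

/-- The set of possible values of `τ(k, l)`. -/
def lagSet (k s l : ℕ) : Finset ℕ := Finset.Icc (lagLo k s l) (lagHi k l)

/-- `f_{avg,k,l}`: the average of `θ_{-t : 0}`, as `t` ranges over the values of `τ(k, l)`. -/
def fAvg (γ : ℝ) (θ₀ : Vec d) (k s : ℕ) (z : ℤ → Sample d) : ℕ → Vec d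
  | 0 => ((k : ℝ) - s)⁻¹ • ∑ t ∈ Finset.Ico s k, theta γ θ₀ z (-(t : ℤ)) 0
  | l + 1 => ((k : ℝ) * 2 ^ (l + 1))⁻¹ •
      ∑ t ∈ Finset.Ico (k * (2 ^ (l + 1) - 1)) (k * (2 ^ (l + 2) - 1)), theta γ θ₀ z (-(t : ℤ)) 0

/-- `Z_{avg,k} = (f_{avg,k,N+1} - f_{avg,k,N}) / p_N`, for given values of the samples and of
`N = l`. -/
def zAvg (γ δ : ℝ) (θ₀ : Vec d) (k s : ℕ) (z : ℤ → Sample d) (l : ℕ) : Vec d :=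
  (levelProb δ l)⁻¹ • (fAvg γ θ₀ k s z (l + 1) - fAvg γ θ₀ k s z l)

/-- `θ̄_k + q⁻¹ Q Z'`, where the Bernoulli variable `Q` is encoded as a boolean. -/
def fHat (q : ℝ) (θbar : Vec d) (Q : Bool) (Z : Vec d) : Vec d :=
  θbar + (q⁻¹ * (if Q then 1 else 0)) • Z

end Estimators

/-! ### Simulation and running time

Running time is the number of simulated samples.  A simulation is a program that may draw samples,
one at a time; samples carry a label in `ι`, which only serves to name them. -/

/-- A program that draws samples and returns an element of `A`. -/
inductive Prog (d : ℕ) (ι A : Type) : Type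
  | ret (a : A) : Prog d ι A
  | draw (i : ι) (next : Sample d → Prog d ι A) : Prog d ι A

namespace Prog

variable {d : ℕ} {ι A B : Type}

/-- Sequential composition. -/
def bind : Prog d ι A → (A → Prog d ι B) → Prog d ι B
  | ret a, g => g a
  | draw i next, g => draw i fun z => (next z).bind g

/-- The output of a program, given the values of the samples. -/
def eval : Prog d ι A → (ι → Sample d) → A
  | ret a, _ => a
  | draw i next, z => (next (z i)).eval z

/-- The running time of a program: the number of draws that it executes. -/
def time : Prog d ι A → (ι → Sample d) → ℕ
  | ret _, _ => 0
  | draw i next, z => (next (z i)).time z + 1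

end Prog

section Programs

variable {d : ℕ} {ι : Type}

/-- The update `η_t ↦ η_{t+1}` at time `t = -r`, in the one-pass computation of the average of
`θ_{h : 0}` over `m ≤ h ≤ m'`, with `m = -b` and `m' = -a`.  Before time `m`, the computation has
not started and the state is `η_m = θ₀`. -/
def etaUpdate (γ : ℝ) (θ₀ : Vec d) (a b r : ℕ) (z : Sample d) (η : Vec d) : Vec d :=
  if b < r then θ₀
  else if a < r then
    ((b : ℝ) - r + 2)⁻¹ • (((b : ℝ) - r + 1) • sgdStep γ z η + θ₀)
  else sgdStep γ z η

/-- Draws the samples at times `-r, …, -1`, and updates the states of levels `l + 1` and `l`. -/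
def zAvgLoop (γ : ℝ) (θ₀ : Vec d) (k s : ℕ) (e : ℤ → ι) (l : ℕ) :
    ℕ → Vec d → Vec d → Prog d ι (Vec d × Vec d)
  | 0, η₁, η₀ => .ret (η₁, η₀)
  | r + 1, η₁, η₀ => .draw (e (-((r : ℤ) + 1))) fun z =>
      zAvgLoop γ θ₀ k s e l r
        (etaUpdate γ θ₀ (lagLo k s (l + 1)) (lagHi k (l + 1)) (r + 1) z η₁)
        (etaUpdate γ θ₀ (lagLo k s l) (lagHi k l) (r + 1) z η₀)

/-- Simulation of `Z_{avg,k}`, given that `N = l`. -/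
def zAvgProg (γ δ : ℝ) (θ₀ : Vec d) (k s : ℕ) (e : ℤ → ι) (l : ℕ) : Prog d ι (Vec d) :=
  (zAvgLoop γ θ₀ k s e l (lagHi k (l + 1)) θ₀ θ₀).bind fun η =>
    .ret ((levelProb δ l)⁻¹ • (η.1 - η.2))

/-- Draws the next `r` samples from time `t` on; `θ` is the iterate at time `t`, and `S` the sum of
the iterates so far, from time `s` on. -/
def thetaBarLoop (γ : ℝ) (s : ℕ) (e : ℤ → ι) : ℕ → ℕ → Vec d → Vec d → Prog d ι (Vec d)
  | 0, _, _, S => .ret S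
  | r + 1, t, θ, S => .draw (e t) fun z =>
      thetaBarLoop γ s e r (t + 1) (sgdStep γ z θ)
        (if s ≤ t + 1 then S + sgdStep γ z θ else S)

/-- Simulation of the time-average estimator. -/
def thetaBarProg (γ : ℝ) (θ₀ : Vec d) (k s : ℕ) (e : ℤ → ι) : Prog d ι (Vec d) :=
  (thetaBarLoop γ s e (k - 1) 0 θ₀ (if s ≤ 0 then θ₀ else 0)).bind fun S =>
    .ret (((k : ℝ) - s)⁻¹ • S)

/-- Simulation of `f̂_{avg,k}`, given the values of `Q` and of `N' = l`: the copy of `Z_{avg,k}` is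
simulated, from a second family of samples, only if `Q = 1`. -/
def fHatProg (γ δ q : ℝ) (θ₀ : Vec d) (k s : ℕ) (Q : Bool) (l : ℕ) : Prog d (ℤ ⊕ ℤ) (Vec d) :=
  (thetaBarProg γ θ₀ k s Sum.inl).bind fun θbar =>
    if Q then (zAvgProg γ δ θ₀ k s Sum.inr l).bind fun Z => .ret (θbar + q⁻¹ • Z)
    else .ret θbar

end Programs

/-- `T_{avg,k}`: the expected time to simulate `Z_{avg,k}`. -/
def expectedTimeZ {Ω : Type*} [MeasurableSpace Ω] {d : ℕ} (P : Measure Ω) (γ δ : ℝ) (θ₀ : Vec d)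
    (k s : ℕ) (z : ℤ → Ω → Sample d) (N : Ω → ℕ) : ℝ≥0∞ :=
  ∫⁻ ω, ((zAvgProg γ δ θ₀ k s id (N ω)).time (fun t => z t ω) : ℝ≥0∞) ∂P

/-- `T̂_{avg,k}`: the expected time to simulate `f̂_{avg,k}`; the samples `z` are used for the
time-average, and the samples `z'` for the copy of `Z_{avg,k}`. -/
def expectedTimeFHat {Ω : Type*} [MeasurableSpace Ω] {d : ℕ} (P : Measure Ω) (γ δ q : ℝ)
    (θ₀ : Vec d) (k s : ℕ) (z z' : ℤ → Ω → Sample d) (Q : Ω → Bool) (N' : Ω → ℕ) : ℝ≥0∞ :=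
  ∫⁻ ω, ((fHatProg γ δ q θ₀ k s (Q ω) (N' ω)).time
    (Sum.elim (fun t => z t ω) (fun t => z' t ω)) : ℝ≥0∞) ∂P

end

end AvgStartSGD

open AvgStartSGD

set_option linter.unusedSectionVars false

/-! Subtract θ* and replace each response by its residual (`sgdIter_sub_eq_residual`). The target
becomes 0, the excess risk becomes half the quadratic form of H (`risk_eq`), and an iterate splits
into a noise part, started at 0, and a linear part, a product of random matrices I - γxxᵀ applied to
the start. Let κ = γ(2 - γR²). One linear step lowers the mean squared norm by at least κ vᵀHv. This
single inequality yields geometric decay at rate 1 - ξ, a bound on the sum of the quadratic forms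
along a run (`sum_quadForm_linIter_le`), and the invariance of the covariance bound aI, with a =
γσ²/(2 - γR²), for the noise part (`integral_inner_sq_sgdStep_le`).

Time average: the mean step is I - γH, so the correlations of one iterate with the later ones
telescope, and the quadratic form of the centred θ̄_k has mean O(c/(k - s)).

Consecutive levels: runs started at -t and at -u, with u ≤ t, share their last u samples, so their
noise parts differ by a linear part applied to an independent vector of covariance at most aI.
Averaging over a window of starting times and telescoping gives O(c(1 - ξ)^lo / card), where lo is
the smallest lag of the lower level and card its number of lags
(`integral_quadForm_startAvg_sub_le`). The factor 1/p_l ≤ 2^(l+1) (l+1)^δ cancels against card = k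
2^l and leaves (l+1)^δ exp(-ξ 2^l), so only logarithmically many levels matter (`sum_levelTerm_le`).

Unbiasedness: the mean of Z telescopes to lim E f_l - E f_0, and by stationarity E f_0 = E θ̄_k. In
centred coordinates E Z = -E θ̄_k, which also makes the cross term in the second moment of θ̄_k +
q⁻¹QZ' nonpositive (`integral_quadForm_fHat_le`).

Simulation: an SGD step is affine and commutes with averages, so one state carries the average of
all runs (`etaUpdate_etaState`). Level l costs at most 4k 2^l draws and 2^l p_l ≤ (l+1)^(-δ), which
is summable as δ > 1. -/

namespace AvgStartSGD

/-! ### Algebra of the SGD recursion -/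

section Algebra

variable {d : ℕ}

/-- The samples with the responses set to zero. -/
def noiseFree (z : Sample d) : Sample d := (z.1, 0)

/-- The samples with the responses replaced by the residuals at `θ`. -/
noncomputable def residual (θ : Vec d) (z : Sample d) : Sample d := (z.1, z.2 - inner ℝ z.1 θ)

/-- The step is the affine map v ↦ (I - γxxᵀ)v + γyx, so an added vector meets only its linear part.
-/
theorem sgdStep_add (γ : ℝ) (z : Sample d) (v w : Vec d) :
    sgdStep γ z (v + w) = sgdStep γ z v + sgdStep γ (noiseFree z) w := by
  simp only [sgdStep, noiseFree, inner_add_right, sub_zero]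
  module

theorem sgdStep_noiseFree_smul (γ : ℝ) (z : Sample d) (c : ℝ) (v : Vec d) :
    sgdStep γ (noiseFree z) (c • v) = c • sgdStep γ (noiseFree z) v := by
  simp only [sgdStep, noiseFree, inner_smul_right, sub_zero]
  module

theorem sgdIter_add_start (γ : ℝ) (z : ℤ → Sample d) (m : ℤ) (n : ℕ) (v w : Vec d) :
    sgdIter γ (v + w) z m n =
      sgdIter γ v z m n + sgdIter γ w (fun t => noiseFree (z t)) m n := by
  induction n with
  | zero => rfl
  | succ n ih => simp only [sgdIter, ih, sgdStep_add]

/-- The linear part of the SGD recursion. -/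
noncomputable def linIter (γ : ℝ) (z : ℤ → Sample d) (m : ℤ) (n : ℕ) : Vec d →ₗ[ℝ] Vec d where
  toFun v := sgdIter γ v (fun t => noiseFree (z t)) m n
  map_add' v w := sgdIter_add_start γ (fun t => noiseFree (z t)) m n v w
  map_smul' c v := by
    induction n with
    | zero => rfl
    | succ n ih =>
      simp only [RingHom.id_apply] at ih
      simp only [sgdIter, ih, sgdStep_noiseFree_smul, RingHom.id_apply]

theorem linIter_zero (γ : ℝ) (z : ℤ → Sample d) (m : ℤ) (v : Vec d) :
    linIter γ z m 0 v = v := rfl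

theorem linIter_succ (γ : ℝ) (z : ℤ → Sample d) (m : ℤ) (n : ℕ) (v : Vec d) :
    linIter γ z m (n + 1) v = sgdStep γ (noiseFree (z (m + n))) (linIter γ z m n v) := rfl

theorem sgdIter_eq_add_linIter (γ : ℝ) (z : ℤ → Sample d) (m : ℤ) (n : ℕ) (v w : Vec d) :
    sgdIter γ (v + w) z m n = sgdIter γ v z m n + linIter γ z m n w :=
  sgdIter_add_start γ z m n v w

theorem sgdIter_add_steps (γ : ℝ) (θ : Vec d) (z : ℤ → Sample d) (m : ℤ) (i j : ℕ) :
    sgdIter γ θ z m (i + j) = sgdIter γ (sgdIter γ θ z m i) z (m + i) j := by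
  induction j with
  | zero => rfl
  | succ j ih =>
    rw [← add_assoc]
    simp only [sgdIter, ih]
    congr 2
    push_cast
    ring

/-- This moves the minimizer to the origin; all moment estimates are proved for the centred
recursion, whose noise is uncorrelated with x. -/
theorem sgdIter_sub_eq_residual (γ : ℝ) (θ θs : Vec d) (z : ℤ → Sample d) (m : ℤ) (n : ℕ) :
    sgdIter γ θ z m n - θs = sgdIter γ (θ - θs) (fun t => residual θs (z t)) m n := by
  induction n with
  | zero => rfl
  | succ n ih =>
    change _ = sgdStep γ (residual θs (z (m + n))) (sgdIter γ (θ - θs) _ m n)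
    rw [← ih]
    simp only [sgdIter, sgdStep, residual, inner_sub_right]
    module

theorem sgdIter_shift (γ : ℝ) (θ : Vec d) (z : ℤ → Sample d) (m : ℤ) (n : ℕ) :
    sgdIter γ θ z m n = sgdIter γ θ (fun t => z (t + m)) 0 n := by
  induction n with
  | zero => rfl
  | succ n ih =>
    simp only [sgdIter, ih]
    congr 2
    ring

theorem measurable_sgdStep (γ : ℝ) :
    Measurable fun p : Sample d × Vec d => sgdStep γ p.1 p.2 := by
  unfold sgdStep
  exact (by fun_prop : Continuous fun p : Sample d × Vec d =>
    p.2 - (γ * (inner ℝ p.1.1 p.2 - p.1.2)) • p.1.1).measurable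

theorem measurable_noiseFree : Measurable (noiseFree : Sample d → Sample d) := by
  unfold noiseFree; fun_prop

theorem measurable_residual (θ : Vec d) : Measurable (residual θ : Sample d → Sample d) := by
  unfold residual; fun_prop

/-- The `σ`-algebra generated by the samples at times in `S`. -/
abbrev samplesIn {Ω : Type*} (z : ℤ → Ω → Sample d) (S : Set ℤ) : MeasurableSpace Ω :=
  ⨆ t ∈ S, MeasurableSpace.comap (z t) inferInstance

theorem measurable_samplesIn {Ω : Type*} (z : ℤ → Ω → Sample d) {S : Set ℤ} {t : ℤ}
    (ht : t ∈ S) : Measurable[samplesIn z S] (z t) := by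
  rw [measurable_iff_comap_le]
  exact le_iSup₂ (f := fun t (_ : t ∈ S) => MeasurableSpace.comap (z t) inferInstance) t ht

theorem samplesIn_le {Ω : Type*} [mΩ : MeasurableSpace Ω] {z : ℤ → Ω → Sample d}
    (hz : ∀ t, Measurable (z t)) (S : Set ℤ) : samplesIn z S ≤ mΩ :=
  iSup₂_le fun t _ => (hz t).comap_le

theorem measurable_sgdIter_map {Ω : Type*} (γ : ℝ) (θ : Vec d) (z : ℤ → Ω → Sample d)
    {φ : Sample d → Sample d} (hφ : Measurable φ) (m : ℤ) (n : ℕ) {S : Set ℤ}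
    (hS : Set.Ico m (m + n) ⊆ S) :
    Measurable[samplesIn z S] fun ω => sgdIter γ θ (fun t => φ (z t ω)) m n := by
  induction n with
  | zero => exact measurable_const
  | succ n ih =>
    have h1 := ih (subset_trans (Set.Ico_subset_Ico_right (by push_cast; linarith)) hS)
    have h2 : Measurable[samplesIn z S] (z (m + n)) :=
      measurable_samplesIn z (hS ⟨by linarith [Int.natCast_nonneg n], by push_cast; linarith⟩)
    exact (measurable_sgdStep γ).comp ((hφ.comp h2).prodMk h1)

theorem measurable_sgdIter {Ω : Type*} (γ : ℝ) (θ : Vec d) (z : ℤ → Ω → Sample d)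
    (m : ℤ) (n : ℕ) {S : Set ℤ} (hS : Set.Ico m (m + n) ⊆ S) :
    Measurable[samplesIn z S] fun ω => sgdIter γ θ (fun t => z t ω) m n :=
  measurable_sgdIter_map γ θ z measurable_id m n hS

theorem measurable_linIter {Ω : Type*} (γ : ℝ) (v : Vec d) (z : ℤ → Ω → Sample d)
    (m : ℤ) (n : ℕ) {S : Set ℤ} (hS : Set.Ico m (m + n) ⊆ S) :
    Measurable[samplesIn z S] fun ω => linIter γ (fun t => z t ω) m n v :=
  measurable_sgdIter_map γ v z measurable_noiseFree m n hS

theorem measurable_sgdIter_path (γ : ℝ) (θ : Vec d) (m : ℤ) (n : ℕ) :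
    Measurable fun z : ℤ → Sample d => sgdIter γ θ z m n := by
  induction n with
  | zero => exact measurable_const
  | succ n ih =>
    have h : Measurable fun z : ℤ → Sample d => z (m + n) := measurable_pi_apply _
    exact (measurable_sgdStep γ).comp (h.prodMk ih)

end Algebra

/-! ### Integration over independent pairs -/

section Indep

variable {Ω E F : Type*} [MeasurableSpace Ω] {P : Measure Ω} [IsProbabilityMeasure P]
  [MeasurableSpace E] [MeasurableSpace F] {V : Ω → E} {Z : Ω → F}

/-- Fubini on the product law, for a nonnegative integrand. Integrability is part of the conclusion,
so that second moments can be propagated from step to step. -/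
theorem integrable_and_integral_le_of_indepFun (hV : AEMeasurable V P) (hZ : AEMeasurable Z P)
    (hVZ : IndepFun V Z P) {f : E → F → ℝ} (hf : Measurable (Function.uncurry f))
    (hf0 : ∀ v z, 0 ≤ f v z) {g : E → ℝ} (hg : Measurable g)
    (hint : ∀ v, Integrable (f v) (P.map Z))
    (hle : ∀ v, ∫ z, f v z ∂(P.map Z) ≤ g v) (hgV : Integrable (fun ω => g (V ω)) P) :
    Integrable (fun ω => f (V ω) (Z ω)) P ∧ ∫ ω, f (V ω) (Z ω) ∂P ≤ ∫ ω, g (V ω) ∂P := by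
  have : IsProbabilityMeasure (P.map Z) := Measure.isProbabilityMeasure_map hZ
  have hmap := (indepFun_iff_map_prod_eq_prod_map_map hV hZ).1 hVZ
  have hg' : Integrable g (P.map V) := (integrable_map_measure hg.aestronglyMeasurable hV).2 hgV
  have hmeas : StronglyMeasurable fun v => ∫ z, f v z ∂(P.map Z) :=
    hf.stronglyMeasurable.integral_prod_right
  have hI : Integrable (fun v => ∫ z, f v z ∂(P.map Z)) (P.map V) := by
    refine hg'.mono' hmeas.aestronglyMeasurable (ae_of_all _ fun v => ?_)
    rw [Real.norm_of_nonneg (integral_nonneg (hf0 v))]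
    exact hle v
  have hprod : Integrable (Function.uncurry f) ((P.map V).prod (P.map Z)) := by
    rw [integrable_prod_iff hf.aestronglyMeasurable]
    refine ⟨ae_of_all _ hint, ?_⟩
    simpa only [Function.uncurry, Real.norm_of_nonneg (hf0 _ _)] using hI
  have hprod' := hprod
  rw [← hmap] at hprod'
  have hVZm := hV.prodMk hZ
  refine ⟨(integrable_map_measure hf.aestronglyMeasurable hVZm).1 hprod', ?_⟩
  calc ∫ ω, f (V ω) (Z ω) ∂P
      = ∫ p, Function.uncurry f p ∂(P.map fun ω => (V ω, Z ω)) :=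
        (integral_map hVZm hf.aestronglyMeasurable).symm
    _ = ∫ v, ∫ z, f v z ∂(P.map Z) ∂(P.map V) := by
        rw [hmap, integral_prod _ hprod]; rfl
    _ ≤ ∫ v, g v ∂(P.map V) := integral_mono hI hg' hle
    _ = ∫ ω, g (V ω) ∂P := integral_map hV hg.aestronglyMeasurable

theorem integral_eq_of_indepFun {G : Type*} [NormedAddCommGroup G] [NormedSpace ℝ G]
    [MeasurableSpace G] [BorelSpace G] [SecondCountableTopology G]
    (hV : AEMeasurable V P) (hZ : AEMeasurable Z P)
    (hVZ : IndepFun V Z P) {f : E → F → G} (hf : Measurable (Function.uncurry f))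
    {g : E → G} (hg : Measurable g) (hint : Integrable (fun ω => f (V ω) (Z ω)) P)
    (hfg : ∀ v, ∫ z, f v z ∂(P.map Z) = g v) :
    Integrable g (P.map V) ∧ ∫ ω, f (V ω) (Z ω) ∂P = ∫ ω, g (V ω) ∂P := by
  have : IsProbabilityMeasure (P.map Z) := Measure.isProbabilityMeasure_map hZ
  have hmap := (indepFun_iff_map_prod_eq_prod_map_map hV hZ).1 hVZ
  have hVZm := hV.prodMk hZ
  have hprod : Integrable (Function.uncurry f) ((P.map V).prod (P.map Z)) := by
    rw [← hmap]
    exact (integrable_map_measure hf.aestronglyMeasurable hVZm).2 hint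
  refine ⟨by simpa only [Function.uncurry, hfg] using hprod.integral_prod_left, ?_⟩
  calc ∫ ω, f (V ω) (Z ω) ∂P
      = ∫ p, Function.uncurry f p ∂(P.map fun ω => (V ω, Z ω)) :=
        (integral_map hVZm hf.aestronglyMeasurable).symm
    _ = ∫ v, ∫ z, f v z ∂(P.map Z) ∂(P.map V) := by
        rw [hmap, integral_prod _ hprod]; rfl
    _ = ∫ v, g v ∂(P.map V) := by simp only [hfg]
    _ = ∫ ω, g (V ω) ∂P := integral_map hV hg.aestronglyMeasurable

end Indep

/-! ### Integrability of quadratic expressions in square-integrable vectors -/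

section Integrability

variable {Ω E : Type*} [MeasurableSpace Ω] {P : Measure Ω} [NormedAddCommGroup E]
  [InnerProductSpace ℝ E]

theorem integrable_inner_of_memLp {U V : Ω → E} (hU : MemLp U 2 P) (hV : MemLp V 2 P) :
    Integrable (fun ω => inner ℝ (U ω) (V ω)) P := by
  have hU2 := (memLp_two_iff_integrable_sq_norm hU.1).1 hU
  have hV2 := (memLp_two_iff_integrable_sq_norm hV.1).1 hV
  refine (hU2.add hV2).mono' (hU.1.inner hV.1) (ae_of_all _ fun ω => ?_)
  have := abs_real_inner_le_norm (U ω) (V ω)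
  simp only [Real.norm_eq_abs, Pi.add_apply]
  nlinarith [sq_nonneg (‖U ω‖ - ‖V ω‖), sq_nonneg (‖U ω‖), sq_nonneg (‖V ω‖)]

theorem integrable_quadForm (H : E →L[ℝ] E) {V : Ω → E} (hV : MemLp V 2 P) :
    Integrable (fun ω => inner ℝ (V ω) (H (V ω))) P :=
  integrable_inner_of_memLp hV (H.comp_memLp' hV)

theorem integrable_bilin (H : E →L[ℝ] E) {U V : Ω → E} (hU : MemLp U 2 P) (hV : MemLp V 2 P) :
    Integrable (fun ω => inner ℝ (U ω) (H (V ω))) P :=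
  integrable_inner_of_memLp hU (H.comp_memLp' hV)

theorem integrable_normSq {V : Ω → E} (hV : MemLp V 2 P) : Integrable (fun ω => ‖V ω‖ ^ 2) P :=
  (memLp_two_iff_integrable_sq_norm hV.1).1 hV

end Integrability

/-! ### One step of SGD -/

section OneStep

variable {d : ℕ}

/-- The moment conditions on the law of a sample whose response has been replaced by the residual
at the minimizer of the risk; `H` is the Hessian. -/
structure CenteredLaw (ν : Measure (Sample d)) (H : Vec d →L[ℝ] Vec d) (σ R : ℝ) : Prop where
  integrable_inner_mul : ∀ u v, Integrable (fun z : Sample d => inner ℝ z.1 u * inner ℝ z.1 v) ν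
  integral_inner_mul : ∀ u v, ∫ z : Sample d, inner ℝ z.1 u * inner ℝ z.1 v ∂ν = inner ℝ u (H v)
  integrable_normSq_mul : ∀ v, Integrable (fun z : Sample d => ‖z.1‖ ^ 2 * inner ℝ z.1 v ^ 2) ν
  integral_normSq_mul_le : ∀ v,
    ∫ z : Sample d, ‖z.1‖ ^ 2 * inner ℝ z.1 v ^ 2 ∂ν ≤ R ^ 2 * inner ℝ v (H v)
  integrable_noiseSq_mul : ∀ v, Integrable (fun z : Sample d => z.2 ^ 2 * inner ℝ z.1 v ^ 2) ν
  integral_noiseSq_mul_le : ∀ v,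
    ∫ z : Sample d, z.2 ^ 2 * inner ℝ z.1 v ^ 2 ∂ν ≤ σ ^ 2 * inner ℝ v (H v)
  integrable_noise_mul : ∀ v, Integrable (fun z : Sample d => z.2 * inner ℝ z.1 v) ν
  integral_noise_mul : ∀ v, ∫ z : Sample d, z.2 * inner ℝ z.1 v ∂ν = 0

namespace CenteredLaw

variable {ν : Measure (Sample d)} {H : Vec d →L[ℝ] Vec d} {σ R γ : ℝ}

theorem quadForm_nonneg (h : CenteredLaw ν H σ R) (v : Vec d) : 0 ≤ inner ℝ v (H v) := by
  rw [← h.integral_inner_mul]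
  exact integral_nonneg fun z => mul_self_nonneg _

theorem bilin_comm (h : CenteredLaw ν H σ R) (u v : Vec d) : inner ℝ u (H v) = inner ℝ v (H u) := by
  rw [← h.integral_inner_mul, ← h.integral_inner_mul]
  simp only [mul_comm]

theorem quadForm_add (h : CenteredLaw ν H σ R) (u v : Vec d) :
    inner ℝ (u + v) (H (u + v)) =
      inner ℝ u (H u) + 2 * inner ℝ u (H v) + inner ℝ v (H v) := by
  rw [map_add, inner_add_left, inner_add_right, inner_add_right, h.bilin_comm v u]
  ring

theorem quadForm_smul (H : Vec d →L[ℝ] Vec d) (c : ℝ) (v : Vec d) :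
    inner ℝ (c • v) (H (c • v)) = c ^ 2 * inner ℝ v (H v) := by
  rw [map_smul, real_inner_smul_left, real_inner_smul_right]; ring

theorem quadForm_add_le (h : CenteredLaw ν H σ R) (u v : Vec d) :
    inner ℝ (u + v) (H (u + v)) ≤ 2 * inner ℝ u (H u) + 2 * inner ℝ v (H v) := by
  have h1 := h.quadForm_nonneg (u + (-1 : ℝ) • v)
  rw [h.quadForm_add, quadForm_smul, map_smul, real_inner_smul_right] at h1
  rw [h.quadForm_add]
  linarith

/-- Cauchy–Schwarz, obtained by summing 2uᵀHv ≤ uᵀHu + vᵀHv over all pairs. -/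
theorem quadForm_sum_le (h : CenteredLaw ν H σ R) {ι : Type*} (s : Finset ι) (f : ι → Vec d) :
    inner ℝ (∑ i ∈ s, f i) (H (∑ i ∈ s, f i)) ≤ s.card * ∑ i ∈ s, inner ℝ (f i) (H (f i)) := by
  have hpair : ∀ u v : Vec d, 2 * inner ℝ u (H v) ≤ inner ℝ u (H u) + inner ℝ v (H v) := by
    intro u v
    have h1 := h.quadForm_nonneg (u + (-1 : ℝ) • v)
    rw [h.quadForm_add, quadForm_smul, map_smul, real_inner_smul_right] at h1
    linarith
  have h2 : 2 * inner ℝ (∑ i ∈ s, f i) (H (∑ i ∈ s, f i)) ≤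
      ∑ i ∈ s, ∑ j ∈ s, (inner ℝ (f i) (H (f i)) + inner ℝ (f j) (H (f j))) := by
    rw [map_sum, sum_inner, Finset.mul_sum]
    refine Finset.sum_le_sum fun i _ => ?_
    rw [inner_sum, Finset.mul_sum]
    exact Finset.sum_le_sum fun j _ => hpair _ _
  simp only [Finset.sum_add_distrib, Finset.sum_const, nsmul_eq_mul, ← Finset.mul_sum] at h2
  linarith

/-- Convexity of the quadratic form of `H`, for uniform averages. -/
theorem quadForm_average_le (h : CenteredLaw ν H σ R) {ι : Type*} {s : Finset ι}
    (hs : s.Nonempty) (f : ι → Vec d) :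
    inner ℝ ((s.card : ℝ)⁻¹ • ∑ i ∈ s, f i) (H ((s.card : ℝ)⁻¹ • ∑ i ∈ s, f i)) ≤
      (s.card : ℝ)⁻¹ * ∑ i ∈ s, inner ℝ (f i) (H (f i)) := by
  have hc : (0 : ℝ) < s.card := by exact_mod_cast hs.card_pos
  rw [quadForm_smul]
  calc ((s.card : ℝ)⁻¹) ^ 2 * inner ℝ (∑ i ∈ s, f i) (H (∑ i ∈ s, f i))
      ≤ ((s.card : ℝ)⁻¹) ^ 2 * (s.card * ∑ i ∈ s, inner ℝ (f i) (H (f i))) := by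
        gcongr; exact h.quadForm_sum_le s f
    _ = _ := by field_simp

theorem normSq_sgdStep_noiseFree (γ : ℝ) (z : Sample d) (v : Vec d) :
    ‖sgdStep γ (noiseFree z) v‖ ^ 2 = ‖v‖ ^ 2 - 2 * γ * (inner ℝ z.1 v * inner ℝ z.1 v) +
      γ ^ 2 * (‖z.1‖ ^ 2 * inner ℝ z.1 v ^ 2) := by
  simp only [sgdStep, noiseFree, sub_zero]
  rw [norm_sub_sq_real, real_inner_smul_right, norm_smul, mul_pow, Real.norm_eq_abs, sq_abs,
    real_inner_comm]
  ring

variable [IsProbabilityMeasure ν]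

theorem integrable_normSq_sgdStep_noiseFree (h : CenteredLaw ν H σ R) (γ : ℝ) (v : Vec d) :
    Integrable (fun z => ‖sgdStep γ (noiseFree z) v‖ ^ 2) ν := by
  simp only [normSq_sgdStep_noiseFree]
  exact ((integrable_const _).sub ((h.integrable_inner_mul v v).const_mul _)).add
    ((h.integrable_normSq_mul v).const_mul _)

/-- In the expansion of the square, the first-order term has mean -2γ vᵀHv, and the fourth-moment
condition bounds the second-order term by γ²R² vᵀHv. All decay and all telescoping rest on this
inequality. -/
theorem integral_normSq_sgdStep_noiseFree_le (h : CenteredLaw ν H σ R) (γ : ℝ) (v : Vec d) :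
    ∫ z, ‖sgdStep γ (noiseFree z) v‖ ^ 2 ∂ν ≤
      ‖v‖ ^ 2 - γ * (2 - γ * R ^ 2) * inner ℝ v (H v) := by
  simp only [normSq_sgdStep_noiseFree]
  have i0 : Integrable (fun z : Sample d => ‖v‖ ^ 2 - 2 * γ * (inner ℝ z.1 v * inner ℝ z.1 v)) ν :=
    (integrable_const _).sub ((h.integrable_inner_mul v v).const_mul _)
  rw [integral_add i0 ((h.integrable_normSq_mul v).const_mul _),
    integral_sub (integrable_const _) ((h.integrable_inner_mul v v).const_mul _),
    integral_const_mul, integral_const_mul, h.integral_inner_mul]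
  simp only [integral_const, probReal_univ, one_smul]
  nlinarith [mul_le_mul_of_nonneg_left (h.integral_normSq_mul_le v) (sq_nonneg γ)]

/-- At a unit vector, which exists as d > 0, the contraction bound dominates a nonnegative mean.
Hence 1 - ξ is a legitimate decay rate. -/
theorem xi_le_one (h : CenteredLaw ν H σ R) {lam : ℝ} (hlam : ∀ v, lam * ‖v‖ ^ 2 ≤ inner ℝ v (H v))
    (hκ : 0 ≤ γ * (2 - γ * R ^ 2)) (hd : 0 < d) : γ * (2 - γ * R ^ 2) * lam ≤ 1 := by
  set v : Vec d := EuclideanSpace.single ⟨0, hd⟩ 1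
  have hv : ‖v‖ = 1 := by simp [v]
  have h1 := h.integral_normSq_sgdStep_noiseFree_le γ v
  have h2 : 0 ≤ ∫ z, ‖sgdStep γ (noiseFree z) v‖ ^ 2 ∂ν := integral_nonneg fun z => by positivity
  have h3 := mul_le_mul_of_nonneg_left (hlam v) hκ
  rw [hv] at h1 h3
  linarith

theorem integrable_noiseSq_normSq (h : CenteredLaw ν H σ R) :
    Integrable (fun z : Sample d => z.2 ^ 2 * ‖z.1‖ ^ 2) ν := by
  have : (fun z : Sample d => z.2 ^ 2 * ‖z.1‖ ^ 2) =
      fun z => ∑ j, z.2 ^ 2 * inner ℝ z.1 (EuclideanSpace.basisFun (Fin d) ℝ j) ^ 2 := by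
    funext z
    rw [← Finset.mul_sum, ← (EuclideanSpace.basisFun (Fin d) ℝ).sum_sq_norm_inner_left z.1]
    simp
  rw [this]
  exact integrable_finsetSum _ fun j _ => h.integrable_noiseSq_mul _

theorem normSq_sgdStep_le (γ : ℝ) (z : Sample d) (v : Vec d) :
    ‖sgdStep γ z v‖ ^ 2 ≤ 2 * ‖sgdStep γ (noiseFree z) v‖ ^ 2 +
      2 * γ ^ 2 * (z.2 ^ 2 * ‖z.1‖ ^ 2) := by
  have h1 : sgdStep γ z v = sgdStep γ (noiseFree z) v + (γ * z.2) • z.1 := by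
    simp only [sgdStep, noiseFree]; module
  have h2 : ‖(γ * z.2) • z.1‖ ^ 2 = γ ^ 2 * (z.2 ^ 2 * ‖z.1‖ ^ 2) := by
    rw [norm_smul, mul_pow, Real.norm_eq_abs, sq_abs]; ring
  rw [h1]
  have h3 := norm_add_le (sgdStep γ (noiseFree z) v) ((γ * z.2) • z.1)
  nlinarith [sq_nonneg (‖sgdStep γ (noiseFree z) v‖ - ‖(γ * z.2) • z.1‖),
    norm_nonneg (sgdStep γ (noiseFree z) v + (γ * z.2) • z.1)]

theorem integrable_normSq_sgdStep (h : CenteredLaw ν H σ R) (γ : ℝ) (v : Vec d) :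
    Integrable (fun z => ‖sgdStep γ z v‖ ^ 2) ν := by
  refine (((h.integrable_normSq_sgdStep_noiseFree γ v).const_mul 2).add
    (h.integrable_noiseSq_normSq.const_mul (2 * γ ^ 2))).mono' ?_ (ae_of_all _ fun z => ?_)
  · have : Measurable fun z : Sample d => sgdStep γ z v :=
      (measurable_sgdStep γ).comp (measurable_id.prodMk measurable_const)
    exact (this.norm.pow_const 2).aestronglyMeasurable
  · rw [Real.norm_of_nonneg (by positivity)]
    exact normSq_sgdStep_le γ z v

/-- A crude bound, which only serves to keep the iterates square-integrable; the uniform bound comes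
from the covariance recursion of the noise part. -/
theorem integral_normSq_sgdStep_le (h : CenteredLaw ν H σ R) (hκ : 0 ≤ γ * (2 - γ * R ^ 2))
    (v : Vec d) : ∫ z, ‖sgdStep γ z v‖ ^ 2 ∂ν ≤
      2 * ‖v‖ ^ 2 + 2 * γ ^ 2 * ∫ z : Sample d, z.2 ^ 2 * ‖z.1‖ ^ 2 ∂ν := by
  have h1 := (h.integrable_normSq_sgdStep_noiseFree γ v).const_mul 2
  have h2 := h.integrable_noiseSq_normSq.const_mul (2 * γ ^ 2)
  have h3 := integral_mono (h.integrable_normSq_sgdStep γ v) (h1.add h2)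
    fun z => normSq_sgdStep_le γ z v
  simp only [Pi.add_apply] at h3
  rw [integral_add h1 h2, integral_const_mul, integral_const_mul] at h3
  linarith [h.integral_normSq_sgdStep_noiseFree_le γ v,
    mul_nonneg hκ (h.quadForm_nonneg v)]

/-- The mean step is I - γH, since the noise is uncorrelated with x. -/
theorem integral_inner_sgdStep (h : CenteredLaw ν H σ R) (γ : ℝ) (u v : Vec d) :
    ∫ z, inner ℝ u (sgdStep γ z v) ∂ν = inner ℝ u v - γ * inner ℝ u (H v) := by
  have h1 : ∀ z : Sample d, inner ℝ u (sgdStep γ z v) =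
      inner ℝ u v - γ * (inner ℝ z.1 u * inner ℝ z.1 v) + γ * (z.2 * inner ℝ z.1 u) := by
    intro z
    simp only [sgdStep, inner_sub_right, real_inner_smul_right]
    rw [real_inner_comm u z.1]
    ring
  simp only [h1]
  have i1 := (h.integrable_inner_mul u v).const_mul γ
  have i2 := (h.integrable_noise_mul u).const_mul γ
  have i0 : Integrable
      (fun z : Sample d => inner ℝ u v - γ * (inner ℝ z.1 u * inner ℝ z.1 v)) ν :=
    (integrable_const _).sub i1
  rw [integral_add i0 i2, integral_sub (integrable_const _) i1,
    integral_const_mul, integral_const_mul, h.integral_inner_mul, h.integral_noise_mul]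
  simp

end CenteredLaw

/-- Independent samples with law `ν`. -/
structure IsStream {Ω : Type*} [MeasurableSpace Ω] (P : Measure Ω) (z : ℤ → Ω → Sample d)
    (ν : Measure (Sample d)) : Prop where
  measurable : ∀ t, Measurable (z t)
  iIndepFun : iIndepFun z P
  map_eq : ∀ t, P.map (z t) = ν

namespace IsStream

variable {Ω : Type*} [MeasurableSpace Ω] {P : Measure Ω} [IsProbabilityMeasure P]
  {z : ℤ → Ω → Sample d} {ν : Measure (Sample d)} {H : Vec d →L[ℝ] Vec d} {σ R γ : ℝ}

theorem isProbabilityMeasure (hz : IsStream P z ν) : IsProbabilityMeasure ν := by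
  rw [← hz.map_eq 0]; exact Measure.isProbabilityMeasure_map (hz.measurable 0).aemeasurable

theorem indepFun (hz : IsStream P z ν) {S T : Set ℤ} (hST : Disjoint S T) {E F : Type*}
    [MeasurableSpace E] [MeasurableSpace F] {V : Ω → E} {W : Ω → F}
    (hV : Measurable[samplesIn z S] V) (hW : Measurable[samplesIn z T] W) : IndepFun V W P := by
  have := indep_iSup_of_disjoint (fun t => (hz.measurable t).comap_le) hz.iIndepFun.iIndep hST
  rw [IndepFun_iff_Indep]
  exact indep_of_indep_of_le_left (indep_of_indep_of_le_right this hW.comap_le) hV.comap_le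

theorem indepFun_sample (hz : IsStream P z ν) {S : Set ℤ} {t : ℤ} (ht : t ∉ S) {E : Type*}
    [MeasurableSpace E] {V : Ω → E} (hV : Measurable[samplesIn z S] V) : IndepFun V (z t) P :=
  hz.indepFun (T := {t}) (by simpa using ht) hV (measurable_samplesIn z rfl)

variable {V : Ω → Vec d} {t : ℤ}

theorem memLp_sgdStep (hz : IsStream P z ν) (h : CenteredLaw ν H σ R)
    (hκ : 0 ≤ γ * (2 - γ * R ^ 2)) (hVm : Measurable V) (hV : MemLp V 2 P)
    (hind : IndepFun V (z t) P) : MemLp (fun ω => sgdStep γ (z t ω) (V ω)) 2 P := by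
  have := hz.isProbabilityMeasure
  have hm : Measurable fun ω => sgdStep γ (z t ω) (V ω) :=
    (measurable_sgdStep γ).comp ((hz.measurable t).prodMk hVm)
  rw [memLp_two_iff_integrable_sq_norm hm.aestronglyMeasurable]
  refine (integrable_and_integral_le_of_indepFun (f := fun v z => ‖sgdStep γ z v‖ ^ 2)
    (g := fun v => 2 * ‖v‖ ^ 2 + 2 * γ ^ 2 * ∫ z : Sample d, z.2 ^ 2 * ‖z.1‖ ^ 2 ∂ν)
    hVm.aemeasurable (hz.measurable t).aemeasurable hind ?_ (fun v z => by positivity)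
    (by fun_prop) ?_ ?_ ?_).1
  · exact ((measurable_sgdStep γ).comp measurable_swap).norm.pow_const 2
  · rw [hz.map_eq]; exact h.integrable_normSq_sgdStep γ
  · rw [hz.map_eq]; exact h.integral_normSq_sgdStep_le hκ
  · exact ((integrable_normSq hV).const_mul 2).add (integrable_const _)

theorem integral_normSq_sgdStep_noiseFree_le (hz : IsStream P z ν) (h : CenteredLaw ν H σ R)
    (γ : ℝ) (hVm : Measurable V) (hV : MemLp V 2 P) (hind : IndepFun V (z t) P) :
    ∫ ω, ‖sgdStep γ (noiseFree (z t ω)) (V ω)‖ ^ 2 ∂P ≤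
      ∫ ω, ‖V ω‖ ^ 2 ∂P - γ * (2 - γ * R ^ 2) * ∫ ω, inner ℝ (V ω) (H (V ω)) ∂P := by
  have := hz.isProbabilityMeasure
  have hq := (integrable_quadForm H hV).const_mul (γ * (2 - γ * R ^ 2))
  rw [← integral_const_mul, ← integral_sub (integrable_normSq hV) hq]
  refine (integrable_and_integral_le_of_indepFun
    (f := fun v z => ‖sgdStep γ (noiseFree z) v‖ ^ 2)
    (g := fun v => ‖v‖ ^ 2 - γ * (2 - γ * R ^ 2) * inner ℝ v (H v))
    hVm.aemeasurable (hz.measurable t).aemeasurable hind ?_ (fun v z => by positivity)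
    (by fun_prop) ?_ ?_ ?_).2
  · exact ((measurable_sgdStep γ).comp
      ((measurable_noiseFree.comp measurable_snd).prodMk measurable_fst)).norm.pow_const 2
  · rw [hz.map_eq]; exact h.integrable_normSq_sgdStep_noiseFree γ
  · rw [hz.map_eq]; exact h.integral_normSq_sgdStep_noiseFree_le γ
  · exact (integrable_normSq hV).sub hq

theorem integral_inner_sgdStep (hz : IsStream P z ν) (h : CenteredLaw ν H σ R)
    (hκ : 0 ≤ γ * (2 - γ * R ^ 2)) {U : Ω → Vec d} (hUm : Measurable U) (hU : MemLp U 2 P)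
    (hVm : Measurable V) (hV : MemLp V 2 P) (hind : IndepFun (fun ω => (U ω, V ω)) (z t) P) :
    ∫ ω, inner ℝ (U ω) (sgdStep γ (z t ω) (V ω)) ∂P =
      ∫ ω, inner ℝ (U ω) (V ω) ∂P - γ * ∫ ω, inner ℝ (U ω) (H (V ω)) ∂P := by
  have := hz.isProbabilityMeasure
  rw [← integral_const_mul, ← integral_sub (integrable_inner_of_memLp hU hV)
    ((integrable_bilin H hU hV).const_mul γ)]
  refine (integral_eq_of_indepFun (f := fun p z => inner ℝ p.1 (sgdStep γ z p.2))
    (g := fun p => inner ℝ p.1 p.2 - γ * inner ℝ p.1 (H p.2))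
    (hUm.prodMk hVm).aemeasurable (hz.measurable t).aemeasurable hind ?_ (by fun_prop) ?_ ?_).2
  · exact (measurable_fst.fst).inner ((measurable_sgdStep γ).comp
      (measurable_snd.prodMk measurable_fst.snd))
  · exact integrable_inner_of_memLp hU
      (hz.memLp_sgdStep h hκ hVm hV (hind.comp measurable_snd measurable_id))
  · rw [hz.map_eq]; exact fun p => h.integral_inner_sgdStep γ p.1 p.2

end IsStream

end OneStep

/-! ### Second moments of the iterates -/

section Iterates

variable {d : ℕ} {ν : Measure (Sample d)} {H : Vec d →L[ℝ] Vec d} {σ R γ : ℝ}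

/-- Zeroing the noise preserves the moment conditions with the same constants, so results on
`sgdIter` transfer to `linIter`. -/
theorem CenteredLaw.map_noiseFree (h : CenteredLaw ν H σ R) :
    CenteredLaw (ν.map noiseFree) H σ R := by
  have key : ∀ f : Sample d → ℝ, Measurable f → Integrable (fun z => f (noiseFree z)) ν →
      Integrable f (ν.map noiseFree) := fun f hf hi =>
    (integrable_map_measure hf.aestronglyMeasurable measurable_noiseFree.aemeasurable).2 hi
  have key' : ∀ f : Sample d → ℝ, Measurable f →
      ∫ z, f z ∂(ν.map noiseFree) = ∫ z, f (noiseFree z) ∂ν := fun f hf =>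
    integral_map measurable_noiseFree.aemeasurable hf.aestronglyMeasurable
  constructor
  · exact fun u v => key _ (by fun_prop) (h.integrable_inner_mul u v)
  · intro u v
    rw [key' _ (by fun_prop)]
    exact h.integral_inner_mul u v
  · exact fun v => key _ (by fun_prop) (h.integrable_normSq_mul v)
  · intro v
    rw [key' _ (by fun_prop)]
    exact h.integral_normSq_mul_le v
  · exact fun v => key _ (by fun_prop) (by simp [noiseFree])
  · intro v
    rw [key' _ (by fun_prop)]
    simpa [noiseFree] using mul_nonneg (sq_nonneg σ) (h.quadForm_nonneg v)
  · exact fun v => key _ (by fun_prop) (by simp [noiseFree])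
  · intro v
    rw [key' _ (by fun_prop)]
    simp [noiseFree]

namespace IsStream

variable {Ω : Type*} [MeasurableSpace Ω] {P : Measure Ω} [IsProbabilityMeasure P]
  {z : ℤ → Ω → Sample d}

theorem map (hz : IsStream P z ν) {φ : Sample d → Sample d} (hφ : Measurable φ) :
    IsStream P (fun t ω => φ (z t ω)) (ν.map φ) where
  measurable t := hφ.comp (hz.measurable t)
  iIndepFun := hz.iIndepFun.comp (fun _ => φ) fun _ => hφ
  map_eq t := by rw [← hz.map_eq t, Measure.map_map hφ (hz.measurable t)]; rfl

theorem shift (hz : IsStream P z ν) (m : ℤ) : IsStream P (fun t => z (t + m)) ν where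
  measurable _ := hz.measurable _
  iIndepFun := hz.iIndepFun.precomp (add_left_injective m)
  map_eq _ := hz.map_eq _

theorem identDistrib_shift (hz : IsStream P z ν) (m : ℤ) :
    IdentDistrib (fun ω t => z (t + m) ω) (fun ω t => z t ω) P P where
  aemeasurable_fst := (measurable_pi_lambda _ fun t => hz.measurable _).aemeasurable
  aemeasurable_snd := (measurable_pi_lambda _ fun t => hz.measurable _).aemeasurable
  map_eq := by
    have h1 := (iIndepFun_iff_map_fun_eq_infinitePi_map hz.measurable).1 hz.iIndepFun
    have h2 := (iIndepFun_iff_map_fun_eq_infinitePi_map (hz.shift m).measurable).1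
      (hz.shift m).iIndepFun
    rw [h1, h2]
    simp only [hz.map_eq]

theorem measurable_sgdIter (hz : IsStream P z ν) (γ : ℝ) (θ : Vec d) (m : ℤ) (n : ℕ) :
    Measurable fun ω => sgdIter γ θ (fun t => z t ω) m n :=
  (AvgStartSGD.measurable_sgdIter γ θ z m n subset_rfl).mono (samplesIn_le hz.measurable _) le_rfl

theorem measurable_linIter (hz : IsStream P z ν) (γ : ℝ) (θ : Vec d) (m : ℤ) (n : ℕ) :
    Measurable fun ω => linIter γ (fun t => z t ω) m n θ :=
  (AvgStartSGD.measurable_linIter γ θ z m n subset_rfl).mono (samplesIn_le hz.measurable _) le_rfl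

theorem identDistrib_sgdIter (hz : IsStream P z ν) (γ : ℝ) (θ : Vec d) (m : ℤ) (n : ℕ) :
    IdentDistrib (fun ω => sgdIter γ θ (fun t => z t ω) m n)
      (fun ω => sgdIter γ θ (fun t => z t ω) 0 n) P P := by
  simp only [sgdIter_shift γ θ _ m n]
  exact (hz.identDistrib_shift m).comp (measurable_sgdIter_path γ θ 0 n)

theorem memLp_sgdIter (hz : IsStream P z ν) (h : CenteredLaw ν H σ R)
    (hκ : 0 ≤ γ * (2 - γ * R ^ 2)) (θ : Vec d) (m : ℤ) (n : ℕ) :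
    MemLp (fun ω => sgdIter γ θ (fun t => z t ω) m n) 2 P := by
  induction n with
  | zero => exact memLp_const θ
  | succ n ih =>
    exact hz.memLp_sgdStep h hκ (hz.measurable_sgdIter γ θ m n) ih
      (hz.indepFun_sample (by simp) (AvgStartSGD.measurable_sgdIter γ θ z m n subset_rfl))

theorem memLp_linIter (hz : IsStream P z ν) (h : CenteredLaw ν H σ R)
    (hκ : 0 ≤ γ * (2 - γ * R ^ 2)) (v : Vec d) (m : ℤ) (n : ℕ) :
    MemLp (fun ω => linIter γ (fun t => z t ω) m n v) 2 P :=
  (hz.map measurable_noiseFree).memLp_sgdIter h.map_noiseFree hκ v m n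

theorem identDistrib_linIter (hz : IsStream P z ν) (γ : ℝ) (v : Vec d) (m : ℤ) (n : ℕ) :
    IdentDistrib (fun ω => linIter γ (fun t => z t ω) m n v)
      (fun ω => linIter γ (fun t => z t ω) 0 n v) P P :=
  (hz.map measurable_noiseFree).identDistrib_sgdIter γ v m n

/-! #### Decay of the linear part -/

theorem integral_normSq_linIter_succ_le (hz : IsStream P z ν) (h : CenteredLaw ν H σ R)
    (hκ : 0 ≤ γ * (2 - γ * R ^ 2)) (v : Vec d) (m : ℤ) (n : ℕ) :
    ∫ ω, ‖linIter γ (fun t => z t ω) m (n + 1) v‖ ^ 2 ∂P ≤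
      ∫ ω, ‖linIter γ (fun t => z t ω) m n v‖ ^ 2 ∂P - γ * (2 - γ * R ^ 2) *
        ∫ ω, inner ℝ (linIter γ (fun t => z t ω) m n v)
          (H (linIter γ (fun t => z t ω) m n v)) ∂P := by
  simp only [linIter_succ]
  exact hz.integral_normSq_sgdStep_noiseFree_le h γ (hz.measurable_linIter γ v m n)
    (hz.memLp_linIter h hκ v m n)
    (hz.indepFun_sample (by simp) (AvgStartSGD.measurable_linIter γ v z m n subset_rfl))

/-- Here `lam` is any lower bound for the quadratic form: 0 gives non-expansion, and the smallest
eigenvalue gives geometric decay. -/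
theorem integral_normSq_linIter_le (hz : IsStream P z ν) (h : CenteredLaw ν H σ R)
    (hκ : 0 ≤ γ * (2 - γ * R ^ 2)) {lam : ℝ} (hlam : ∀ v, lam * ‖v‖ ^ 2 ≤ inner ℝ v (H v))
    (hξ : γ * (2 - γ * R ^ 2) * lam ≤ 1) (v : Vec d) (m : ℤ) (n : ℕ) :
    ∫ ω, ‖linIter γ (fun t => z t ω) m n v‖ ^ 2 ∂P ≤
      (1 - γ * (2 - γ * R ^ 2) * lam) ^ n * ‖v‖ ^ 2 := by
  induction n with
  | zero => simp [linIter_zero]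
  | succ n ih =>
    have h1 := hz.integral_normSq_linIter_succ_le h hκ v m n
    have h2 : lam * ∫ ω, ‖linIter γ (fun t => z t ω) m n v‖ ^ 2 ∂P ≤
        ∫ ω, inner ℝ (linIter γ (fun t => z t ω) m n v)
          (H (linIter γ (fun t => z t ω) m n v)) ∂P := by
      rw [← integral_const_mul]
      exact integral_mono ((integrable_normSq (hz.memLp_linIter h hκ v m n)).const_mul _)
        (integrable_quadForm H (hz.memLp_linIter h hκ v m n)) fun ω => hlam _
    have h3 := mul_le_mul_of_nonneg_left h2 hκ
    have h4 := mul_le_mul_of_nonneg_left ih (sub_nonneg.2 hξ)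
    rw [pow_succ']
    linarith

/-- Each step removes κ times the quadratic form from the mean squared norm, so the sum telescopes
to at most the mean squared norm after `a` steps. The bound does not grow with the number of terms,
so an average over a window gains a factor 1/card. -/
theorem sum_quadForm_linIter_le (hz : IsStream P z ν) (h : CenteredLaw ν H σ R)
    (hκ : 0 < γ * (2 - γ * R ^ 2)) {lam : ℝ} (hlam : ∀ v, lam * ‖v‖ ^ 2 ≤ inner ℝ v (H v))
    (hξ : γ * (2 - γ * R ^ 2) * lam ≤ 1) (v : Vec d) (a b : ℕ) :
    ∑ u ∈ Finset.Icc a b, ∫ ω, inner ℝ (linIter γ (fun t => z t ω) (-(u : ℤ)) u v)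
      (H (linIter γ (fun t => z t ω) (-(u : ℤ)) u v)) ∂P ≤
      (1 - γ * (2 - γ * R ^ 2) * lam) ^ a * ‖v‖ ^ 2 / (γ * (2 - γ * R ^ 2)) := by
  -- By stationarity, a sum over starting times becomes a sum along a single run started at time 0.
  have hshift : ∀ u : ℕ, ∫ ω, inner ℝ (linIter γ (fun t => z t ω) (-(u : ℤ)) u v)
      (H (linIter γ (fun t => z t ω) (-(u : ℤ)) u v)) ∂P =
      ∫ ω, inner ℝ (linIter γ (fun t => z t ω) 0 u v) (H (linIter γ (fun t => z t ω) 0 u v)) ∂P :=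
    fun u => ((hz.identDistrib_linIter γ v (-(u : ℤ)) u).comp
      (u := fun v => inner ℝ v (H v)) (by fun_prop)).integral_eq
  simp only [hshift]
  have htel : ∀ n : ℕ, γ * (2 - γ * R ^ 2) * ∑ u ∈ Finset.Ico a (a + n),
      ∫ ω, inner ℝ (linIter γ (fun t => z t ω) 0 u v)
        (H (linIter γ (fun t => z t ω) 0 u v)) ∂P ≤
      ∫ ω, ‖linIter γ (fun t => z t ω) 0 a v‖ ^ 2 ∂P -
        ∫ ω, ‖linIter γ (fun t => z t ω) 0 (a + n) v‖ ^ 2 ∂P := by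
    intro n
    induction n with
    | zero => simp
    | succ n ih =>
      rw [← add_assoc, Finset.sum_Ico_succ_top (Nat.le_add_right a n), mul_add]
      linarith [hz.integral_normSq_linIter_succ_le h hκ.le v 0 (a + n)]
  rw [le_div_iff₀' hκ]
  rcases le_or_gt a b with hab | hab
  · have h1 := htel (b + 1 - a)
    rw [show a + (b + 1 - a) = b + 1 by omega] at h1
    have h2 : Finset.Icc a b = Finset.Ico a (b + 1) := by ext; simp
    rw [h2]
    have h3 : 0 ≤ ∫ ω, ‖linIter γ (fun t => z t ω) 0 (b + 1) v‖ ^ 2 ∂P :=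
      integral_nonneg fun ω => by positivity
    linarith [hz.integral_normSq_linIter_le h hκ.le hlam hξ v 0 a]
  · rw [Finset.Icc_eq_empty (by omega)]
    simp only [Finset.sum_empty, mul_zero]
    exact mul_nonneg (pow_nonneg (sub_nonneg.2 hξ) _) (by positivity)

/-! #### The noise part -/

theorem integral_inner_sgdIter_zero (hz : IsStream P z ν) (h : CenteredLaw ν H σ R)
    (hκ : 0 ≤ γ * (2 - γ * R ^ 2)) (m : ℤ) (n : ℕ) (w : Vec d) :
    ∫ ω, inner ℝ w (sgdIter γ 0 (fun t => z t ω) m n) ∂P = 0 := by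
  induction n generalizing w with
  | zero => simp [sgdIter]
  | succ n ih =>
    have h1 := hz.integral_inner_sgdStep (t := m + n) h hκ (U := fun _ => w) measurable_const
      (memLp_const w) (hz.measurable_sgdIter γ 0 m n) (hz.memLp_sgdIter h hκ 0 m n)
      (hz.indepFun_sample (S := Set.Ico m (m + n)) (by simp)
        (measurable_const.prodMk (AvgStartSGD.measurable_sgdIter γ 0 z m n subset_rfl)))
    -- Symmetry moves H onto the test vector, and the induction hypothesis applies at both `w` and
    -- `H w`.
    simp only [h.bilin_comm w, real_inner_comm (H w), ih, mul_zero, sub_zero] at h1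
    exact h1

/-- The covariance bound aI is preserved by a step. Given the sample, testing the new iterate
against w means testing V against (I - γxxᵀ)w and adding γ times noise times ⟨x, w⟩; the cross term
vanishes because V has mean 0. The first part contributes at most a(‖w‖² - κ wᵀHw), the noise at
most γ²σ² wᵀHw, and `haκ` says that the loss pays for the noise. -/
theorem integral_inner_sq_sgdStep_le (hz : IsStream P z ν) (h : CenteredLaw ν H σ R)
    {a : ℝ} (ha : 0 ≤ a) (haκ : γ ^ 2 * σ ^ 2 ≤ a * (γ * (2 - γ * R ^ 2)))
    {V : Ω → Vec d} {t : ℤ} (hVm : Measurable V) (hV : MemLp V 2 P) (hind : IndepFun V (z t) P)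
    (hmean : ∀ w, ∫ ω, inner ℝ w (V ω) ∂P = 0)
    (hcov : ∀ w, ∫ ω, inner ℝ w (V ω) ^ 2 ∂P ≤ a * ‖w‖ ^ 2) (w : Vec d) :
    ∫ ω, inner ℝ w (sgdStep γ (z t ω) (V ω)) ^ 2 ∂P ≤ a * ‖w‖ ^ 2 := by
  have := hz.isProbabilityMeasure
  have hstep : ∀ (z : Sample d) (v : Vec d), inner ℝ w (sgdStep γ z v) =
      inner ℝ (sgdStep γ (noiseFree z) w) v + γ * (z.2 * inner ℝ z.1 w) := by
    intro z v
    simp only [sgdStep, noiseFree, inner_sub_right, inner_sub_left, real_inner_smul_right,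
      real_inner_smul_left, sub_zero]
    rw [real_inner_comm w z.1]
    ring
  have hI1 : ∀ u : Vec d, Integrable (fun ω => inner ℝ u (V ω)) P := fun u =>
    integrable_inner_of_memLp (memLp_const u) hV
  have hI2 : ∀ u : Vec d, Integrable (fun ω => inner ℝ u (V ω) ^ 2) P := fun u => by
    have hmem : MemLp (fun ω => inner ℝ u (V ω)) 2 P := (innerSL ℝ u).comp_memLp' hV
    simpa using integrable_normSq hmem
  have hexp : ∀ (u : Vec d) (r : ℝ) ω, (inner ℝ u (V ω) + r) ^ 2 =
      inner ℝ u (V ω) ^ 2 + 2 * r * inner ℝ u (V ω) + r ^ 2 := fun u r ω => by ring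
  have hI3 : ∀ (u : Vec d) (r : ℝ), Integrable (fun ω => inner ℝ u (V ω) ^ 2 +
      2 * r * inner ℝ u (V ω)) P := fun u r => (hI2 u).add ((hI1 u).const_mul _)
  have hg : Integrable (fun z : Sample d => a * ‖sgdStep γ (noiseFree z) w‖ ^ 2 +
      γ ^ 2 * (z.2 ^ 2 * inner ℝ z.1 w ^ 2)) ν :=
    ((h.integrable_normSq_sgdStep_noiseFree γ w).const_mul a).add
      ((h.integrable_noiseSq_mul w).const_mul _)
  have hAm : Measurable fun z : Sample d => sgdStep γ (noiseFree z) w :=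
    (measurable_sgdStep γ).comp (measurable_noiseFree.prodMk measurable_const)
  have hgm : Measurable fun z : Sample d => a * ‖sgdStep γ (noiseFree z) w‖ ^ 2 +
      γ ^ 2 * (z.2 ^ 2 * inner ℝ z.1 w ^ 2) :=
    ((hAm.norm.pow_const 2).const_mul a).add (by fun_prop)
  -- The sample is the frozen variable here; `V` is integrated first.
  have key := (integrable_and_integral_le_of_indepFun (P := P)
    (f := fun (z : Sample d) v => inner ℝ w (sgdStep γ z v) ^ 2)
    (g := fun z : Sample d => a * ‖sgdStep γ (noiseFree z) w‖ ^ 2 +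
      γ ^ 2 * (z.2 ^ 2 * inner ℝ z.1 w ^ 2))
    (hz.measurable t).aemeasurable hVm.aemeasurable hind.symm
    ((measurable_const.inner (measurable_sgdStep γ)).pow_const 2) (fun z v => sq_nonneg _) hgm
    ?_ ?_ ?_).2
  · refine key.trans ?_
    rw [← integral_map (hz.measurable t).aemeasurable hgm.aestronglyMeasurable, hz.map_eq,
      integral_add ((h.integrable_normSq_sgdStep_noiseFree γ w).const_mul a)
        ((h.integrable_noiseSq_mul w).const_mul _), integral_const_mul, integral_const_mul]
    have h1 := mul_le_mul_of_nonneg_left (h.integral_normSq_sgdStep_noiseFree_le γ w) ha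
    have h2 := mul_le_mul_of_nonneg_left (h.integral_noiseSq_mul_le w) (sq_nonneg γ)
    have h3 := mul_le_mul_of_nonneg_right haκ (h.quadForm_nonneg w)
    linarith
  · intro z
    rw [integrable_map_measure _ hVm.aemeasurable]
    · simp only [Function.comp_def, hstep, hexp]
      exact (hI3 _ _).add (integrable_const _)
    · simp only [hstep]
      exact (by fun_prop : Measurable _).aestronglyMeasurable
  · intro z
    rw [integral_map hVm.aemeasurable]
    · simp only [hstep, hexp]
      rw [integral_add (hI3 _ _) (integrable_const _), integral_add (hI2 _)
        ((hI1 _).const_mul _), integral_const_mul, hmean]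
      simp only [mul_zero, add_zero, integral_const, probReal_univ, one_smul]
      have := hcov (sgdStep γ (noiseFree z) w)
      nlinarith
    · simp only [hstep]
      exact (by fun_prop : Measurable _).aestronglyMeasurable
  · exact (integrable_map_measure hgm.aestronglyMeasurable (hz.measurable t).aemeasurable).1
      (by rw [hz.map_eq]; exact hg)

theorem integral_inner_sq_sgdIter_zero_le (hz : IsStream P z ν) (h : CenteredLaw ν H σ R)
    (hκ : 0 ≤ γ * (2 - γ * R ^ 2)) {a : ℝ} (ha : 0 ≤ a)
    (haκ : γ ^ 2 * σ ^ 2 ≤ a * (γ * (2 - γ * R ^ 2))) (m : ℤ) (n : ℕ) (w : Vec d) :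
    ∫ ω, inner ℝ w (sgdIter γ 0 (fun t => z t ω) m n) ^ 2 ∂P ≤ a * ‖w‖ ^ 2 := by
  induction n generalizing w with
  | zero => simpa [sgdIter] using mul_nonneg ha (sq_nonneg ‖w‖)
  | succ n ih =>
    exact hz.integral_inner_sq_sgdStep_le h ha haκ (hz.measurable_sgdIter γ 0 m n)
      (hz.memLp_sgdIter h hκ 0 m n)
      (hz.indepFun_sample (by simp) (AvgStartSGD.measurable_sgdIter γ 0 z m n subset_rfl))
      (hz.integral_inner_sgdIter_zero h hκ m n) ih w

/-- The trace of the covariance bound aI, over an orthonormal basis. -/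
theorem integral_normSq_sgdIter_zero_le (hz : IsStream P z ν) (h : CenteredLaw ν H σ R)
    (hκ : 0 ≤ γ * (2 - γ * R ^ 2)) {a : ℝ} (ha : 0 ≤ a)
    (haκ : γ ^ 2 * σ ^ 2 ≤ a * (γ * (2 - γ * R ^ 2))) (m : ℤ) (n : ℕ) :
    ∫ ω, ‖sgdIter γ 0 (fun t => z t ω) m n‖ ^ 2 ∂P ≤ a * d := by
  have hV := hz.memLp_sgdIter h hκ 0 m n
  set e := EuclideanSpace.basisFun (Fin d) ℝ
  have h1 : ∀ v : Vec d, ‖v‖ ^ 2 = ∑ j, inner ℝ (e j) v ^ 2 := fun v => by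
    rw [← e.sum_sq_norm_inner_right v]; simp
  simp only [h1]
  rw [integral_finsetSum]
  · calc _ ≤ ∑ j : Fin d, a * ‖e j‖ ^ 2 := Finset.sum_le_sum fun j _ =>
          hz.integral_inner_sq_sgdIter_zero_le h hκ ha haκ m n (e j)
      _ = a * d := by simp [mul_comm]
  · intro j _
    have hmem : MemLp (fun ω => inner ℝ (e j) (sgdIter γ 0 (fun t => z t ω) m n)) 2 P :=
      (innerSL ℝ (e j)).comp_memLp' hV
    simpa using integrable_normSq hmem

theorem integral_normSq_sgdIter_le (hz : IsStream P z ν) (h : CenteredLaw ν H σ R)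
    (hκ : 0 ≤ γ * (2 - γ * R ^ 2)) {a : ℝ} (ha : 0 ≤ a)
    (haκ : γ ^ 2 * σ ^ 2 ≤ a * (γ * (2 - γ * R ^ 2))) (v : Vec d) (m : ℤ) (n : ℕ) :
    ∫ ω, ‖sgdIter γ v (fun t => z t ω) m n‖ ^ 2 ∂P ≤ 2 * (a * d + ‖v‖ ^ 2) := by
  have i1 := integrable_normSq (hz.memLp_sgdIter h hκ 0 m n)
  have i2 := integrable_normSq (hz.memLp_linIter h hκ v m n)
  have hle : ∀ ω, ‖sgdIter γ v (fun t => z t ω) m n‖ ^ 2 ≤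
      2 * ‖sgdIter γ 0 (fun t => z t ω) m n‖ ^ 2 +
        2 * ‖linIter γ (fun t => z t ω) m n v‖ ^ 2 := by
    intro ω
    have h1 := sgdIter_eq_add_linIter γ (fun t => z t ω) m n 0 v
    rw [zero_add] at h1
    rw [h1]
    have h3 := norm_add_le (sgdIter γ 0 (fun t => z t ω) m n) (linIter γ (fun t => z t ω) m n v)
    nlinarith [sq_nonneg (‖sgdIter γ 0 (fun t => z t ω) m n‖ - ‖linIter γ (fun t => z t ω) m n v‖),
      norm_nonneg (sgdIter γ 0 (fun t => z t ω) m n + linIter γ (fun t => z t ω) m n v)]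
  have h2 := integral_mono (integrable_normSq (hz.memLp_sgdIter h hκ v m n))
    ((i1.const_mul 2).add (i2.const_mul 2)) hle
  simp only [Pi.add_apply] at h2
  rw [integral_add (i1.const_mul 2) (i2.const_mul 2), integral_const_mul, integral_const_mul] at h2
  have := hz.isProbabilityMeasure
  have h3 := hz.integral_normSq_linIter_le h hκ (lam := 0)
    (fun v => by simpa using h.quadForm_nonneg v) (by simp) v m n
  simp only [mul_zero, sub_zero, one_pow, one_mul] at h3
  linarith [hz.integral_normSq_sgdIter_zero_le h hκ ha haκ m n]

/-! #### Time averages -/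

/-- γHv is v minus its mean image under a step, so the correlations of a fixed iterate with the
later ones telescope. -/
theorem gamma_mul_sum_integral_bilin (hz : IsStream P z ν) (h : CenteredLaw ν H σ R)
    (hκ : 0 ≤ γ * (2 - γ * R ^ 2)) (v : Vec d) (s n : ℕ) :
    γ * ∑ i ∈ Finset.range n, ∫ ω, inner ℝ (sgdIter γ v (fun t => z t ω) 0 s)
        (H (sgdIter γ v (fun t => z t ω) 0 (s + i))) ∂P =
      ∫ ω, ‖sgdIter γ v (fun t => z t ω) 0 s‖ ^ 2 ∂P -
        ∫ ω, inner ℝ (sgdIter γ v (fun t => z t ω) 0 s)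
          (sgdIter γ v (fun t => z t ω) 0 (s + n)) ∂P := by
  induction n with
  | zero => simp
  | succ n ih =>
    have h1 := hz.integral_inner_sgdStep (t := 0 + (s + n : ℕ)) h hκ
      (hz.measurable_sgdIter γ v 0 s) (hz.memLp_sgdIter h hκ v 0 s)
      (hz.measurable_sgdIter γ v 0 (s + n)) (hz.memLp_sgdIter h hκ v 0 (s + n))
      (hz.indepFun_sample (S := Set.Ico 0 (0 + (s + n : ℕ))) (by simp)
        ((AvgStartSGD.measurable_sgdIter γ v z 0 s
          (Set.Ico_subset_Ico_right (by push_cast; omega))).prodMk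
        (AvgStartSGD.measurable_sgdIter γ v z 0 (s + n) subset_rfl)))
    rw [Finset.sum_range_succ, mul_add, ih, ← add_assoc]
    change _ = _ - ∫ ω, inner ℝ _ (sgdStep γ (z (0 + (s + n : ℕ)) ω) _) ∂P
    rw [h1]
    ring

/-- The growth is linear in n because each row of the double sum of correlations telescopes to at
most 2K/γ. The induction peels off the first row, counting its diagonal term twice, which only
enlarges the bound. -/
theorem integral_quadForm_sum_sgdIter_le (hz : IsStream P z ν) (h : CenteredLaw ν H σ R)
    (hγ : 0 < γ) (hκ : 0 ≤ γ * (2 - γ * R ^ 2)) {K : ℝ} (v : Vec d)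
    (hK : ∀ n, ∫ ω, ‖sgdIter γ v (fun t => z t ω) 0 n‖ ^ 2 ∂P ≤ K) (s n : ℕ) :
    ∫ ω, inner ℝ (∑ i ∈ Finset.range n, sgdIter γ v (fun t => z t ω) 0 (s + i))
      (H (∑ i ∈ Finset.range n, sgdIter γ v (fun t => z t ω) 0 (s + i))) ∂P ≤
      n * (4 * K / γ) := by
  induction n generalizing s with
  | zero => simp
  | succ n ih =>
    have hmem : ∀ i, MemLp (fun ω => sgdIter γ v (fun t => z t ω) 0 i) 2 P :=
      fun i => hz.memLp_sgdIter h hκ v 0 i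
    have hsum : ∀ s n, MemLp (fun ω => ∑ i ∈ Finset.range n,
        sgdIter γ v (fun t => z t ω) 0 (s + i)) 2 P := fun s n =>
      memLp_finsetSum _ fun i _ => hmem (s + i)
    have hpt : ∀ ω, inner ℝ (∑ i ∈ Finset.range (n + 1), sgdIter γ v (fun t => z t ω) 0 (s + i))
        (H (∑ i ∈ Finset.range (n + 1), sgdIter γ v (fun t => z t ω) 0 (s + i))) ≤
        2 * ∑ i ∈ Finset.range (n + 1), inner ℝ (sgdIter γ v (fun t => z t ω) 0 s)
          (H (sgdIter γ v (fun t => z t ω) 0 (s + i))) +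
        inner ℝ (∑ i ∈ Finset.range n, sgdIter γ v (fun t => z t ω) 0 (s + 1 + i))
          (H (∑ i ∈ Finset.range n, sgdIter γ v (fun t => z t ω) 0 (s + 1 + i))) := by
      intro ω
      rw [← inner_sum, ← map_sum]
      have hs : ∑ i ∈ Finset.range (n + 1), sgdIter γ v (fun t => z t ω) 0 (s + i) =
          sgdIter γ v (fun t => z t ω) 0 s +
            ∑ i ∈ Finset.range n, sgdIter γ v (fun t => z t ω) 0 (s + 1 + i) := by
        rw [Finset.sum_range_succ', add_comm]
        simp only [add_zero, add_assoc, add_comm 1]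
      rw [hs, h.quadForm_add, map_add, inner_add_right]
      linarith [h.quadForm_nonneg (sgdIter γ v (fun t => z t ω) 0 s)]
    have i1 : Integrable (fun ω => 2 * ∑ i ∈ Finset.range (n + 1),
        inner ℝ (sgdIter γ v (fun t => z t ω) 0 s)
          (H (sgdIter γ v (fun t => z t ω) 0 (s + i)))) P :=
      (integrable_finsetSum _ fun i _ => integrable_bilin H (hmem s) (hmem (s + i))).const_mul 2
    have i2 := integrable_quadForm H (hsum (s + 1) n)
    have h1 := integral_mono (integrable_quadForm H (hsum s (n + 1))) (i1.add i2) hpt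
    simp only [Pi.add_apply] at h1
    rw [integral_add i1 i2, integral_const_mul,
      integral_finsetSum _ fun i _ => integrable_bilin H (hmem s) (hmem (s + i))] at h1
    have h2 := hz.gamma_mul_sum_integral_bilin h hκ v s (n + 1)
    have h3 : -∫ ω, inner ℝ (sgdIter γ v (fun t => z t ω) 0 s)
        (sgdIter γ v (fun t => z t ω) 0 (s + (n + 1))) ∂P ≤ K := by
      have h4 := integral_mono (integrable_inner_of_memLp (hmem s) (hmem (s + (n + 1)))).neg
        (((integrable_normSq (hmem s)).add (integrable_normSq (hmem (s + (n + 1))))).const_mul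
          (1 / 2)) (fun ω => by
          simp only [Pi.neg_apply, Pi.add_apply]
          nlinarith [norm_add_sq_real (sgdIter γ v (fun t => z t ω) 0 s)
            (sgdIter γ v (fun t => z t ω) 0 (s + (n + 1))),
            sq_nonneg ‖sgdIter γ v (fun t => z t ω) 0 s +
              sgdIter γ v (fun t => z t ω) 0 (s + (n + 1))‖])
      simp only [Pi.neg_apply, Pi.add_apply] at h4
      rw [integral_neg, integral_const_mul, integral_add (integrable_normSq (hmem s))
        (integrable_normSq (hmem (s + (n + 1))))] at h4
      linarith [hK s, hK (s + (n + 1))]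
    have h5 : ∑ i ∈ Finset.range (n + 1), ∫ ω, inner ℝ (sgdIter γ v (fun t => z t ω) 0 s)
        (H (sgdIter γ v (fun t => z t ω) 0 (s + i))) ∂P ≤ 2 * K / γ := by
      rw [le_div_iff₀' hγ]
      linarith [hK s]
    have h6 : 2 * (2 * K / γ) = 4 * K / γ := by ring
    push_cast
    linarith [ih (s + 1)]

end IsStream

end Iterates

/-! ### Averages over starting times -/

section StartAverages

variable {d : ℕ} {ν : Measure (Sample d)} {H : Vec d →L[ℝ] Vec d} {σ R γ : ℝ}

/-- The average of `θ_{-t : 0}`, as `t` ranges over `W`. -/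
noncomputable def startAvg (γ : ℝ) (θ : Vec d) (z : ℤ → Sample d) (W : Finset ℕ) : Vec d :=
  (W.card : ℝ)⁻¹ • ∑ t ∈ W, sgdIter γ θ z (-(t : ℤ)) t

/-- The coupling of starting times: from time -u on, the run started at -t uses the same samples as
the run started at -u, so the two differ by the linear part applied to the position reached at time
-u. -/
theorem sgdIter_zero_eq_add_linIter (γ : ℝ) (z : ℤ → Sample d) {u t : ℕ} (hut : u ≤ t) :
    sgdIter γ 0 z (-(t : ℤ)) t = sgdIter γ 0 z (-(u : ℤ)) u +
      linIter γ z (-(u : ℤ)) u (sgdIter γ 0 z (-(t : ℤ)) (t - u)) := by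
  have h1 := sgdIter_add_steps γ 0 z (-(t : ℤ)) (t - u) u
  rw [Nat.sub_add_cancel hut, show -(t : ℤ) + ((t - u : ℕ) : ℤ) = -(u : ℤ) by omega] at h1
  rw [h1, ← sgdIter_eq_add_linIter, zero_add]

namespace IsStream

variable {Ω : Type*} [MeasurableSpace Ω] {P : Measure Ω} [IsProbabilityMeasure P]
  {z : ℤ → Ω → Sample d}

theorem integral_inner_sample_sq (hz : IsStream P z ν) (h : CenteredLaw ν H σ R) {V : Ω → Vec d}
    {t : ℤ} (hVm : Measurable V) (hV : MemLp V 2 P) (hind : IndepFun V (z t) P) :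
    Integrable (fun ω => inner ℝ (z t ω).1 (V ω) ^ 2) P ∧
      ∫ ω, inner ℝ (z t ω).1 (V ω) ^ 2 ∂P = ∫ ω, inner ℝ (V ω) (H (V ω)) ∂P := by
  have hm : Measurable (Function.uncurry fun (v : Vec d) (z : Sample d) => inner ℝ z.1 v ^ 2) := by
    unfold Function.uncurry; fun_prop
  have hint : Integrable (fun ω => inner ℝ (z t ω).1 (V ω) ^ 2) P :=
    (integrable_and_integral_le_of_indepFun (f := fun v (z : Sample d) => inner ℝ z.1 v ^ 2)
      (g := fun v => inner ℝ v (H v)) hVm.aemeasurable (hz.measurable t).aemeasurable hind hm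
      (fun _ _ => sq_nonneg _) (by fun_prop)
      (by rw [hz.map_eq]; simpa only [sq] using fun v => h.integrable_inner_mul v v)
      (by rw [hz.map_eq]; simpa only [sq] using fun v => (h.integral_inner_mul v v).le)
      (integrable_quadForm H hV)).1
  exact ⟨hint, (integral_eq_of_indepFun (f := fun v (z : Sample d) => inner ℝ z.1 v ^ 2)
      (g := fun v => inner ℝ v (H v)) hVm.aemeasurable (hz.measurable t).aemeasurable hind hm
      (by fun_prop) hint (by rw [hz.map_eq]; simpa only [sq] using fun v => h.integral_inner_mul v v)).2⟩

/-- By coupling, the difference is BV, where B is the linear part of the last u steps and V, the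
noise accumulated before, is independent of B with covariance at most aI. Hence the mean quadratic
form is at most a times the mean trace of BᵀHB. -/
theorem integral_quadForm_noise_sub_le (hz : IsStream P z ν) (h : CenteredLaw ν H σ R)
    (hκ : 0 ≤ γ * (2 - γ * R ^ 2)) {a : ℝ} (ha : 0 ≤ a)
    (haκ : γ ^ 2 * σ ^ 2 ≤ a * (γ * (2 - γ * R ^ 2))) {u t : ℕ} (hut : u ≤ t) :
    ∫ ω, inner ℝ (sgdIter γ 0 (fun i => z i ω) (-(t : ℤ)) t -
        sgdIter γ 0 (fun i => z i ω) (-(u : ℤ)) u)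
      (H (sgdIter γ 0 (fun i => z i ω) (-(t : ℤ)) t -
        sgdIter γ 0 (fun i => z i ω) (-(u : ℤ)) u)) ∂P ≤
    a * ∑ j, ∫ ω, inner ℝ (linIter γ (fun i => z i ω) (-(u : ℤ)) u
        (EuclideanSpace.basisFun (Fin d) ℝ j))
      (H (linIter γ (fun i => z i ω) (-(u : ℤ)) u (EuclideanSpace.basisFun (Fin d) ℝ j))) ∂P := by
  set e := EuclideanSpace.basisFun (Fin d) ℝ
  set V : Ω → Vec d := fun ω => sgdIter γ 0 (fun i => z i ω) (-(t : ℤ)) (t - u) with hVdef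
  set B : Fin d → Ω → Vec d := fun j ω => linIter γ (fun i => z i ω) (-(u : ℤ)) u (e j) with hBdef
  -- `G` is Bᵀx₀. The sample at time 0 is used by neither iterate, so the quadratic form of H is the
  -- mean of ⟨x₀, BV⟩² = ⟨G, V⟩², to which the covariance bound applies with `G` frozen.
  set G : Ω → Vec d := fun ω => WithLp.toLp 2 fun j => inner ℝ (z 0 ω).1 (B j ω) with hGdef
  set D : Ω → Vec d := fun ω => sgdIter γ 0 (fun i => z i ω) (-(t : ℤ)) t -
        sgdIter γ 0 (fun i => z i ω) (-(u : ℤ)) u with hDdef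
  have hVm := hz.measurable_sgdIter γ 0 (-(t : ℤ)) (t - u)
  have hV := hz.memLp_sgdIter h hκ 0 (-(t : ℤ)) (t - u)
  have hD : MemLp D 2 P :=
    (hz.memLp_sgdIter h hκ 0 (-(t : ℤ)) t).sub (hz.memLp_sgdIter h hκ 0 (-(u : ℤ)) u)
  have hDpast : Measurable[samplesIn z (Set.Ico (-(t : ℤ)) 0)] D :=
    Measurable.sub (AvgStartSGD.measurable_sgdIter γ 0 z (-(t : ℤ)) t (by simp))
      (AvgStartSGD.measurable_sgdIter γ 0 z (-(u : ℤ)) u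
        (Set.Ico_subset_Ico (by omega) (by omega)))
  have hBpast : ∀ j, Measurable[samplesIn z (Set.Icc (-(u : ℤ)) 0)] (B j) := fun j =>
    AvgStartSGD.measurable_linIter γ (e j) z (-(u : ℤ)) u
      (by intro i; simp only [Set.mem_Ico, Set.mem_Icc]; omega)
  have hGpast : Measurable[samplesIn z (Set.Icc (-(u : ℤ)) 0)] G := by
    refine (WithLp.measurable_toLp 2 _).comp
      (@measurable_pi_lambda _ _ _ (samplesIn z (Set.Icc (-(u : ℤ)) 0)) _ _ fun j => ?_)
    have h0 : Measurable[samplesIn z (Set.Icc (-(u : ℤ)) 0)] (z 0) :=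
      measurable_samplesIn z (by simp)
    exact (measurable_fst.comp h0).inner (hBpast j)
  have hGm : Measurable G := hGpast.mono (samplesIn_le hz.measurable _) le_rfl
  have hVG : IndepFun G V P := by
    refine hz.indepFun (S := Set.Icc (-(u : ℤ)) 0)
      (T := Set.Ico (-(t : ℤ)) (-(t : ℤ) + ((t - u : ℕ) : ℤ))) ?_ hGpast
      (AvgStartSGD.measurable_sgdIter γ 0 z (-(t : ℤ)) (t - u) subset_rfl)
    rw [Set.disjoint_left]
    intro i
    simp only [Set.mem_Ico, Set.mem_Icc]
    omega
  have hGV : ∀ ω, inner ℝ (z 0 ω).1 (D ω) = inner ℝ (G ω) (V ω) := by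
    intro ω
    have h1 : D ω = linIter γ (fun i => z i ω) (-(u : ℤ)) u (V ω) := by
      simp only [hDdef, hVdef, sgdIter_zero_eq_add_linIter γ (fun i => z i ω) hut]
      abel
    have h2 : V ω = ∑ j, V ω j • e j := by
      conv_lhs => rw [← e.sum_repr (V ω)]
      rfl
    rw [h1, h2, map_sum, inner_sum, ← h2, PiLp.inner_apply]
    refine Finset.sum_congr rfl fun j _ => ?_
    rw [map_smul, real_inner_smul_right]
    simp [hGdef, hBdef]
  have hBz : ∀ j, Integrable (fun ω => inner ℝ (z 0 ω).1 (B j ω) ^ 2) P ∧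
      ∫ ω, inner ℝ (z 0 ω).1 (B j ω) ^ 2 ∂P = ∫ ω, inner ℝ (B j ω) (H (B j ω)) ∂P := fun j =>
    hz.integral_inner_sample_sq h (hz.measurable_linIter γ (e j) (-(u : ℤ)) u)
      (hz.memLp_linIter h hκ (e j) (-(u : ℤ)) u)
      (hz.indepFun_sample (S := Set.Ico (-(u : ℤ)) 0) (by simp)
        (AvgStartSGD.measurable_linIter γ (e j) z (-(u : ℤ)) u (by simp)))
  have hGsq : ∀ ω, ‖G ω‖ ^ 2 = ∑ j, inner ℝ (z 0 ω).1 (B j ω) ^ 2 := by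
    intro ω
    rw [EuclideanSpace.norm_sq_eq]
    simp [hGdef]
  have hGint : Integrable (fun ω => a * ‖G ω‖ ^ 2) P := by
    simp only [hGsq]
    exact (integrable_finsetSum _ fun j _ => (hBz j).1).const_mul a
  have hI2 : ∀ u : Vec d, Integrable (fun ω => inner ℝ u (V ω) ^ 2) P := fun u => by
    have hmem : MemLp (fun ω => inner ℝ u (V ω)) 2 P := (innerSL ℝ u).comp_memLp' hV
    simpa using integrable_normSq hmem
  have hsqm : ∀ g : Vec d, AEStronglyMeasurable (fun v : Vec d => inner ℝ g v ^ 2) (P.map V) :=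
    fun g => (by fun_prop : Measurable fun v : Vec d => inner ℝ g v ^ 2).aestronglyMeasurable
  have key := (integrable_and_integral_le_of_indepFun (P := P)
    (f := fun (g v : Vec d) => inner ℝ g v ^ 2) (g := fun g => a * ‖g‖ ^ 2)
    hGm.aemeasurable hVm.aemeasurable hVG (by unfold Function.uncurry; fun_prop)
    (fun _ _ => sq_nonneg _) (by fun_prop)
    (fun g => (integrable_map_measure (hsqm g) hVm.aemeasurable).2 (hI2 g))
    (fun g => by
      rw [integral_map hVm.aemeasurable (hsqm g)]
      exact hz.integral_inner_sq_sgdIter_zero_le h hκ ha haκ _ _ g) hGint).2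
  rw [← (hz.integral_inner_sample_sq (t := 0) h
    (hDpast.mono (samplesIn_le hz.measurable _) le_rfl) hD
    (hz.indepFun_sample (by simp) hDpast)).2]
  simp only [hGV]
  refine key.trans (le_of_eq ?_)
  simp only [hGsq]
  rw [integral_const_mul, integral_finsetSum _ fun j _ => (hBz j).1]
  simp only [(hBz _).2]
  rfl

theorem memLp_startAvg (hz : IsStream P z ν) (h : CenteredLaw ν H σ R)
    (hκ : 0 ≤ γ * (2 - γ * R ^ 2)) (v : Vec d) (W : Finset ℕ) :
    MemLp (fun ω => startAvg γ v (fun t => z t ω) W) 2 P :=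
  (memLp_finsetSum W fun (t : ℕ) _ => hz.memLp_sgdIter h hκ v (-(t : ℤ)) t).const_smul
    (W.card : ℝ)⁻¹

/-- The difference of two averages is the average of the differences over all pairs of starting
times, and convexity applies. The bound for a pair depends only on the smaller lag, so the sum over
`W` cancels its cardinality and the sum over the other window telescopes. -/
theorem integral_quadForm_startAvg_zero_sub_le (hz : IsStream P z ν) (h : CenteredLaw ν H σ R)
    (hκ : 0 < γ * (2 - γ * R ^ 2)) {a : ℝ} (ha : 0 ≤ a)
    (haκ : γ ^ 2 * σ ^ 2 ≤ a * (γ * (2 - γ * R ^ 2)))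
    {lam : ℝ} (hlam : ∀ v, lam * ‖v‖ ^ 2 ≤ inner ℝ v (H v))
    (hξ : γ * (2 - γ * R ^ 2) * lam ≤ 1) {lo hi : ℕ} (hlohi : lo ≤ hi) {W : Finset ℕ}
    (hW : W.Nonempty) (hhi : ∀ t ∈ W, hi ≤ t) :
    ∫ ω, inner ℝ (startAvg γ 0 (fun i => z i ω) W - startAvg γ 0 (fun i => z i ω) (.Icc lo hi))
      (H (startAvg γ 0 (fun i => z i ω) W - startAvg γ 0 (fun i => z i ω) (.Icc lo hi))) ∂P ≤
    (1 - γ * (2 - γ * R ^ 2) * lam) ^ lo / (Finset.Icc lo hi).card *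
      (a * d / (γ * (2 - γ * R ^ 2))) := by
  set U := Finset.Icc lo hi with hU
  have hUne : U.Nonempty := Finset.nonempty_Icc.2 hlohi
  have hUc : (0 : ℝ) < U.card := by exact_mod_cast hUne.card_pos
  have hWc : (0 : ℝ) < W.card := by exact_mod_cast hW.card_pos
  set n : ℕ → Ω → Vec d := fun t ω => sgdIter γ 0 (fun i => z i ω) (-(t : ℤ)) t with hn
  have hnmem : ∀ t, MemLp (n t) 2 P := fun t => hz.memLp_sgdIter h hκ.le 0 _ _
  have hprod : ∀ ω, startAvg γ 0 (fun i => z i ω) W - startAvg γ 0 (fun i => z i ω) U =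
      ((U ×ˢ W).card : ℝ)⁻¹ • ∑ p ∈ U ×ˢ W, (n p.2 ω - n p.1 ω) := by
    intro ω
    rw [Finset.sum_product, Finset.card_product]
    simp only [Finset.sum_sub_distrib, Finset.sum_const, startAvg, hn]
    push_cast
    simp only [← Nat.cast_smul_eq_nsmul ℝ, ← Finset.smul_sum, smul_sub, smul_smul]
    congr 2 <;> field_simp
  have i1 := integrable_quadForm H
    ((hz.memLp_startAvg h hκ.le 0 W).sub (hz.memLp_startAvg h hκ.le 0 U))
  have i2 : ∀ p : ℕ × ℕ, Integrable (fun ω => inner ℝ (n p.2 ω - n p.1 ω)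
      (H (n p.2 ω - n p.1 ω))) P := fun p =>
    integrable_quadForm H ((hnmem p.2).sub (hnmem p.1))
  have h1 := integral_mono i1 ((integrable_finsetSum (U ×ˢ W) fun p _ => i2 p).const_mul
    ((U ×ˢ W).card : ℝ)⁻¹) (fun ω => by
      simp only [Pi.sub_apply, hprod ω]
      exact h.quadForm_average_le (hUne.product hW) fun p => n p.2 ω - n p.1 ω)
  simp only [Pi.sub_apply] at h1
  refine h1.trans ?_
  rw [integral_const_mul, integral_finsetSum _ fun p _ => i2 p]
  set e := EuclideanSpace.basisFun (Fin d) ℝ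
  have h2 : ∑ p ∈ U ×ˢ W, ∫ ω, inner ℝ (n p.2 ω - n p.1 ω) (H (n p.2 ω - n p.1 ω)) ∂P ≤
      ∑ p ∈ U ×ˢ W, a * ∑ j, ∫ ω, inner ℝ (linIter γ (fun i => z i ω) (-(p.1 : ℤ)) p.1 (e j))
        (H (linIter γ (fun i => z i ω) (-(p.1 : ℤ)) p.1 (e j))) ∂P := by
    refine Finset.sum_le_sum fun p hp => ?_
    rw [Finset.mem_product] at hp
    exact hz.integral_quadForm_noise_sub_le h hκ.le ha haκ
      ((Finset.mem_Icc.1 hp.1).2.trans (hhi _ hp.2))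
  have h2' : ∑ p ∈ U ×ˢ W, a * ∑ j, ∫ ω,
        inner ℝ (linIter γ (fun i => z i ω) (-(p.1 : ℤ)) p.1 (e j))
          (H (linIter γ (fun i => z i ω) (-(p.1 : ℤ)) p.1 (e j))) ∂P =
      W.card * (a * ∑ j, ∑ u ∈ U, ∫ ω, inner ℝ (linIter γ (fun i => z i ω) (-(u : ℤ)) u (e j))
        (H (linIter γ (fun i => z i ω) (-(u : ℤ)) u (e j))) ∂P) := by
    rw [Finset.sum_product, Finset.sum_comm (s := Finset.univ)]
    simp only [Finset.sum_const, nsmul_eq_mul, ← Finset.mul_sum]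
  rw [h2'] at h2
  have h3 : ∑ j, ∑ u ∈ U, ∫ ω, inner ℝ (linIter γ (fun i => z i ω) (-(u : ℤ)) u (e j))
        (H (linIter γ (fun i => z i ω) (-(u : ℤ)) u (e j))) ∂P ≤
      d * ((1 - γ * (2 - γ * R ^ 2) * lam) ^ lo / (γ * (2 - γ * R ^ 2))) := by
    calc _ ≤ ∑ j : Fin d, (1 - γ * (2 - γ * R ^ 2) * lam) ^ lo * ‖e j‖ ^ 2 /
          (γ * (2 - γ * R ^ 2)) :=
          Finset.sum_le_sum fun j _ => hz.sum_quadForm_linIter_le h hκ hlam hξ (e j) lo hi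
      _ = _ := by simp
  rw [Finset.card_product]
  push_cast
  calc _ ≤ ((U.card : ℝ) * W.card)⁻¹ * (W.card * (a *
        (d * ((1 - γ * (2 - γ * R ^ 2) * lam) ^ lo / (γ * (2 - γ * R ^ 2)))))) := by
        gcongr
        exact h2.trans (by gcongr)
    _ = _ := by field_simp

theorem integral_quadForm_linIter_average_le (hz : IsStream P z ν) (h : CenteredLaw ν H σ R)
    (hκ : 0 < γ * (2 - γ * R ^ 2)) {lam : ℝ} (hlam : ∀ v, lam * ‖v‖ ^ 2 ≤ inner ℝ v (H v))
    (hξ : γ * (2 - γ * R ^ 2) * lam ≤ 1) (v : Vec d) {lo hi : ℕ} (hlohi : lo ≤ hi) :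
    ∫ ω, inner ℝ (((Finset.Icc lo hi).card : ℝ)⁻¹ • ∑ t ∈ Finset.Icc lo hi,
        linIter γ (fun i => z i ω) (-(t : ℤ)) t v)
      (H (((Finset.Icc lo hi).card : ℝ)⁻¹ • ∑ t ∈ Finset.Icc lo hi,
        linIter γ (fun i => z i ω) (-(t : ℤ)) t v)) ∂P ≤
    (1 - γ * (2 - γ * R ^ 2) * lam) ^ lo / (Finset.Icc lo hi).card *
      (‖v‖ ^ 2 / (γ * (2 - γ * R ^ 2))) := by
  set U := Finset.Icc lo hi with hU
  have hUne : U.Nonempty := Finset.nonempty_Icc.2 hlohi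
  have hmem : ∀ t : ℕ, MemLp (fun ω => linIter γ (fun i => z i ω) (-(t : ℤ)) t v) 2 P :=
    fun t => hz.memLp_linIter h hκ.le v _ _
  have h1 := integral_mono (integrable_quadForm H
      ((memLp_finsetSum U fun t _ => hmem t).const_smul (U.card : ℝ)⁻¹))
    ((integrable_finsetSum U fun t _ => integrable_quadForm H (hmem t)).const_mul (U.card : ℝ)⁻¹)
    (fun ω => h.quadForm_average_le hUne fun t => linIter γ (fun i => z i ω) (-(t : ℤ)) t v)
  refine h1.trans ?_
  rw [integral_const_mul, integral_finsetSum _ fun t _ => integrable_quadForm H (hmem t)]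
  calc _ ≤ (U.card : ℝ)⁻¹ *
        ((1 - γ * (2 - γ * R ^ 2) * lam) ^ lo * ‖v‖ ^ 2 / (γ * (2 - γ * R ^ 2))) := by
        gcongr
        exact hz.sum_quadForm_linIter_le h hκ hlam hξ v lo hi
    _ = _ := by ring

/-- The noise parts of the two averages must be compared with each other, since neither decays
alone; the contributions of the starting point are small separately. The one from the older window
is dominated by that of the newer, as its lags are larger and its window at least as long, hence the
constant 8 = 4 + 4. -/
theorem integral_quadForm_startAvg_sub_le (hz : IsStream P z ν) (h : CenteredLaw ν H σ R)
    (hκ : 0 < γ * (2 - γ * R ^ 2)) {a : ℝ} (ha : 0 ≤ a)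
    (haκ : γ ^ 2 * σ ^ 2 ≤ a * (γ * (2 - γ * R ^ 2)))
    {lam : ℝ} (hlam0 : 0 ≤ lam) (hlam : ∀ v, lam * ‖v‖ ^ 2 ≤ inner ℝ v (H v))
    (hξ : γ * (2 - γ * R ^ 2) * lam ≤ 1) (v : Vec d) {lo hi lo' hi' : ℕ} (hlohi : lo ≤ hi)
    (hlohi' : lo' ≤ hi') (hhilo : hi ≤ lo')
    (hcard : (Finset.Icc lo hi).card ≤ (Finset.Icc lo' hi').card) :
    ∫ ω, inner ℝ
        (startAvg γ v (fun i => z i ω) (.Icc lo' hi') - startAvg γ v (fun i => z i ω) (.Icc lo hi))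
      (H (startAvg γ v (fun i => z i ω) (.Icc lo' hi') -
        startAvg γ v (fun i => z i ω) (.Icc lo hi))) ∂P ≤
    8 * ((a * d + ‖v‖ ^ 2) / (γ * (2 - γ * R ^ 2))) *
      ((1 - γ * (2 - γ * R ^ 2) * lam) ^ lo / (Finset.Icc lo hi).card) := by
  set U := Finset.Icc lo hi with hU
  set W := Finset.Icc lo' hi' with hW
  have hUne : U.Nonempty := Finset.nonempty_Icc.2 hlohi
  have hWne : W.Nonempty := Finset.nonempty_Icc.2 hlohi'
  have hUc : (0 : ℝ) < U.card := by exact_mod_cast hUne.card_pos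
  have hUW : (U.card : ℝ) ≤ W.card := by exact_mod_cast hcard
  set b : Finset ℕ → Ω → Vec d := fun S ω => (S.card : ℝ)⁻¹ • ∑ t ∈ S,
    linIter γ (fun i => z i ω) (-(t : ℤ)) t v with hb
  have hbmem : ∀ S, MemLp (b S) 2 P := fun S =>
    (memLp_finsetSum S fun t _ => hz.memLp_linIter h hκ.le v (-(t : ℤ)) t).const_smul
      (S.card : ℝ)⁻¹
  set n : Ω → Vec d := fun ω => startAvg γ 0 (fun i => z i ω) W - startAvg γ 0 (fun i => z i ω) U
    with hn
  have hnmem : MemLp n 2 P := (hz.memLp_startAvg h hκ.le 0 W).sub (hz.memLp_startAvg h hκ.le 0 U)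
  have hdecomp : ∀ ω, startAvg γ v (fun i => z i ω) W - startAvg γ v (fun i => z i ω) U =
      n ω + (b W ω + (-1 : ℝ) • b U ω) := by
    intro ω
    have h1 : ∀ t : ℕ, sgdIter γ v (fun i => z i ω) (-(t : ℤ)) t =
        sgdIter γ 0 (fun i => z i ω) (-(t : ℤ)) t + linIter γ (fun i => z i ω) (-(t : ℤ)) t v :=
      fun t => by rw [← sgdIter_eq_add_linIter, zero_add]
    simp only [hn, hb, startAvg, h1, Finset.sum_add_distrib, smul_add]
    module
  have hpt : ∀ ω, inner ℝ
      (startAvg γ v (fun i => z i ω) W - startAvg γ v (fun i => z i ω) U)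
      (H (startAvg γ v (fun i => z i ω) W - startAvg γ v (fun i => z i ω) U)) ≤
      2 * inner ℝ (n ω) (H (n ω)) + (4 * inner ℝ (b W ω) (H (b W ω)) +
        4 * inner ℝ (b U ω) (H (b U ω))) := by
    intro ω
    rw [hdecomp]
    have h1 := h.quadForm_add_le (n ω) (b W ω + (-1 : ℝ) • b U ω)
    have h2 := h.quadForm_add_le (b W ω) ((-1 : ℝ) • b U ω)
    rw [CenteredLaw.quadForm_smul H (-1)] at h2
    linarith
  have jn := (integrable_quadForm H hnmem).const_mul 2
  have jW := (integrable_quadForm H (hbmem W)).const_mul 4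
  have jU := (integrable_quadForm H (hbmem U)).const_mul 4
  have jWU : Integrable (fun ω => 4 * inner ℝ (b W ω) (H (b W ω)) +
        4 * inner ℝ (b U ω) (H (b U ω))) P := jW.add jU
  have h1 := integral_mono (integrable_quadForm H
    ((hz.memLp_startAvg h hκ.le v W).sub (hz.memLp_startAvg h hκ.le v U))) (jn.add jWU) hpt
  simp only [Pi.sub_apply, Pi.add_apply] at h1
  rw [integral_add jn jWU, integral_add jW jU, integral_const_mul, integral_const_mul,
    integral_const_mul] at h1
  have h2 := hz.integral_quadForm_startAvg_zero_sub_le h hκ ha haκ hlam hξ hlohi hWne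
    (fun t ht => hhilo.trans (Finset.mem_Icc.1 ht).1)
  have h3 := hz.integral_quadForm_linIter_average_le h hκ hlam hξ v hlohi
  have h4 := hz.integral_quadForm_linIter_average_le h hκ hlam hξ v hlohi'
  have hr0 : 0 ≤ 1 - γ * (2 - γ * R ^ 2) * lam := sub_nonneg.2 hξ
  have hr1 : 1 - γ * (2 - γ * R ^ 2) * lam ≤ 1 := by
    linarith [mul_nonneg hκ.le hlam0]
  have h5 : (1 - γ * (2 - γ * R ^ 2) * lam) ^ lo' / W.card ≤
      (1 - γ * (2 - γ * R ^ 2) * lam) ^ lo / U.card :=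
    div_le_div₀ (pow_nonneg hr0 _) (pow_le_pow_of_le_one hr0 hr1 (hlohi.trans hhilo)) hUc hUW
  set r := (1 - γ * (2 - γ * R ^ 2) * lam) ^ lo / (U.card : ℝ) with hr
  have hrnn : 0 ≤ r := by positivity
  have h6 : (1 - γ * (2 - γ * R ^ 2) * lam) ^ lo' / W.card * (‖v‖ ^ 2 / (γ * (2 - γ * R ^ 2))) ≤
      r * (‖v‖ ^ 2 / (γ * (2 - γ * R ^ 2))) := by gcongr
  have h7 : 0 ≤ r * (a * d / (γ * (2 - γ * R ^ 2))) := by positivity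
  have h8 : 8 * ((a * d + ‖v‖ ^ 2) / (γ * (2 - γ * R ^ 2))) * r =
      8 * (r * (a * d / (γ * (2 - γ * R ^ 2)))) + 8 * (r * (‖v‖ ^ 2 / (γ * (2 - γ * R ^ 2)))) := by
    ring
  rw [h8]
  linarith

end IsStream

end StartAverages

/-! ### Correctness and running time of the programs -/

section ProgramCorrectness

variable {d : ℕ} {ι A B : Type}

theorem Prog.eval_bind (p : Prog d ι A) (g : A → Prog d ι B) (z : ι → Sample d) :
    (p.bind g).eval z = (g (p.eval z)).eval z := by
  induction p with
  | ret a => rfl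
  | draw i next ih => exact ih (z i)

theorem Prog.time_bind (p : Prog d ι A) (g : A → Prog d ι B) (z : ι → Sample d) :
    (p.bind g).time z = p.time z + (g (p.eval z)).time z := by
  induction p with
  | ret a => simp [Prog.bind, Prog.time, Prog.eval]
  | draw i next ih =>
    simp only [Prog.bind, Prog.time, Prog.eval, ih]
    omega

theorem theta_neg_zero (γ : ℝ) (θ : Vec d) (z : ℤ → Sample d) (t : ℕ) :
    theta γ θ z (-(t : ℤ)) 0 = sgdIter γ θ z (-(t : ℤ)) t := by
  simp [theta]

theorem theta_zero_natCast (γ : ℝ) (θ : Vec d) (z : ℤ → Sample d) (t : ℕ) :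
    theta γ θ z 0 t = sgdIter γ θ z 0 t := by
  simp [theta]

section Lags

variable {k s : ℕ}

theorem card_lagSet_zero (hs : s < k) : ((lagSet k s 0).card : ℝ) = (k : ℝ) - s := by
  rw [← Nat.cast_sub hs.le]
  simp only [lagSet, lagLo, lagHi, Nat.card_Icc]
  congr 1
  omega

theorem mul_two_pow_sub_one (k n : ℕ) : k * (2 ^ n - 1) = k * 2 ^ n - k := by
  rw [Nat.mul_sub, mul_one]

theorem le_mul_two_pow (k n : ℕ) : k ≤ k * 2 ^ n := Nat.le_mul_of_pos_right _ (by positivity)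

theorem card_lagSet_succ (hk : 0 < k) (l : ℕ) :
    (lagSet k s (l + 1)).card = k * 2 ^ (l + 1) := by
  simp only [lagSet, lagLo, lagHi, Nat.card_Icc, mul_two_pow_sub_one]
  have h1 : k * 2 ^ (l + 1 + 1) = 2 * (k * 2 ^ (l + 1)) := by ring
  have := le_mul_two_pow k (l + 1)
  omega

theorem lagLo_le_lagHi (hs : s < k) (l : ℕ) : lagLo k s l ≤ lagHi k l := by
  cases l with
  | zero => simp only [lagLo, lagHi]; omega
  | succ l =>
    simp only [lagLo, lagHi, mul_two_pow_sub_one]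
    have h1 : k * 2 ^ (l + 1 + 1) = 2 * (k * 2 ^ (l + 1)) := by ring
    have := le_mul_two_pow k (l + 1)
    omega

theorem lagHi_le_lagLo_succ (k s l : ℕ) : lagHi k l ≤ lagLo k s (l + 1) := by
  simp only [lagHi, lagLo]; omega

theorem card_lagSet_le_succ (hs : s < k) (l : ℕ) :
    (lagSet k s l).card ≤ (lagSet k s (l + 1)).card := by
  rw [card_lagSet_succ (by omega)]
  cases l with
  | zero =>
    simp only [lagSet, lagLo, lagHi, Nat.card_Icc]
    omega
  | succ l =>
    rw [card_lagSet_succ (by omega)]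
    exact Nat.mul_le_mul_left _ (Nat.pow_le_pow_right (by norm_num) (by omega))

theorem fAvg_eq_startAvg (γ : ℝ) (θ : Vec d) (hs : s < k) (z : ℤ → Sample d) (l : ℕ) :
    fAvg γ θ k s z l = startAvg γ θ z (lagSet k s l) := by
  cases l with
  | zero =>
    simp only [fAvg, startAvg, theta_neg_zero, card_lagSet_zero hs]
    congr 2
    ext i
    simp only [lagSet, lagLo, lagHi, Finset.mem_Ico, Finset.mem_Icc]
    omega
  | succ l =>
    simp only [fAvg, startAvg, theta_neg_zero, card_lagSet_succ (s := s) (by omega : 0 < k)]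
    push_cast
    congr 2
    ext i
    simp only [lagSet, lagLo, lagHi, Finset.mem_Ico, Finset.mem_Icc, mul_two_pow_sub_one]
    have h1 : k * 2 ^ (l + 1 + 1) = 2 * (k * 2 ^ (l + 1)) := by ring
    have h2 : k * 2 ^ (l + 2) = 2 * (k * 2 ^ (l + 1)) := by ring
    have := le_mul_two_pow k (l + 1)
    omega

end Lags

/-- An affine map commutes with averages; hence one state can stand for all the runs that share a
sample. -/
theorem sgdStep_average (γ : ℝ) (z : Sample d) {S : Finset ℕ} (hS : S.Nonempty)
    (f : ℕ → Vec d) :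
    sgdStep γ z ((S.card : ℝ)⁻¹ • ∑ i ∈ S, f i) =
      (S.card : ℝ)⁻¹ • ∑ i ∈ S, sgdStep γ z (f i) := by
  have hc : (S.card : ℝ) ≠ 0 := by exact_mod_cast hS.card_pos.ne'
  have h1 : ∀ v : Vec d, sgdStep γ z v = sgdStep γ z 0 + sgdStep γ (noiseFree z) v := fun v => by
    rw [← sgdStep_add, zero_add]
  have h2 : sgdStep γ (noiseFree z) (∑ i ∈ S, f i) = ∑ i ∈ S, sgdStep γ (noiseFree z) (f i) := by
    simp only [sgdStep, noiseFree, sub_zero, inner_sum, Finset.sum_sub_distrib, ← Finset.sum_smul,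
      Finset.mul_sum]
  rw [h1, sgdStep_noiseFree_smul, h2]
  simp only [h1 (f _), Finset.sum_add_distrib, Finset.sum_const, smul_add,
    ← Nat.cast_smul_eq_nsmul ℝ, smul_smul, inv_mul_cancel₀ hc, one_smul]

/-- The state at time `-r` of the one-pass computation: the average of `θ_{-h : -r}` over the
starting times `-h` between `-b` and `-a` that are not after `-r`. -/
noncomputable def etaState (γ : ℝ) (θ : Vec d) (z : ℤ → Sample d) (a b r : ℕ) : Vec d :=
  if b < r then θ
  else ((Finset.Icc (max a r) b).card : ℝ)⁻¹ •
    ∑ h ∈ Finset.Icc (max a r) b, sgdIter γ θ z (-(h : ℤ)) (h - r)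

theorem etaState_of_le (γ : ℝ) (θ : Vec d) (z : ℤ → Sample d) {a b r : ℕ} (hab : a ≤ b)
    (hbr : b ≤ r) : etaState γ θ z a b r = θ := by
  rcases hbr.lt_or_eq with h | rfl
  · simp [etaState, h]
  -- For r = b the window is {b}, and its run has not made a step yet.
  · simp [etaState, hab, sgdIter]

theorem etaState_zero (γ : ℝ) (θ : Vec d) (z : ℤ → Sample d) (a b : ℕ) :
    etaState γ θ z a b 0 = startAvg γ θ z (.Icc a b) := by
  simp [etaState, startAvg]

theorem etaUpdate_etaState (γ : ℝ) (θ : Vec d) (z : ℤ → Sample d) {a b : ℕ} (hab : a ≤ b)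
    (r : ℕ) : etaUpdate γ θ a b (r + 1) (z (-((r : ℤ) + 1))) (etaState γ θ z a b (r + 1)) =
      etaState γ θ z a b r := by
  rcases Nat.lt_or_ge b (r + 1) with hb | hb
  · rw [etaUpdate, if_pos hb, etaState_of_le γ θ z hab (by omega)]
  have hstep : ∀ h, r + 1 ≤ h → sgdStep γ (z (-((r : ℤ) + 1)))
      (sgdIter γ θ z (-(h : ℤ)) (h - (r + 1))) = sgdIter γ θ z (-(h : ℤ)) (h - r) := by
    intro h hh
    rw [show h - r = h - (r + 1) + 1 by omega]
    simp only [sgdIter]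
    congr 2
    omega
  have hne : (Finset.Icc (max a (r + 1)) b).Nonempty := Finset.nonempty_Icc.2 (by omega)
  have hS : sgdStep γ (z (-((r : ℤ) + 1))) (etaState γ θ z a b (r + 1)) =
      ((Finset.Icc (max a (r + 1)) b).card : ℝ)⁻¹ •
        ∑ h ∈ Finset.Icc (max a (r + 1)) b, sgdIter γ θ z (-(h : ℤ)) (h - r) := by
    rw [etaState, if_neg (by omega), sgdStep_average γ _ hne]
    congr 1
    refine Finset.sum_congr rfl fun h hh => hstep h ?_
    have := (Finset.mem_Icc.1 hh).1
    omega
  rw [etaUpdate, if_neg (by omega), hS]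
  -- If a ≤ r, a new run starts at time -r and joins the b - r older ones, with weight 1/(b - r +
  -- 1). Otherwise the set of runs is complete and is only advanced.
  by_cases ha : a < r + 1
  · have hsum : ∑ h ∈ Finset.Icc r b, sgdIter γ θ z (-(h : ℤ)) (h - r) =
        sgdIter γ θ z (-(r : ℤ)) (r - r) +
          ∑ h ∈ Finset.Ioc r b, sgdIter γ θ z (-(h : ℤ)) (h - r) := by
      rw [← Finset.Ioc_insert_left (by omega : r ≤ b), Finset.sum_insert (by simp)]
    rw [if_pos ha, etaState, if_neg (by omega), max_eq_right (by omega : a ≤ r + 1),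
      max_eq_right (by omega : a ≤ r), hsum]
    have hIoc : Finset.Icc (r + 1) b = Finset.Ioc r b := by
      ext; simp only [Finset.mem_Icc, Finset.mem_Ioc]; omega
    have hbr : (r : ℝ) + 1 ≤ b := by exact_mod_cast hb
    have hc1 : ((Finset.Ioc r b).card : ℝ) = (b : ℝ) - r := by
      rw [Nat.card_Ioc, Nat.cast_sub (by omega)]
    have hc2 : ((Finset.Icc r b).card : ℝ) = (b : ℝ) - r + 1 := by
      rw [Nat.card_Icc, Nat.cast_sub (by omega)]; push_cast; ring
    rw [hIoc, hc1, hc2, smul_smul, show (b : ℝ) - ((r + 1 : ℕ) : ℝ) + 1 = b - r by push_cast; ring,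
      show (b : ℝ) - ((r + 1 : ℕ) : ℝ) + 2 = b - r + 1 by push_cast; ring,
      mul_inv_cancel₀ (by linarith), one_smul, Nat.sub_self,
      add_comm (sgdIter γ θ z (-(r : ℤ)) 0)]
    rfl
  · rw [if_neg ha, etaState, if_neg (by omega), max_eq_left (by omega : r + 1 ≤ a),
      max_eq_left (by omega : r ≤ a)]

theorem eval_zAvgLoop (γ : ℝ) (θ : Vec d) {k s : ℕ} (hs : s < k) (e : ℤ → ι) (l : ℕ)
    (z : ι → Sample d) (r : ℕ) :
    (zAvgLoop γ θ k s e l r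
      (etaState γ θ (fun t => z (e t)) (lagLo k s (l + 1)) (lagHi k (l + 1)) r)
      (etaState γ θ (fun t => z (e t)) (lagLo k s l) (lagHi k l) r)).eval z =
      (fAvg γ θ k s (fun t => z (e t)) (l + 1), fAvg γ θ k s (fun t => z (e t)) l) := by
  induction r with
  | zero =>
    simp only [zAvgLoop, Prog.eval, etaState_zero, fAvg_eq_startAvg γ θ hs]
    rfl
  | succ r ih =>
    simp only [zAvgLoop, Prog.eval]
    rw [etaUpdate_etaState γ θ (fun t => z (e t)) (lagLo_le_lagHi hs (l + 1)) r,
      etaUpdate_etaState γ θ (fun t => z (e t)) (lagLo_le_lagHi hs l) r]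
    exact ih

theorem time_zAvgLoop (γ : ℝ) (θ : Vec d) (k s : ℕ) (e : ℤ → ι) (l : ℕ)
    (z : ι → Sample d) (r : ℕ) (η₁ η₀ : Vec d) :
    (zAvgLoop γ θ k s e l r η₁ η₀).time z = r := by
  induction r generalizing η₁ η₀ with
  | zero => rfl
  | succ r ih => simp only [zAvgLoop, Prog.time, ih]

theorem eval_zAvgProg (γ δ : ℝ) (θ : Vec d) {k s : ℕ} (hs : s < k) (e : ℤ → ι) (l : ℕ)
    (z : ι → Sample d) :
    (zAvgProg γ δ θ k s e l).eval z = zAvg γ δ θ k s (fun t => z (e t)) l := by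
  have h1 := eval_zAvgLoop γ θ hs e l z (lagHi k (l + 1))
  -- Drawing begins at the earliest start of level l + 1, no later than any start of level l, so the
  -- loop invariant holds for both levels with the initial state θ.
  rw [etaState_of_le _ _ _ (lagLo_le_lagHi hs (l + 1)) le_rfl,
    etaState_of_le _ _ _ (lagLo_le_lagHi hs l)
      ((lagHi_le_lagLo_succ k s l).trans (lagLo_le_lagHi hs (l + 1)))] at h1
  rw [zAvgProg, Prog.eval_bind, h1]
  rfl

theorem time_zAvgProg (γ δ : ℝ) (θ : Vec d) (k s : ℕ) (e : ℤ → ι) (l : ℕ)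
    (z : ι → Sample d) : (zAvgProg γ δ θ k s e l).time z = lagHi k (l + 1) := by
  rw [zAvgProg, Prog.time_bind, time_zAvgLoop]
  rfl

/-- The accumulated sum already contains the iterate at time t; this is why k - 1 draws suffice for
the iterates up to time k - 1. -/
theorem eval_thetaBarLoop (γ : ℝ) (θ : Vec d) (s : ℕ) (e : ℤ → ι) (z : ι → Sample d) (r t : ℕ) :
    (thetaBarLoop γ s e r t (sgdIter γ θ (fun t => z (e t)) 0 t)
      (∑ i ∈ Finset.Ico s (t + 1), sgdIter γ θ (fun t => z (e t)) 0 i)).eval z =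
      ∑ i ∈ Finset.Ico s (t + r + 1), sgdIter γ θ (fun t => z (e t)) 0 i := by
  induction r generalizing t with
  | zero => rfl
  | succ r ih =>
    simp only [thetaBarLoop, Prog.eval]
    have h1 : sgdStep γ (z (e t)) (sgdIter γ θ (fun t => z (e t)) 0 t) =
        sgdIter γ θ (fun t => z (e t)) 0 (t + 1) := by
      simp [sgdIter]
    have h2 : (if s ≤ t + 1 then (∑ i ∈ Finset.Ico s (t + 1), sgdIter γ θ (fun t => z (e t)) 0 i) +
        sgdIter γ θ (fun t => z (e t)) 0 (t + 1)
        else ∑ i ∈ Finset.Ico s (t + 1), sgdIter γ θ (fun t => z (e t)) 0 i) =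
        ∑ i ∈ Finset.Ico s (t + 1 + 1), sgdIter γ θ (fun t => z (e t)) 0 i := by
      split_ifs with hst
      · rw [Finset.sum_Ico_succ_top hst]
      · rw [Finset.Ico_eq_empty (by omega), Finset.Ico_eq_empty (by omega)]
    rw [h1, h2, ih, show t + 1 + r + 1 = t + (r + 1) + 1 by omega]

theorem time_thetaBarLoop (γ : ℝ) (s : ℕ) (e : ℤ → ι) (z : ι → Sample d) (r t : ℕ)
    (θ S : Vec d) : (thetaBarLoop γ s e r t θ S).time z = r := by
  induction r generalizing t θ S with
  | zero => rfl
  | succ r ih => simp only [thetaBarLoop, Prog.time, ih]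

theorem eval_thetaBarProg (γ : ℝ) (θ : Vec d) {k : ℕ} (hk : 0 < k) (s : ℕ) (e : ℤ → ι)
    (z : ι → Sample d) :
    (thetaBarProg γ θ k s e).eval z = thetaBar γ θ k s (fun t => z (e t)) := by
  have h1 := eval_thetaBarLoop γ θ s e z (k - 1) 0
  have h2 : ∑ i ∈ Finset.Ico s (0 + 1), sgdIter γ θ (fun t => z (e t)) 0 i =
      if s ≤ 0 then θ else 0 := by
    split_ifs with hs
    · obtain rfl : s = 0 := by omega
      simp [sgdIter]
    · rw [Finset.Ico_eq_empty (by omega), Finset.sum_empty]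
  rw [h2, show 0 + (k - 1) + 1 = k by omega] at h1
  rw [thetaBarProg, Prog.eval_bind]
  simp only [Prog.eval, thetaBar, theta_zero_natCast]
  rw [← h1]
  rfl

theorem time_thetaBarProg (γ : ℝ) (θ : Vec d) (k s : ℕ) (e : ℤ → ι) (z : ι → Sample d) :
    (thetaBarProg γ θ k s e).time z = k - 1 := by
  rw [thetaBarProg, Prog.time_bind, time_thetaBarLoop]
  rfl

theorem eval_fHatProg (γ δ q : ℝ) (θ : Vec d) {k s : ℕ} (hs : s < k) (Q : Bool) (l : ℕ)
    (z z' : ℤ → Sample d) :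
    (fHatProg γ δ q θ k s Q l).eval (Sum.elim z z') =
      fHat q (thetaBar γ θ k s z) Q (zAvg γ δ θ k s z' l) := by
  rw [fHatProg, Prog.eval_bind, eval_thetaBarProg γ θ (by omega)]
  cases Q
  · simp [fHat, Prog.eval]
  · simp [fHat, Prog.eval_bind, Prog.eval, eval_zAvgProg γ δ θ hs]

theorem time_fHatProg (γ δ q : ℝ) (θ : Vec d) (k s : ℕ) (Q : Bool) (l : ℕ)
    (z : ℤ ⊕ ℤ → Sample d) :
    (fHatProg γ δ q θ k s Q l).time z = k - 1 + if Q then lagHi k (l + 1) else 0 := by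
  rw [fHatProg, Prog.time_bind, time_thetaBarProg]
  cases Q
  · simp [Prog.time]
  · simp [Prog.time_bind, Prog.time, time_zAvgProg]

end ProgramCorrectness

/-! ### Level probabilities -/

section Levels

variable {δ : ℝ}

theorem two_pow_mul_levelProb_le (δ : ℝ) (l : ℕ) :
    2 ^ l * levelProb δ l ≤ 1 / ((l : ℝ) + 1) ^ δ := by
  have h1 : 0 < ((l : ℝ) + 1) ^ δ := by positivity
  have h2 : (0 : ℝ) ≤ 1 / (2 ^ (l + 1) * ((l : ℝ) + 2) ^ δ) := by positivity
  calc 2 ^ l * levelProb δ l ≤ 2 ^ l * (1 / (2 ^ l * ((l : ℝ) + 1) ^ δ)) := by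
        gcongr; rw [levelProb]; linarith
    _ = _ := by field_simp

/-- Replacing (l+2)^δ by (l+1)^δ in the subtracted term leaves half of the first term. -/
theorem one_div_le_levelProb (hδ : 0 ≤ δ) (l : ℕ) :
    1 / (2 ^ (l + 1) * ((l : ℝ) + 1) ^ δ) ≤ levelProb δ l := by
  have h1 : 0 < ((l : ℝ) + 1) ^ δ := by positivity
  have h2 : 1 / (2 ^ (l + 1) * ((l : ℝ) + 2) ^ δ) ≤ 1 / (2 ^ (l + 1) * ((l : ℝ) + 1) ^ δ) := by
    gcongr
    norm_num
  have h3 : 1 / (2 ^ l * ((l : ℝ) + 1) ^ δ) = 2 * (1 / (2 ^ (l + 1) * ((l : ℝ) + 1) ^ δ)) := by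
    rw [pow_succ]; field_simp
  rw [levelProb, h3]
  linarith

theorem levelProb_pos (hδ : 0 ≤ δ) (l : ℕ) : 0 < levelProb δ l :=
  lt_of_lt_of_le (by positivity) (one_div_le_levelProb hδ l)

theorem inv_levelProb_le (hδ : 0 ≤ δ) (l : ℕ) :
    (levelProb δ l)⁻¹ ≤ 2 ^ (l + 1) * ((l : ℝ) + 1) ^ δ := by
  have := one_div_le_levelProb hδ l
  rw [one_div] at this
  exact inv_le_of_inv_le₀ (by positivity) this

end Levels

/-! ### Expected running times -/

section ExpectedTime

variable {δ : ℝ}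

/-- The right-hand side is the integral of t^(-δ) over [m, m+1]. The proof needs only log x ≤ x - 1
and 1 + x ≤ exp x. -/
theorem one_div_rpow_le_telescope (hδ : 1 < δ) {m : ℝ} (hm : 0 < m) :
    1 / (m + 1) ^ δ ≤ (m ^ (1 - δ) - (m + 1) ^ (1 - δ)) / (δ - 1) := by
  have hm1 : 0 < m + 1 := by linarith
  have hr : 0 < δ - 1 := by linarith
  have h1 : 1 + (δ - 1) * (1 / (m + 1)) ≤ (m / (m + 1)) ^ (1 - δ) := by
    have hx : 0 < m / (m + 1) := by positivity
    rw [Real.rpow_def_of_pos hx]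
    have h2 := Real.log_le_sub_one_of_pos hx
    have h3 : m / (m + 1) - 1 = -(1 / (m + 1)) := by field_simp; ring
    have h4 := Real.add_one_le_exp (Real.log (m / (m + 1)) * (1 - δ))
    nlinarith
  rw [Real.div_rpow hm.le hm1.le, le_div_iff₀ (by positivity)] at h1
  rw [le_div_iff₀ hr]
  have h5 : 1 / (m + 1) ^ δ = 1 / (m + 1) * (m + 1) ^ (1 - δ) := by
    rw [Real.rpow_sub hm1, Real.rpow_one]
    field_simp
  rw [h5]
  linarith

theorem sum_one_div_rpow_le (hδ : 1 < δ) (n : ℕ) :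
    ∑ l ∈ Finset.range n, 1 / ((l : ℝ) + 1) ^ δ ≤ δ / (δ - 1) := by
  have hr : 0 < δ - 1 := by linarith
  -- The term l = 0 is kept apart, as the telescoping bound needs m > 0; this explains δ/(δ-1) = 1 +
  -- 1/(δ-1).
  have h : ∀ n : ℕ, ∑ l ∈ Finset.range (n + 1), 1 / ((l : ℝ) + 1) ^ δ ≤
      1 + (1 - ((n : ℝ) + 1) ^ (1 - δ)) / (δ - 1) := by
    intro n
    induction n with
    | zero => simp
    | succ n ih =>
      rw [Finset.sum_range_succ]
      have h1 := one_div_rpow_le_telescope hδ (by positivity : (0 : ℝ) < (n : ℝ) + 1)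
      push_cast
      have h2 : 1 + (1 - ((n : ℝ) + 1 + 1) ^ (1 - δ)) / (δ - 1) =
          1 + (1 - ((n : ℝ) + 1) ^ (1 - δ)) / (δ - 1) +
          (((n : ℝ) + 1) ^ (1 - δ) - ((n : ℝ) + 1 + 1) ^ (1 - δ)) / (δ - 1) := by ring
      rw [h2]
      exact add_le_add ih h1
  cases n with
  | zero => simp; positivity
  | succ n =>
    refine (h n).trans ?_
    have h1 : δ / (δ - 1) = 1 + 1 / (δ - 1) := by field_simp; ring
    rw [h1]
    gcongr
    have : 0 ≤ ((n : ℝ) + 1) ^ (1 - δ) := by positivity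
    linarith

variable {Ω : Type*} [MeasurableSpace Ω] {P : Measure Ω} [IsProbabilityMeasure P]

theorem lintegral_comp_level {N : Ω → ℕ} (hN : AEMeasurable N P) (G : ℕ → ℝ≥0∞) :
    ∫⁻ ω, G (N ω) ∂P = ∑' l, G l * P.map N {l} := by
  rw [← lintegral_map' (measurable_of_countable G).aemeasurable hN, lintegral_countable']

theorem map_singleton_eq {N : Ω → ℕ} (hN : Measurable N)
    (hNlaw : ∀ l, P.real (N ⁻¹' {l}) = levelProb δ l) (l : ℕ) :
    P.map N {l} = ENNReal.ofReal (levelProb δ l) := by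
  rw [Measure.map_apply hN (measurableSet_singleton l), ← hNlaw, ofReal_measureReal]

variable {d : ℕ}

theorem expectedTimeZ_le (hδ : 1 < δ) (γ : ℝ) (θ : Vec d) (k s : ℕ) (z : ℤ → Ω → Sample d)
    {N : Ω → ℕ} (hN : Measurable N) (hNlaw : ∀ l, P.real (N ⁻¹' {l}) = levelProb δ l) :
    expectedTimeZ P γ δ θ k s z N ≤ ENNReal.ofReal (4 * δ * k / (δ - 1)) := by
  have hr : 0 < δ - 1 := by linarith
  simp only [expectedTimeZ, time_zAvgProg]
  rw [lintegral_comp_level hN.aemeasurable fun l => ((lagHi k (l + 1) : ℕ) : ℝ≥0∞)]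
  have hterm : ∀ l, ((lagHi k (l + 1) : ℕ) : ℝ≥0∞) * P.map N {l} ≤
      ENNReal.ofReal (4 * k * (1 / ((l : ℝ) + 1) ^ δ)) := by
    intro l
    rw [map_singleton_eq hN hNlaw, ← ENNReal.ofReal_natCast,
      ← ENNReal.ofReal_mul (Nat.cast_nonneg _)]
    refine ENNReal.ofReal_le_ofReal ?_
    have h1 : (lagHi k (l + 1) : ℝ) ≤ 4 * k * 2 ^ l := by
      have : lagHi k (l + 1) ≤ 4 * k * 2 ^ l := by
        rw [lagHi, mul_two_pow_sub_one, show 4 * k * 2 ^ l = k * 2 ^ (l + 1 + 1) by ring]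
        omega
      exact_mod_cast this
    calc (lagHi k (l + 1) : ℝ) * levelProb δ l ≤ 4 * k * 2 ^ l * levelProb δ l := by
          have := (levelProb_pos (by linarith : 0 ≤ δ) l).le
          gcongr
      _ = 4 * k * (2 ^ l * levelProb δ l) := by ring
      _ ≤ _ := by gcongr; exact two_pow_mul_levelProb_le δ l
  refine (ENNReal.tsum_le_tsum hterm).trans (ENNReal.tsum_le_of_sum_range_le fun n => ?_)
  rw [← ENNReal.ofReal_sum_of_nonneg fun l _ => by positivity, ← Finset.mul_sum]
  refine ENNReal.ofReal_le_ofReal ?_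
  calc 4 * k * ∑ l ∈ Finset.range n, 1 / ((l : ℝ) + 1) ^ δ ≤ 4 * k * (δ / (δ - 1)) := by
        gcongr; exact sum_one_div_rpow_le hδ n
    _ = _ := by ring

theorem expectedTimeFHat_le {γ δ q : ℝ} (θ : Vec d) (k s : ℕ) (z z' : ℤ → Ω → Sample d)
    {N N' : Ω → ℕ} {Q : Ω → Bool} (hQ : Measurable Q) (hQlaw : P.real (Q ⁻¹' {true}) = q)
    (hNN' : IdentDistrib N' N P P) (hind : IndepFun N' Q P) :
    expectedTimeFHat P γ δ q θ k s z z' Q N' ≤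
      k + ENNReal.ofReal q * expectedTimeZ P γ δ θ k s z N := by
  simp only [expectedTimeFHat, expectedTimeZ, time_fHatProg, time_zAvgProg]
  set g : ℕ → ℝ≥0∞ := fun l => ((lagHi k (l + 1) : ℕ) : ℝ≥0∞) with hg
  have hgm : Measurable g := measurable_of_countable g
  set b : Bool → ℝ≥0∞ := fun c => if c then 1 else 0 with hb
  have hbm : Measurable b := measurable_of_countable b
  have h1 : ∀ ω, ((k - 1 + (if Q ω = true then lagHi k (N' ω + 1) else 0) : ℕ) : ℝ≥0∞) =
      ((k - 1 : ℕ) : ℝ≥0∞) + g (N' ω) * b (Q ω) := by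
    intro ω
    cases h : Q ω <;> simp [hg, hb]
  simp only [h1]
  rw [lintegral_add_left measurable_const]
  have h2 : ∫⁻ ω, g (N' ω) * b (Q ω) ∂P = (∫⁻ ω, g (N' ω) ∂P) * ∫⁻ ω, b (Q ω) ∂P :=
    lintegral_mul_eq_lintegral_mul_lintegral_of_indepFun''
      (hgm.comp_aemeasurable hNN'.aemeasurable_fst) (hbm.comp_aemeasurable hQ.aemeasurable)
      (hind.comp hgm hbm)
  have h3 : ∫⁻ ω, b (Q ω) ∂P = ENNReal.ofReal q := by
    have : (fun ω => b (Q ω)) = (Q ⁻¹' {true}).indicator 1 := by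
      funext ω
      by_cases h : Q ω = true <;> simp [hb, h]
    rw [this, lintegral_indicator_one (hQ (measurableSet_singleton _)), ← hQlaw,
      ofReal_measureReal]
  have h4 : ∫⁻ ω, g (N' ω) ∂P = ∫⁻ ω, g (N ω) ∂P := (hNN'.comp hgm).lintegral_eq
  rw [h2, h3, h4, mul_comm]
  simp only [lintegral_const, measure_univ, mul_one]
  gcongr
  exact Nat.sub_le k 1

end ExpectedTime

/-! ### Averages as conditional expectations -/

section CondExp

variable {d : ℕ} {Ω : Type*} [MeasurableSpace Ω] {P : Measure Ω} [IsProbabilityMeasure P]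

/-- Decompose over the values t of τ: the iterate with lag t ≤ j is measurable for the conditioning
σ-algebra and factors out, while the indicator of τ = t is independent of it and contributes its
probability 1/card. -/
theorem fAvg_eq_condExp {γ : ℝ} {θ : Vec d} {k s : ℕ} (hs : s < k) {z : ℤ → Ω → Sample d}
    (hz : ∀ t, Measurable (z t))
    (hint : ∀ t : ℕ, Integrable (fun ω => sgdIter γ θ (fun i => z i ω) (-(t : ℤ)) t) P)
    (l : ℕ) {τ : Ω → ℕ} (hτ : Measurable τ)
    (hτlaw : ∀ t ∈ lagSet k s l, P.real (τ ⁻¹' {t}) = 1 / (lagSet k s l).card)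
    (hτind : IndepFun τ (fun ω t => z t ω) P) {j : ℕ} (hj : k * (2 ^ (l + 1) - 1) ≤ j) :
    (fun ω => fAvg γ θ k s (fun t => z t ω) l) =ᵐ[P]
      P[fun ω => theta γ θ (fun t => z t ω) (-(τ ω : ℤ)) 0 |
        samplesIn z (Set.Icc (-(j : ℤ)) 0)] := by
  set W := lagSet k s l with hW
  have hmle := samplesIn_le hz (Set.Icc (-(j : ℤ)) 0)
  have hWne : W.Nonempty := Finset.nonempty_Icc.2 (lagLo_le_lagHi hs l)
  have hWc : (W.card : ℝ) ≠ 0 := by exact_mod_cast hWne.card_pos.ne'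
  set g : ℕ → Ω → Vec d := fun t ω => sgdIter γ θ (fun i => z i ω) (-(t : ℤ)) t with hg
  set χ : ℕ → Ω → ℝ := fun t => (τ ⁻¹' {t}).indicator fun _ => 1 with hχ
  have hτm : ∀ t, MeasurableSet (τ ⁻¹' {t}) := fun t => hτ (measurableSet_singleton t)
  -- The prescribed probabilities on `W` already sum to 1, so other values are negligible.
  have hτW : ∀ᵐ ω ∂P, τ ω ∈ W := by
    have h1 : P.real (τ ⁻¹' (W : Set ℕ)) = 1 := by
      have hU : τ ⁻¹' (W : Set ℕ) = ⋃ t ∈ W, τ ⁻¹' {t} := by ext; simp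
      rw [hU, measureReal_biUnion_finset _ fun t _ => hτm t, Finset.sum_congr rfl hτlaw]
      · simp [hWc]
      · intro a _ b _ hab
        exact (Set.disjoint_singleton.2 hab).preimage τ
    have h2 : P (τ ⁻¹' (W : Set ℕ)) = 1 := by
      rw [← ofReal_measureReal, h1, ENNReal.ofReal_one]
    exact (prob_compl_eq_zero_iff (hτ (Set.toFinite _).measurableSet)).2 h2
  have hind : Indep (MeasurableSpace.comap τ inferInstance) (samplesIn z (Set.Icc (-(j : ℤ)) 0)) P := by
    rw [IndepFun_iff_Indep] at hτind
    refine indep_of_indep_of_le_right hτind (iSup₂_le fun i _ => ?_)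
    exact measurable_iff_comap_le.1 ((measurable_pi_apply i).comp
      (comap_measurable fun ω t => z t ω))
  have hχm : ∀ t, StronglyMeasurable[MeasurableSpace.comap τ inferInstance] (χ t) := fun t =>
    (@stronglyMeasurable_const _ _ (MeasurableSpace.comap τ inferInstance) _ (1 : ℝ)).indicator
      ⟨{t}, measurableSet_singleton t, rfl⟩
  have hχint : ∀ t, Integrable (χ t) P := fun t => (integrable_const 1).indicator (hτm t)
  have hχg : ∀ t, Integrable (χ t • g t) P := by
    intro t
    have : χ t • g t = (τ ⁻¹' {t}).indicator (g t) := by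
      funext ω
      by_cases h : τ ω = t <;> simp [hχ, h]
    rw [this]
    exact (hint t).indicator (hτm t)
  have hgm : ∀ t ∈ W, AEStronglyMeasurable[samplesIn z (Set.Icc (-(j : ℤ)) 0)] (g t) P := by
    intro t ht
    refine (Measurable.stronglyMeasurable ?_).aestronglyMeasurable
    refine measurable_sgdIter γ θ z (-(t : ℤ)) t ?_
    have h1 := (Finset.mem_Icc.1 ht).2
    rw [lagHi] at h1
    have h2 : t ≤ j := by omega
    intro i
    simp only [Set.mem_Ico, Set.mem_Icc]
    omega
  have hf : (fun ω => theta γ θ (fun t => z t ω) (-(τ ω : ℤ)) 0) =ᵐ[P] ∑ t ∈ W, χ t • g t := by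
    filter_upwards [hτW] with ω hω
    rw [theta_neg_zero, Finset.sum_apply, Finset.sum_eq_single (τ ω)]
    · simp [hχ, hg]
    · intro b _ hb
      simp [hχ, hb.symm]
    · exact fun h => absurd hω h
  have hterm : ∀ t ∈ W, P[χ t • g t | samplesIn z (Set.Icc (-(j : ℤ)) 0)] =ᵐ[P] (W.card : ℝ)⁻¹ • g t := by
    intro t ht
    have h1 := condExp_smul_of_aestronglyMeasurable_right (hχint t) (hχg t) (hgm t ht)
    have h2 := condExp_indep_eq hτ.comap_le hmle (hχm t) hind
    filter_upwards [h1, h2] with ω h1 h2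
    rw [h1, Pi.smul_apply', h2, Pi.smul_apply]
    congr 1
    rw [hχ, integral_indicator_const _ (hτm t), hτlaw t ht]
    simp
  have hterms : ∀ᵐ ω ∂P, ∀ t ∈ W, P[χ t • g t | samplesIn z (Set.Icc (-(j : ℤ)) 0)] ω = ((W.card : ℝ)⁻¹ • g t) ω :=
    (ae_ball_iff W.countable_toSet).2 hterm
  have hsum := condExp_finsetSum (fun t (_ : t ∈ W) => hχg t)
    (samplesIn z (Set.Icc (-(j : ℤ)) 0))
  filter_upwards [condExp_congr_ae (m := samplesIn z (Set.Icc (-(j : ℤ)) 0)) hf, hsum, hterms] with ω h1 h2 h3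
  rw [h1, h2, fAvg_eq_startAvg γ θ hs, startAvg, Finset.sum_apply, Finset.sum_congr rfl h3,
    Finset.smul_sum]
  rfl

end CondExp

/-! ### The regression problem -/

section Problem

variable {d : ℕ}

theorem inner_eq_sum (u v : Vec d) : inner ℝ u v = ∑ i, u i * v i := by
  rw [PiLp.inner_apply]
  simp [mul_comm]

theorem inner_mul_inner_eq_sum (x u v : Vec d) :
    inner ℝ x u * inner ℝ x v = ∑ i, ∑ j, u i * v j * (x i * x j) := by
  rw [inner_eq_sum, inner_eq_sum, Finset.sum_mul_sum]
  exact Finset.sum_congr rfl fun i _ => Finset.sum_congr rfl fun j _ => by ring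

theorem inner_toEuclideanCLM (M : Matrix (Fin d) (Fin d) ℝ) (u v : Vec d) :
    inner ℝ u (Matrix.toEuclideanCLM (𝕜 := ℝ) M v) = ∑ i, ∑ j, u i * v j * M i j := by
  rw [inner_eq_sum]
  refine Finset.sum_congr rfl fun i _ => ?_
  rw [Matrix.ofLp_toEuclideanCLM, Matrix.mulVec, dotProduct, Finset.mul_sum]
  exact Finset.sum_congr rfl fun j _ => by ring

/-- As d > 0 the spectrum is nonempty and finite, so its infimum is an eigenvalue; subtracting it
from M shifts the spectrum into the nonnegative reals. -/
theorem lambdaMin_spec {M : Matrix (Fin d) (Fin d) ℝ} (hM : M.PosDef) (hd : 0 < d) :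
    0 < lambdaMin M ∧
      ∀ v : Vec d, lambdaMin M * ‖v‖ ^ 2 ≤ inner ℝ v (Matrix.toEuclideanCLM (𝕜 := ℝ) M v) := by
  have : Nonempty (Fin d) := ⟨⟨0, hd⟩⟩
  have hspec := hM.isHermitian.spectrum_real_eq_range_eigenvalues
  have hfin : (spectrum ℝ M).Finite := by rw [hspec]; exact Set.finite_range _
  have hne : (spectrum ℝ M).Nonempty := by rw [hspec]; exact Set.range_nonempty _
  have hmem : lambdaMin M ∈ spectrum ℝ M := hne.csInf_mem hfin
  refine ⟨?_, fun v => ?_⟩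
  · rw [hspec] at hmem
    obtain ⟨i, hi⟩ := hmem
    rw [← hi]
    exact hM.eigenvalues_pos i
  · have hN : (M - algebraMap ℝ _ (lambdaMin M)).IsHermitian := by
      refine hM.isHermitian.sub ?_
      rw [Matrix.IsHermitian, Matrix.algebraMap_eq_diagonal]
      simp
    have hpsd : (M - algebraMap ℝ _ (lambdaMin M)).PosSemidef := by
      rw [hN.posSemidef_iff_eigenvalues_nonneg]
      intro i
      have h1 : hN.eigenvalues i ∈ spectrum ℝ (M - algebraMap ℝ _ (lambdaMin M)) := by
        rw [hN.spectrum_real_eq_range_eigenvalues]; exact ⟨i, rfl⟩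
      rw [← spectrum.sub_singleton_eq, Set.sub_singleton] at h1
      obtain ⟨r, hr, hri⟩ := h1
      rw [← hri]
      have h2 : lambdaMin M ≤ r := csInf_le hfin.bddBelow hr
      simpa using h2
    have h2 := hpsd.dotProduct_mulVec_nonneg v.ofLp
    rw [Matrix.sub_mulVec, dotProduct_sub, Matrix.algebraMap_eq_diagonal] at h2
    have h3 : star v.ofLp ⬝ᵥ M *ᵥ v.ofLp = inner ℝ v (Matrix.toEuclideanCLM (𝕜 := ℝ) M v) := by
      rw [inner_eq_sum, Matrix.ofLp_toEuclideanCLM, dotProduct]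
      simp
    have h4 : star v.ofLp ⬝ᵥ (Matrix.diagonal (algebraMap ℝ (Fin d → ℝ) (lambdaMin M))) *ᵥ v.ofLp =
        lambdaMin M * ‖v‖ ^ 2 := by
      rw [EuclideanSpace.norm_sq_eq, dotProduct, Finset.mul_sum]
      refine Finset.sum_congr rfl fun i _ => ?_
      simp [Matrix.mulVec_diagonal]
      ring
    rw [h3, h4] at h2
    linarith

variable {Ω₀ : Type*} [MeasurableSpace Ω₀] {P₀ : Measure Ω₀} [IsProbabilityMeasure P₀]
  {x : Ω₀ → Vec d} {y : Ω₀ → ℝ} {θs : Vec d} {σ R : ℝ}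

/-- The Hessian, as an operator. -/
noncomputable def hessianOp (P₀ : Measure Ω₀) (x : Ω₀ → Vec d) : Vec d →L[ℝ] Vec d :=
  Matrix.toEuclideanCLM (𝕜 := ℝ) (hessian P₀ x)

theorem WeightedMomentLE.integrable {w : Ω₀ → ℝ} {a : ℝ} (h : WeightedMomentLE P₀ x w a)
    (v : Vec d) : Integrable (fun ω => w ω * inner ℝ (x ω) v ^ 2) P₀ := by
  have h1 : ∀ ω, w ω * inner ℝ (x ω) v ^ 2 =
      ∑ i, ∑ j, v i * v j * (w ω * (x ω i * x ω j)) := by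
    intro ω
    rw [sq, inner_mul_inner_eq_sum, Finset.mul_sum]
    refine Finset.sum_congr rfl fun i _ => ?_
    rw [Finset.mul_sum]
    exact Finset.sum_congr rfl fun j _ => by ring
  simp only [h1]
  exact integrable_finsetSum _ fun i _ => integrable_finsetSum _ fun j _ =>
    (h.1 i j).const_mul _

theorem WeightedMomentLE.integral_le {w : Ω₀ → ℝ} {a : ℝ} (h : WeightedMomentLE P₀ x w a)
    (v : Vec d) : ∫ ω, w ω * inner ℝ (x ω) v ^ 2 ∂P₀ ≤ a * inner ℝ v (hessianOp P₀ x v) := by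
  have h1 : ∀ ω, w ω * inner ℝ (x ω) v ^ 2 =
      ∑ i, ∑ j, v i * v j * (w ω * (x ω i * x ω j)) := by
    intro ω
    rw [sq, inner_mul_inner_eq_sum, Finset.mul_sum]
    refine Finset.sum_congr rfl fun i _ => ?_
    rw [Finset.mul_sum]
    exact Finset.sum_congr rfl fun j _ => by ring
  have h2 := h.2.dotProduct_mulVec_nonneg v.ofLp
  rw [Matrix.sub_mulVec, dotProduct_sub, Matrix.smul_mulVec, dotProduct_smul] at h2
  have h3 : ∀ M : Matrix (Fin d) (Fin d) ℝ, star v.ofLp ⬝ᵥ M *ᵥ v.ofLp =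
      inner ℝ v (Matrix.toEuclideanCLM (𝕜 := ℝ) M v) := by
    intro M
    rw [inner_eq_sum, Matrix.ofLp_toEuclideanCLM, dotProduct]
    simp
  rw [h3, h3, inner_toEuclideanCLM (Matrix.of _)] at h2
  simp only [h1]
  rw [integral_finsetSum _ fun i _ => integrable_finsetSum _ fun j _ => (h.1 i j).const_mul _]
  simp only [smul_eq_mul, Matrix.of_apply] at h2
  have h4 : ∀ i, ∫ ω, ∑ j, v i * v j * (w ω * (x ω i * x ω j)) ∂P₀ =
      ∑ j, v i * v j * ∫ ω, w ω * (x ω i * x ω j) ∂P₀ := by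
    intro i
    rw [integral_finsetSum _ fun j _ => (h.1 i j).const_mul _]
    simp only [integral_const_mul]
  simp only [h4, hessianOp]
  linarith

theorem integrable_fun_mul {f g : Ω₀ → ℝ} (hf : MemLp f 2 P₀) (hg : MemLp g 2 P₀) :
    Integrable (fun ω => f ω * g ω) P₀ :=
  hf.integrable_mul hg

theorem memLp_inner (hx : MemLp x 2 P₀) (v : Vec d) : MemLp (fun ω => inner ℝ (x ω) v) 2 P₀ := by
  have : MemLp (fun ω => inner ℝ v (x ω)) 2 P₀ := (innerSL ℝ v).comp_memLp' hx
  simpa only [real_inner_comm] using this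

theorem memLp_coord (hx : MemLp x 2 P₀) (i : Fin d) : MemLp (fun ω => x ω i) 2 P₀ :=
  (EuclideanSpace.proj (𝕜 := ℝ) i).comp_memLp' hx

theorem integral_inner_mul_inner (hx : MemLp x 2 P₀) (u v : Vec d) :
    ∫ ω, inner ℝ (x ω) u * inner ℝ (x ω) v ∂P₀ = inner ℝ u (hessianOp P₀ x v) := by
  have hij : ∀ i j, Integrable (fun ω => x ω i * x ω j) P₀ := fun i j =>
    (memLp_coord hx i).integrable_mul (memLp_coord hx j)
  simp only [inner_mul_inner_eq_sum]
  rw [hessianOp, inner_toEuclideanCLM,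
    integral_finsetSum _ fun i _ => integrable_finsetSum _ fun j _ => (hij i j).const_mul _]
  refine Finset.sum_congr rfl fun i _ => ?_
  rw [integral_finsetSum _ fun j _ => (hij i j).const_mul _]
  simp only [integral_const_mul, hessian, Matrix.of_apply]

theorem integral_residual_mul_inner (hx : MemLp x 2 P₀) (hy : MemLp y 2 P₀)
    (hθ : NormalEq P₀ x y θs) (v : Vec d) :
    ∫ ω, (y ω - inner ℝ (x ω) θs) * inner ℝ (x ω) v ∂P₀ = 0 := by
  have h1 : ∫ ω, y ω * inner ℝ (x ω) v ∂P₀ = inner ℝ v (hessianOp P₀ x θs) := by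
    have hi : ∀ i, Integrable (fun ω => y ω * x ω i) P₀ := fun i =>
      hy.integrable_mul (memLp_coord hx i)
    have h2 : ∀ ω, y ω * inner ℝ (x ω) v = ∑ i, v i * (y ω * x ω i) := by
      intro ω
      rw [inner_eq_sum, Finset.mul_sum]
      exact Finset.sum_congr rfl fun i _ => by ring
    simp only [h2]
    rw [integral_finsetSum _ fun i _ => (hi i).const_mul _, inner_eq_sum]
    refine Finset.sum_congr rfl fun i _ => ?_
    rw [integral_const_mul, hessianOp, Matrix.ofLp_toEuclideanCLM, hθ i]
  simp only [sub_mul]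
  rw [integral_sub (integrable_fun_mul hy (memLp_inner hx v))
    (integrable_fun_mul (memLp_inner hx θs) (memLp_inner hx v)), h1, integral_inner_mul_inner hx,
    ← integral_inner_mul_inner hx, ← integral_inner_mul_inner hx]
  simp only [mul_comm, sub_self]

/-- Pythagoras: the residual at θs is orthogonal to linear functions of x. -/
theorem risk_eq (hx : MemLp x 2 P₀) (hy : MemLp y 2 P₀) (hθ : NormalEq P₀ x y θs) (θ : Vec d) :
    risk P₀ x y θ = risk P₀ x y θs + 1 / 2 * inner ℝ (θ - θs) (hessianOp P₀ x (θ - θs)) := by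
  have hr : MemLp (fun ω => y ω - inner ℝ (x ω) θs) 2 P₀ := hy.sub (memLp_inner hx θs)
  have hd := memLp_inner hx (θ - θs)
  have h1 : ∀ ω, (y ω - inner ℝ (x ω) θ) ^ 2 = (y ω - inner ℝ (x ω) θs) ^ 2 -
      2 * ((y ω - inner ℝ (x ω) θs) * inner ℝ (x ω) (θ - θs)) +
      inner ℝ (x ω) (θ - θs) * inner ℝ (x ω) (θ - θs) := by
    intro ω
    rw [inner_sub_right]
    ring
  have i1 : Integrable (fun ω => (y ω - inner ℝ (x ω) θs) ^ 2) P₀ := hr.integrable_sq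
  have i2 : Integrable (fun ω => 2 * ((y ω - inner ℝ (x ω) θs) * inner ℝ (x ω) (θ - θs))) P₀ :=
    (hr.integrable_mul hd).const_mul 2
  have i12 : Integrable (fun ω => (y ω - inner ℝ (x ω) θs) ^ 2 -
      2 * ((y ω - inner ℝ (x ω) θs) * inner ℝ (x ω) (θ - θs))) P₀ := i1.sub i2
  simp only [risk, h1]
  rw [integral_add i12 (integrable_fun_mul hd hd), integral_sub i1 i2, integral_const_mul,
    integral_residual_mul_inner hx hy hθ, integral_inner_mul_inner hx]
  ring

theorem centeredLaw_residual (hx : MemLp x 2 P₀) (hy : MemLp y 2 P₀) (hθ : NormalEq P₀ x y θs)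
    (hmom : MomentAssumption P₀ x y θs σ R) :
    CenteredLaw (P₀.map fun ω => residual θs (x ω, y ω)) (hessianOp P₀ x) σ R := by
  have hxy : AEMeasurable (fun ω => residual θs (x ω, y ω)) P₀ :=
    (measurable_residual θs).comp_aemeasurable (hx.1.aemeasurable.prodMk hy.1.aemeasurable)
  have hr : MemLp (fun ω => y ω - inner ℝ (x ω) θs) 2 P₀ := hy.sub (memLp_inner hx θs)
  have key : ∀ f : Sample d → ℝ, Measurable f →
      Integrable (fun ω => f (residual θs (x ω, y ω))) P₀ →
      Integrable f (P₀.map fun ω => residual θs (x ω, y ω)) := fun f hf hi =>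
    (integrable_map_measure hf.aestronglyMeasurable hxy).2 hi
  have key' : ∀ f : Sample d → ℝ, Measurable f →
      ∫ z, f z ∂(P₀.map fun ω => residual θs (x ω, y ω)) =
        ∫ ω, f (residual θs (x ω, y ω)) ∂P₀ := fun f hf =>
    integral_map hxy hf.aestronglyMeasurable
  constructor
  · exact fun u v => key _ (by fun_prop) ((memLp_inner hx u).integrable_mul (memLp_inner hx v))
  · intro u v
    rw [key' _ (by fun_prop)]
    exact integral_inner_mul_inner hx u v
  · exact fun v => key _ (by fun_prop) (hmom.2.integrable v)
  · intro v
    rw [key' _ (by fun_prop)]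
    exact hmom.2.integral_le v
  · exact fun v => key _ (by fun_prop) (hmom.1.integrable v)
  · intro v
    rw [key' _ (by fun_prop)]
    exact hmom.1.integral_le v
  · exact fun v => key _ (by fun_prop) (hr.integrable_mul (memLp_inner hx v))
  · intro v
    rw [key' _ (by fun_prop)]
    exact integral_residual_mul_inner hx hy hθ v

theorem isStream_residual (θs : Vec d)
    {Ω : Type*} [MeasurableSpace Ω] {P : Measure Ω} {z : ℤ → Ω → Sample d}
    (hz : ∀ t, Measurable (z t)) (hzindep : iIndepFun z P)
    (hzid : ∀ t, IdentDistrib (z t) (fun ω => (x ω, y ω)) P P₀) :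
    IsStream P (fun t ω => residual θs (z t ω)) (P₀.map fun ω => residual θs (x ω, y ω)) where
  measurable t := (measurable_residual θs).comp (hz t)
  iIndepFun := hzindep.comp (fun _ => residual θs) fun _ => measurable_residual θs
  map_eq t := ((hzid t).comp (measurable_residual θs)).map_eq

end Problem

/-! ### Summation over the levels -/

section LevelSum

variable {δ α ξ : ℝ}

theorem two_le_log_const (hδ : 1 < δ) (hα : 0 < α) (hα' : α ≤ 1 / 2) (hξ : 0 < ξ) (hξ1 : ξ ≤ 1) :
    2 ≤ Real.log ((4 * δ + 8) / (α * ξ)) := by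
  have h1 : (12 : ℝ) ≤ (4 * δ + 8) / (α * ξ) := by
    rw [le_div_iff₀ (by positivity)]
    nlinarith [mul_le_mul hα' hξ1 hξ.le (by norm_num : (0 : ℝ) ≤ 1 / 2)]
  rw [Real.le_log_iff_exp_le (by linarith)]
  have h2 : Real.exp 2 = Real.exp 1 * Real.exp 1 := by rw [← Real.exp_add]; norm_num
  have h3 := Real.exp_one_lt_d9
  have h4 := Real.exp_pos 1
  rw [h2]
  nlinarith

/-- With m = l + 1, the threshold forces ξ ≥ 8(δ+2) exp(-m/2), using α ≤ 1/2. Since 2^l outgrows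
exp(m/2), this gives ξ 2^l ≥ (δ+1)m, and with log m ≤ m the product is at most exp(-m) ≤ 2^(-m). -/
theorem rpow_mul_exp_neg_le_of_large (hδ : 1 < δ) (hα : 0 < α) (hα' : α ≤ 1 / 2) (hξ : 0 < ξ)
    {l : ℕ} (hl : 2 * Real.log ((4 * δ + 8) / (α * ξ)) < (l : ℝ) + 1) :
    ((l : ℝ) + 1) ^ δ * Real.exp (-(ξ * 2 ^ l)) ≤ (1 / 2) ^ (l + 1) := by
  set m : ℝ := (l : ℝ) + 1 with hm
  have hm0 : 0 < m := by positivity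
  set X := (4 * δ + 8) / (α * ξ) with hX
  have hX0 : 0 < X := by positivity
  have hXm : X < Real.exp (m / 2) := by
    rw [← Real.log_lt_iff_lt_exp hX0]; linarith
  have hξX : 8 * (δ + 2) ≤ ξ * X := by
    rw [hX]
    have : ξ * ((4 * δ + 8) / (α * ξ)) = (4 * δ + 8) / α := by field_simp
    rw [this, le_div_iff₀ hα]
    nlinarith
  have hpow : (2 : ℝ) ^ l = Real.exp (m * Real.log 2) / 2 := by
    have : Real.exp (m * Real.log 2) = 2 ^ (l + 1) := by
      rw [mul_comm, ← Real.rpow_def_of_pos two_pos, hm, ← Nat.cast_succ, Real.rpow_natCast]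
    rw [this, pow_succ]; ring
  have hlog2 := Real.log_two_gt_d9
  have hlog2' := Real.log_two_lt_d9
  -- What remains of the exponent of 2^m once exp(-m/2) has been paid for ξ; it is positive since
  -- log 2 > 1/2.
  set y := m * (Real.log 2 - 1 / 2) with hy
  have hexp : 2 * y ≤ Real.exp y := by
    have h1 := Real.add_one_le_exp (y / 2)
    have h2 : Real.exp y = Real.exp (y / 2) * Real.exp (y / 2) := by
      rw [← Real.exp_add]; ring_nf
    have hy0 : 0 ≤ y := mul_nonneg hm0.le (by linarith)
    rw [h2]
    nlinarith [sq_nonneg (y / 2 - 1)]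
  have hbig : (δ + 1) * m ≤ ξ * 2 ^ l := by
    have h1 : 8 * (δ + 2) * Real.exp (-(m / 2)) ≤ ξ := by
      rw [Real.exp_neg, ← div_eq_mul_inv, div_le_iff₀ (Real.exp_pos _)]
      exact hξX.trans (by gcongr)
    have h2 : 4 * (δ + 2) * Real.exp y ≤ ξ * 2 ^ l := by
      calc 4 * (δ + 2) * Real.exp y
          = 8 * (δ + 2) * Real.exp (-(m / 2)) * (Real.exp (m * Real.log 2) / 2) := by
            have : Real.exp y = Real.exp (-(m / 2)) * Real.exp (m * Real.log 2) := by
              rw [← Real.exp_add, hy]; ring_nf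
            rw [this]; ring
        _ ≤ ξ * 2 ^ l := by rw [hpow]; gcongr
    have h3 : m / 4 ≤ Real.exp y := by nlinarith
    nlinarith
  have hlogm : Real.log m ≤ m := (Real.log_le_sub_one_of_pos hm0).trans (by linarith)
  have hhalf : ((1 : ℝ) / 2) ^ (l + 1) = Real.exp (-(m * Real.log 2)) := by
    rw [Real.exp_neg, mul_comm, ← Real.rpow_def_of_pos two_pos, hm, ← Nat.cast_succ,
      Real.rpow_natCast]
    simp
  rw [hhalf, Real.rpow_def_of_pos hm0, ← Real.exp_add]
  refine Real.exp_le_exp.2 ?_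
  nlinarith

/-- Below the threshold M, twice the logarithm, the term is bounded through (l+1)^δ ≤ M^δ, and there
are at most M such levels; above it, the decay in 2^l leaves a geometric tail. -/
theorem levelTerm_le (hδ : 1 < δ) (hα : 0 < α) (hα' : α ≤ 1 / 2) (hξ : 0 < ξ) (hξ1 : ξ ≤ 1)
    {k s : ℕ} (hk : 2 ≤ k) (hs : s < k) (hks : (k : ℝ) ≤ 3 * ((k : ℝ) - s)) (l : ℕ) :
    (levelProb δ l)⁻¹ * ((1 - ξ) ^ lagLo k s l / (lagSet k s l).card) ≤
      2 / k * ((if l < ⌊2 * Real.log ((4 * δ + 8) / (α * ξ))⌋₊ then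
        (2 * Real.log ((4 * δ + 8) / (α * ξ))) ^ δ else 0) + (1 / 2) ^ (l + 1)) := by
  have hlog := two_le_log_const hδ hα hα' hξ hξ1
  set M := 2 * Real.log ((4 * δ + 8) / (α * ξ)) with hM
  have hM4 : 4 ≤ M := by linarith
  have hk0 : (0 : ℝ) < k := by positivity
  have hr0 : 0 ≤ 1 - ξ := by linarith
  have hp := inv_levelProb_le (by linarith : 0 ≤ δ) l
  have hMδ : M ≤ M ^ δ := by
    simpa using Real.rpow_le_rpow_of_exponent_le (by linarith : 1 ≤ M) hδ.le
  cases l with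
  | zero =>
    -- At level 0 no decay is used, and the window has length k - s ≥ k/3 instead of k; the factor 3
    -- is absorbed by M^δ ≥ M ≥ 4.
    rw [card_lagSet_zero hs]
    have hks0 : 0 < (k : ℝ) - s := by linarith
    have h1 : (1 - ξ) ^ lagLo k s 0 / ((k : ℝ) - s) ≤ 3 / k := by
      rw [div_le_div_iff₀ hks0 hk0]
      have : (1 - ξ) ^ lagLo k s 0 ≤ 1 := pow_le_one₀ hr0 (by linarith)
      nlinarith
    have hfloor : 0 < ⌊M⌋₊ := Nat.floor_pos.2 (by linarith)
    rw [if_pos hfloor]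
    simp only [zero_add, pow_one, CharP.cast_eq_zero, Real.one_rpow, mul_one] at hp
    calc (levelProb δ 0)⁻¹ * ((1 - ξ) ^ lagLo k s 0 / ((k : ℝ) - s)) ≤ 2 * (3 / k) := by
          gcongr
      _ = 2 / k * 3 := by ring
      _ ≤ _ := by
          gcongr
          have : (0 : ℝ) ≤ (1 / 2) ^ (0 + 1) := by positivity
          linarith
  | succ n =>
    set l := n + 1 with hl
    have hcard : ((lagSet k s l).card : ℝ) = k * 2 ^ l := by
      rw [card_lagSet_succ (by omega)]; push_cast; rfl
    -- As k ≥ 2 and l ≥ 1, the smallest lag k(2^l - 1) is at least 2^l.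
    have hlo : 2 ^ l ≤ lagLo k s l := by
      change 2 ^ (n + 1) ≤ k * (2 ^ (n + 1) - 1)
      have h1 : 2 ^ (n + 1) = 2 * 2 ^ n := by ring
      have h2 : 0 < 2 ^ n := by positivity
      calc 2 ^ (n + 1) ≤ 2 * (2 ^ (n + 1) - 1) := by omega
        _ ≤ _ := Nat.mul_le_mul_right _ hk
    have hexp : (1 - ξ) ^ lagLo k s l ≤ Real.exp (-(ξ * 2 ^ l)) := by
      calc (1 - ξ) ^ lagLo k s l ≤ (1 - ξ) ^ 2 ^ l :=
            pow_le_pow_of_le_one hr0 (by linarith) hlo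
        _ ≤ Real.exp (-ξ) ^ 2 ^ l := by
            gcongr
            linarith [Real.add_one_le_exp (-ξ)]
        _ = _ := by rw [← Real.exp_nat_mul]; push_cast; ring_nf
    have hmain : (levelProb δ l)⁻¹ * ((1 - ξ) ^ lagLo k s l / (lagSet k s l).card) ≤
        2 / k * (((l : ℝ) + 1) ^ δ * Real.exp (-(ξ * 2 ^ l))) := by
      rw [hcard]
      calc (levelProb δ l)⁻¹ * ((1 - ξ) ^ lagLo k s l / (k * 2 ^ l))
          ≤ 2 ^ (l + 1) * ((l : ℝ) + 1) ^ δ * (Real.exp (-(ξ * 2 ^ l)) / (k * 2 ^ l)) := by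
            gcongr
        _ = _ := by rw [pow_succ]; field_simp
    refine hmain.trans ?_
    gcongr
    by_cases hlM : l < ⌊M⌋₊
    · rw [if_pos hlM]
      have h1 : (l : ℝ) + 1 ≤ M := by
        have : ((l + 1 : ℕ) : ℝ) ≤ M := (Nat.le_floor_iff (by linarith)).1 hlM
        exact_mod_cast this
      have h2 : Real.exp (-(ξ * 2 ^ l)) ≤ 1 := Real.exp_le_one_iff.2 (by
        have : 0 ≤ ξ * 2 ^ l := by positivity
        linarith)
      calc ((l : ℝ) + 1) ^ δ * Real.exp (-(ξ * 2 ^ l)) ≤ M ^ δ * 1 := by gcongr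
        _ ≤ _ := by
            have : (0 : ℝ) ≤ (1 / 2) ^ (l + 1) := by positivity
            linarith
    · rw [if_neg hlM, zero_add]
      refine rpow_mul_exp_neg_le_of_large hδ hα hα' hξ ?_
      have : ((⌊M⌋₊ : ℕ) : ℝ) ≤ l := by exact_mod_cast not_lt.1 hlM
      linarith [Nat.lt_floor_add_one M]

theorem sum_levelTerm_le (hδ : 1 < δ) (hα : 0 < α) (hα' : α ≤ 1 / 2) (hξ : 0 < ξ) (hξ1 : ξ ≤ 1)
    {k s : ℕ} (hk : 2 ≤ k) (hs : s < k) (hks : (k : ℝ) ≤ 3 * ((k : ℝ) - s)) (n : ℕ) :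
    ∑ l ∈ Finset.range n,
      (levelProb δ l)⁻¹ * ((1 - ξ) ^ lagLo k s l / (lagSet k s l).card) ≤
      2 / k * ((2 * Real.log ((4 * δ + 8) / (α * ξ))) ^ (δ + 1) + 1) := by
  refine (Finset.sum_le_sum fun l _ => levelTerm_le hδ hα hα' hξ hξ1 hk hs hks l).trans ?_
  have hlog := two_le_log_const hδ hα hα' hξ hξ1
  set M := 2 * Real.log ((4 * δ + 8) / (α * ξ)) with hM
  rw [← Finset.mul_sum, Finset.sum_add_distrib]
  have hMδ : 0 ≤ M ^ δ := Real.rpow_nonneg (by linarith) _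
  gcongr
  · rw [← Finset.sum_filter, Finset.sum_const, nsmul_eq_mul, Real.rpow_add (by linarith),
      Real.rpow_one, mul_comm]
    gcongr
    calc (((Finset.range n).filter (· < ⌊M⌋₊)).card : ℝ) ≤ ((Finset.range ⌊M⌋₊).card : ℝ) := by
          gcongr
          intro i hi
          simpa using (Finset.mem_filter.1 hi).2
      _ ≤ M := by rw [Finset.card_range]; exact Nat.floor_le (by linarith)
  · have h1 := sum_geometric_two_le n
    have h2 : ∑ i ∈ Finset.range n, ((1 : ℝ) / 2) ^ (i + 1) =
        1 / 2 * ∑ i ∈ Finset.range n, ((1 : ℝ) / 2) ^ i := by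
      rw [Finset.mul_sum]
      exact Finset.sum_congr rfl fun i _ => by ring
    rw [h2]
    linarith

/-- Under either rounding s ≤ ⌈k/2⌉, which is at most 2k/3 for k ≥ 2, with equality at k = 3. -/
theorem burnIn_bounds (hα' : α ≤ 1 / 2) {k s : ℕ} (hk : 2 ≤ k)
    (hs : s = ⌊α * k⌋₊ ∨ s = ⌈α * k⌉₊) : s < k ∧ (k : ℝ) ≤ 3 * ((k : ℝ) - s) := by
  have hk0 : (0 : ℝ) < k := by positivity
  have hle : s ≤ ⌈α * k⌉₊ := by
    rcases hs with rfl | rfl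
    · exact Nat.floor_le_ceil _
    · exact le_rfl
  have h1 : ⌈α * k⌉₊ ≤ (k + 1) / 2 := by
    rw [Nat.ceil_le]
    have h2 : k ≤ 2 * ((k + 1) / 2) := by omega
    have h3 : (k : ℝ) ≤ 2 * (((k + 1) / 2 : ℕ) : ℝ) := by exact_mod_cast h2
    nlinarith
  have h4 : 3 * s ≤ 2 * k := by omega
  have h5 : 3 * (s : ℝ) ≤ 2 * k := by exact_mod_cast h4
  exact ⟨by omega, by linarith⟩

/-- Let Y be the logarithm and m = (2Y)^(δ+1). As 27/α ≥ 54 and (4Y)^(δ+1) ≥ 4m, it suffices that 48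
+ 16(m + 1) ≤ 54 + 24m, which follows from m ≥ 4. -/
theorem excessRisk_bound (hδ : 1 < δ) (hα : 0 < α) (hα' : α ≤ 1 / 2) (hξ : 0 < ξ) (hξ1 : ξ ≤ 1)
    {q c k r A B : ℝ} (hq : 0 < q) (hq' : q ≤ 1) (hc : 0 ≤ c) (hk : 0 < k) (hr : k ≤ 3 * r)
    (hA : A ≤ 16 * c / r)
    (hB : B ≤ 8 * c * (2 / k * ((2 * Real.log ((4 * δ + 8) / (α * ξ))) ^ (δ + 1) + 1))) :
    1 / 2 * (A + q⁻¹ * B) ≤ 1 / (2 * q * k) *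
      (27 * c / α + 6 * c * (4 * Real.log ((4 * δ + 8) / (α * ξ))) ^ (δ + 1)) := by
  have hlog := two_le_log_const hδ hα hα' hξ hξ1
  set Y := Real.log ((4 * δ + 8) / (α * ξ)) with hY
  have h1 : (4 * Y) ^ (δ + 1) = 2 ^ (δ + 1) * (2 * Y) ^ (δ + 1) := by
    rw [← Real.mul_rpow (by norm_num) (by linarith)]; ring_nf
  have h2 : (4 : ℝ) ≤ 2 ^ (δ + 1) := by
    calc (4 : ℝ) = 2 ^ (2 : ℝ) := by norm_num
      _ ≤ 2 ^ (δ + 1) := Real.rpow_le_rpow_of_exponent_le (by norm_num) (by linarith)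
  have h3 : 4 ≤ (2 * Y) ^ (δ + 1) := by
    calc (4 : ℝ) ≤ 2 ^ (δ + 1) := h2
      _ ≤ _ := Real.rpow_le_rpow (by norm_num) (by linarith) (by linarith)
  rw [h1]
  set Mp := (2 * Y) ^ (δ + 1) with hMp
  have h4 : 54 * c ≤ 27 * c / α := by
    rw [le_div_iff₀ hα]; nlinarith
  have h5 : 24 * c * Mp ≤ 6 * c * (2 ^ (δ + 1) * Mp) := by
    nlinarith [mul_nonneg hc (by linarith : 0 ≤ Mp)]
  have hr0 : 0 < r := by linarith
  have h6 : A ≤ 48 * c / k := by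
    refine hA.trans ?_
    rw [div_le_div_iff₀ hr0 hk]
    nlinarith
  have h7 : A ≤ q⁻¹ * (48 * c / k) := by
    refine h6.trans (le_mul_of_one_le_left (by positivity) ((one_le_inv₀ hq).2 hq'))
  calc 1 / 2 * (A + q⁻¹ * B) ≤ 1 / 2 * (q⁻¹ * (48 * c / k) + q⁻¹ *
        (8 * c * (2 / k * (Mp + 1)))) := by gcongr
    _ = 1 / (2 * q * k) * (48 * c + 16 * c * (Mp + 1)) := by field_simp; ring
    _ ≤ _ := by
        refine mul_le_mul_of_nonneg_left ?_ (by positivity)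
        nlinarith [mul_le_mul_of_nonneg_left h3 hc]

end LevelSum

/-! ### Randomization over the levels -/

section RandomLevel

variable {Ω : Type*} [MeasurableSpace Ω] {P : Measure Ω} [IsProbabilityMeasure P] {δ : ℝ}
  {N : Ω → ℕ}

theorem hasSum_integral_nat {E : Type*} [NormedAddCommGroup E] [NormedSpace ℝ E] [CompleteSpace E]
    {μ : Measure ℕ} {f : ℕ → E} (hf : Integrable f μ) :
    HasSum (fun l => μ.real {l} • f l) (∫ l, f l ∂μ) := by
  have h := hf
  rw [← Measure.sum_smul_dirac μ] at h
  have h1 := hasSum_integral_measure h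
  rw [Measure.sum_smul_dirac μ] at h1
  simpa only [integral_smul_measure, integral_dirac, measureReal_def] using h1

theorem integrable_and_integral_comp_level_le (hδ : 0 ≤ δ) (hN : Measurable N)
    (hNlaw : ∀ l, P.real (N ⁻¹' {l}) = levelProb δ l) {G : ℕ → ℝ} (hG : ∀ l, 0 ≤ G l) {C : ℝ}
    (hC : ∀ n, ∑ l ∈ Finset.range n, levelProb δ l * G l ≤ C) :
    Integrable (fun ω => G (N ω)) P ∧ ∫ ω, G (N ω) ∂P ≤ C := by
  have hC0 : 0 ≤ C := by simpa using hC 0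
  have hm : Measurable fun ω => G (N ω) := (measurable_of_countable G).comp hN
  have hlin : ∫⁻ ω, ENNReal.ofReal (G (N ω)) ∂P ≤ ENNReal.ofReal C := by
    rw [lintegral_comp_level hN.aemeasurable fun l => ENNReal.ofReal (G l)]
    refine ENNReal.tsum_le_of_sum_range_le fun n => ?_
    have h1 : ∀ l, ENNReal.ofReal (G l) * P.map N {l} = ENNReal.ofReal (levelProb δ l * G l) := by
      intro l
      rw [map_singleton_eq hN hNlaw, mul_comm, ENNReal.ofReal_mul (levelProb_pos hδ l).le]
    simp only [h1]
    rw [← ENNReal.ofReal_sum_of_nonneg fun l _ => mul_nonneg (levelProb_pos hδ l).le (hG l)]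
    exact ENNReal.ofReal_le_ofReal (hC n)
  refine ⟨⟨hm.aestronglyMeasurable, ?_⟩, ?_⟩
  · rw [hasFiniteIntegral_iff_ofReal (ae_of_all _ fun ω => hG _)]
    exact hlin.trans_lt ENNReal.ofReal_lt_top
  · rw [integral_eq_lintegral_of_nonneg_ae (ae_of_all _ fun ω => hG _) hm.aestronglyMeasurable]
    exact ENNReal.toReal_le_of_le_ofReal hC0 hlin

end RandomLevel

/-! ### Means and second moments of the estimators -/

section Estimator

variable {d : ℕ} {ν : Measure (Sample d)} {H : Vec d →L[ℝ] Vec d} {σ R γ : ℝ}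

/-- Centring shifts the averages of all levels by the same vector, so their differences do not
change. -/
theorem zAvg_residual (γ δ : ℝ) (θ θs : Vec d) {k s : ℕ} (hs : s < k) (z : ℤ → Sample d) (l : ℕ) :
    zAvg γ δ θ k s z l = zAvg γ δ (θ - θs) k s (fun t => residual θs (z t)) l := by
  have h1 : ∀ l, fAvg γ (θ - θs) k s (fun t => residual θs (z t)) l =
      fAvg γ θ k s z l - θs := by
    intro l
    have hne : (lagSet k s l).Nonempty := Finset.nonempty_Icc.2 (lagLo_le_lagHi hs l)
    have hc : ((lagSet k s l).card : ℝ) ≠ 0 := by exact_mod_cast hne.card_pos.ne'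
    rw [fAvg_eq_startAvg _ _ hs, fAvg_eq_startAvg _ _ hs, startAvg, startAvg]
    simp only [← sgdIter_sub_eq_residual, Finset.sum_sub_distrib, Finset.sum_const, smul_sub,
      ← Nat.cast_smul_eq_nsmul ℝ, smul_smul, inv_mul_cancel₀ hc, one_smul]
  rw [zAvg, zAvg, h1, h1, sub_sub_sub_cancel_right]

theorem thetaBar_residual (γ : ℝ) (θ θs : Vec d) {k s : ℕ} (hs : s < k) (z : ℤ → Sample d) :
    thetaBar γ (θ - θs) k s (fun t => residual θs (z t)) = thetaBar γ θ k s z - θs := by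
  have hc : (k : ℝ) - s ≠ 0 := sub_ne_zero.2 (by exact_mod_cast hs.ne')
  simp only [thetaBar, theta_zero_natCast, ← sgdIter_sub_eq_residual, Finset.sum_sub_distrib,
    Finset.sum_const, smul_sub, ← Nat.cast_smul_eq_nsmul ℝ, smul_smul, Nat.card_Ico,
    Nat.cast_sub hs.le, inv_mul_cancel₀ hc, one_smul]

theorem measurable_fAvg_path (γ : ℝ) (θ : Vec d) {k s : ℕ} (hs : s < k) (l : ℕ) :
    Measurable fun z : ℤ → Sample d => fAvg γ θ k s z l := by
  simp only [fAvg_eq_startAvg γ θ hs, startAvg]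
  exact (Finset.measurable_sum _ fun t _ => measurable_sgdIter_path γ θ _ _).const_smul
    ((lagSet k s l).card : ℝ)⁻¹

theorem measurable_zAvg_level_path (γ δ : ℝ) (θ : Vec d) {k s : ℕ} (hs : s < k) (l : ℕ) :
    Measurable fun z : ℤ → Sample d => zAvg γ δ θ k s z l := by
  simp only [zAvg]
  exact ((measurable_fAvg_path γ θ hs (l + 1)).sub (measurable_fAvg_path γ θ hs l)).const_smul
    (levelProb δ l)⁻¹

theorem measurable_zAvg_path (γ δ : ℝ) (θ : Vec d) {k s : ℕ} (hs : s < k) :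
    Measurable (Function.uncurry fun (l : ℕ) (z : ℤ → Sample d) => zAvg γ δ θ k s z l) :=
  measurable_from_prod_countable_right (measurable_zAvg_level_path γ δ θ hs)

namespace IsStream

variable {Ω : Type*} [MeasurableSpace Ω] {P : Measure Ω} [IsProbabilityMeasure P]
  {z : ℤ → Ω → Sample d}

theorem measurable_path (hz : IsStream P z ν) : Measurable fun ω t => z t ω :=
  measurable_pi_lambda _ hz.measurable

/-! #### The time-average estimator -/

theorem memLp_thetaBar (hz : IsStream P z ν) (h : CenteredLaw ν H σ R)
    (hκ : 0 ≤ γ * (2 - γ * R ^ 2)) (v : Vec d) (k s : ℕ) :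
    MemLp (fun ω => thetaBar γ v k s (fun t => z t ω)) 2 P := by
  simp only [thetaBar, theta_zero_natCast]
  exact (memLp_finsetSum (Finset.Ico s k) fun (t : ℕ) _ => hz.memLp_sgdIter h hκ v 0 t).const_smul
    ((k : ℝ) - s)⁻¹

theorem integral_quadForm_thetaBar_le (hz : IsStream P z ν) (h : CenteredLaw ν H σ R)
    (hγ : 0 < γ) (hκ : 0 < γ * (2 - γ * R ^ 2)) {a : ℝ} (ha : 0 ≤ a)
    (haκ : γ ^ 2 * σ ^ 2 ≤ a * (γ * (2 - γ * R ^ 2))) (v : Vec d) {k s : ℕ} (hs : s < k) :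
    ∫ ω, inner ℝ (thetaBar γ v k s (fun t => z t ω)) (H (thetaBar γ v k s (fun t => z t ω))) ∂P ≤
      16 * ((a * d + ‖v‖ ^ 2) / (γ * (2 - γ * R ^ 2))) / ((k : ℝ) - s) := by
  have hks : 0 < (k : ℝ) - s := sub_pos.2 (by exact_mod_cast hs)
  have h1 : ∀ ω, thetaBar γ v k s (fun t => z t ω) = ((k : ℝ) - s)⁻¹ •
      ∑ i ∈ Finset.range (k - s), sgdIter γ v (fun t => z t ω) 0 (s + i) := by
    intro ω
    simp only [thetaBar, theta_zero_natCast, Finset.sum_Ico_eq_sum_range]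
  simp only [h1, CenteredLaw.quadForm_smul]
  rw [integral_const_mul]
  have h2 := hz.integral_quadForm_sum_sgdIter_le h hγ hκ.le v
    (hz.integral_normSq_sgdIter_le h hκ.le ha haκ v 0) s (k - s)
  rw [Nat.cast_sub hs.le] at h2
  -- Turns the factor 8/γ = 8(2 - γR²)/κ into 16/κ.
  have h2R : 2 - γ * R ^ 2 ≤ 2 := by nlinarith [mul_nonneg hγ.le (sq_nonneg R)]
  have h2R0 : 0 < 2 - γ * R ^ 2 := pos_of_mul_pos_right hκ hγ.le
  have hb : 0 ≤ a * d + ‖v‖ ^ 2 := by positivity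
  calc _ ≤ (((k : ℝ) - s)⁻¹) ^ 2 * (((k : ℝ) - s) * (4 * (2 * (a * d + ‖v‖ ^ 2)) / γ)) := by
        gcongr
    _ = 8 * (2 - γ * R ^ 2) * ((a * d + ‖v‖ ^ 2) / (γ * (2 - γ * R ^ 2))) / ((k : ℝ) - s) := by
        field_simp
        ring
    _ ≤ _ := by
        gcongr
        linarith

/-! #### Means -/

theorem normSq_integral_le {E : Type*} [NormedAddCommGroup E] [InnerProductSpace ℝ E]
    [CompleteSpace E] {X : Ω → E} (hX : MemLp X 2 P) : ‖∫ ω, X ω ∂P‖ ^ 2 ≤ ∫ ω, ‖X ω‖ ^ 2 ∂P := by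
  have hi := hX.integrable one_le_two
  set m := ∫ ω, X ω ∂P with hm
  have h1 : 0 ≤ ∫ ω, ‖X ω - m‖ ^ 2 ∂P := integral_nonneg fun ω => by positivity
  have h2 : ∀ ω, ‖X ω - m‖ ^ 2 = ‖X ω‖ ^ 2 - 2 * inner ℝ m (X ω) + ‖m‖ ^ 2 := fun ω => by
    rw [norm_sub_sq_real, real_inner_comm]
  have i1 := integrable_normSq hX
  have i2 : Integrable (fun ω => 2 * inner ℝ m (X ω)) P := (hi.const_inner m).const_mul 2
  have i12 : Integrable (fun ω => ‖X ω‖ ^ 2 - 2 * inner ℝ m (X ω)) P := i1.sub i2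
  simp only [h2] at h1
  rw [integral_add i12 (integrable_const _), integral_sub i1 i2, integral_const_mul,
    integral_inner hi, ← hm, real_inner_self_eq_norm_sq] at h1
  simp only [integral_const, probReal_univ, one_smul] at h1
  linarith

theorem integral_sgdIter_eq (hz : IsStream P z ν) (h : CenteredLaw ν H σ R)
    (hκ : 0 ≤ γ * (2 - γ * R ^ 2)) (v : Vec d) (m : ℤ) (n : ℕ) :
    ∫ ω, sgdIter γ v (fun t => z t ω) m n ∂P = ∫ ω, linIter γ (fun t => z t ω) m n v ∂P := by
  have i0 := (hz.memLp_sgdIter h hκ 0 m n).integrable one_le_two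
  have h0 : ∫ ω, sgdIter γ 0 (fun t => z t ω) m n ∂P = 0 := by
    refine ext_inner_left ℝ fun w => ?_
    rw [← integral_inner i0, hz.integral_inner_sgdIter_zero h hκ, inner_zero_right]
  have h1 : ∀ ω, sgdIter γ v (fun t => z t ω) m n =
      sgdIter γ 0 (fun t => z t ω) m n + linIter γ (fun t => z t ω) m n v := fun ω => by
    rw [← sgdIter_eq_add_linIter, zero_add]
  simp only [h1]
  rw [integral_add i0 ((hz.memLp_linIter h hκ v m n).integrable one_le_two), h0, zero_add]

theorem norm_integral_sgdIter_le (hz : IsStream P z ν) (h : CenteredLaw ν H σ R)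
    (hκ : 0 ≤ γ * (2 - γ * R ^ 2)) {lam : ℝ} (hlam : ∀ v, lam * ‖v‖ ^ 2 ≤ inner ℝ v (H v))
    (hξ : γ * (2 - γ * R ^ 2) * lam ≤ 1) (v : Vec d) (m : ℤ) (n : ℕ) :
    ‖∫ ω, sgdIter γ v (fun t => z t ω) m n ∂P‖ ≤ √(1 - γ * (2 - γ * R ^ 2) * lam) ^ n * ‖v‖ := by
  rw [hz.integral_sgdIter_eq h hκ]
  refine abs_le_of_sq_le_sq' ?_ (by positivity) |>.2
  refine (normSq_integral_le (hz.memLp_linIter h hκ v m n)).trans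
    ((hz.integral_normSq_linIter_le h hκ hlam hξ v m n).trans (le_of_eq ?_))
  rw [mul_pow, ← pow_mul, mul_comm n 2, pow_mul, Real.sq_sqrt (sub_nonneg.2 hξ)]

/-- The noise part has mean 0, and the mean of the linear part decays geometrically in the lag,
which is at least l at level l + 1. -/
theorem tendsto_integral_fAvg (hz : IsStream P z ν) (h : CenteredLaw ν H σ R)
    (hκ : 0 < γ * (2 - γ * R ^ 2)) {lam : ℝ} (hlam0 : 0 < lam)
    (hlam : ∀ v, lam * ‖v‖ ^ 2 ≤ inner ℝ v (H v)) (hξ : γ * (2 - γ * R ^ 2) * lam ≤ 1)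
    (v : Vec d) {k s : ℕ} (hs : s < k) :
    Filter.Tendsto (fun l => ∫ ω, fAvg γ v k s (fun t => z t ω) l ∂P) Filter.atTop (nhds 0) := by
  set ρ := √(1 - γ * (2 - γ * R ^ 2) * lam) with hρ
  have hρ0 : 0 ≤ ρ := Real.sqrt_nonneg _
  have hρ1 : ρ < 1 := by
    rw [hρ, Real.sqrt_lt' one_pos]
    linarith [mul_pos hκ hlam0]
  rw [← Filter.tendsto_add_atTop_iff_nat 1]
  have hlim : Filter.Tendsto (fun l : ℕ => ρ ^ l * ‖v‖) Filter.atTop (nhds 0) := by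
    simpa using (tendsto_pow_atTop_nhds_zero_of_lt_one hρ0 hρ1).mul_const ‖v‖
  refine squeeze_zero_norm (fun l => ?_) hlim
  simp only [fAvg_eq_startAvg γ v hs, startAvg]
  have hne : (lagSet k s (l + 1)).Nonempty := Finset.nonempty_Icc.2 (lagLo_le_lagHi hs (l + 1))
  have hc : (0 : ℝ) < (lagSet k s (l + 1)).card := by exact_mod_cast hne.card_pos
  rw [integral_smul, integral_finsetSum _ fun (t : ℕ) _ =>
    (hz.memLp_sgdIter h hκ.le v (-(t : ℤ)) t).integrable one_le_two, norm_smul,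
    Real.norm_of_nonneg (inv_nonneg.2 hc.le), inv_mul_le_iff₀ hc]
  refine (norm_sum_le_of_le (lagSet k s (l + 1)) (f := fun t : ℕ =>
    ∫ ω, sgdIter γ v (fun i => z i ω) (-(t : ℤ)) t ∂P) (n := fun _ => ρ ^ l * ‖v‖)
    fun t ht => ?_).trans (by simp)
  refine (hz.norm_integral_sgdIter_le h hκ.le hlam hξ v _ t).trans ?_
  have hlt : l ≤ t := by
    refine le_trans ?_ (Finset.mem_Icc.1 ht).1
    have h1 : l + 1 < 2 ^ (l + 1) := Nat.lt_two_pow_self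
    calc l ≤ 1 * (2 ^ (l + 1) - 1) := by omega
      _ ≤ lagLo k s (l + 1) := Nat.mul_le_mul_right _ (by omega)
  gcongr ?_ * _
  exact pow_le_pow_of_le_one hρ0 hρ1.le hlt

/-- By stationarity θ_{-t:0} and θ_{0:t} have the same law, so the two averages share their mean
although they differ pathwise. This ties the correction Z to the bias of the time average. -/
theorem integral_fAvg_zero (hz : IsStream P z ν) (h : CenteredLaw ν H σ R)
    (hκ : 0 ≤ γ * (2 - γ * R ^ 2)) (v : Vec d) (k s : ℕ) :
    ∫ ω, fAvg γ v k s (fun t => z t ω) 0 ∂P = ∫ ω, thetaBar γ v k s (fun t => z t ω) ∂P := by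
  simp only [fAvg, thetaBar, theta_neg_zero, theta_zero_natCast]
  rw [integral_smul, integral_smul, integral_finsetSum _ fun (t : ℕ) _ =>
    (hz.memLp_sgdIter h hκ v (-(t : ℤ)) t).integrable one_le_two, integral_finsetSum _
    fun (t : ℕ) _ => (hz.memLp_sgdIter h hκ v 0 t).integrable one_le_two]
  congr 1
  exact Finset.sum_congr rfl fun t _ => (hz.identDistrib_sgdIter γ v (-(t : ℤ)) t).integral_eq

/-! #### The randomized telescoping estimator -/

theorem memLp_fAvg (hz : IsStream P z ν) (h : CenteredLaw ν H σ R)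
    (hκ : 0 ≤ γ * (2 - γ * R ^ 2)) (v : Vec d) {k s : ℕ} (hs : s < k) (l : ℕ) :
    MemLp (fun ω => fAvg γ v k s (fun t => z t ω) l) 2 P := by
  simp only [fAvg_eq_startAvg γ v hs]
  exact hz.memLp_startAvg h hκ v _

theorem memLp_zAvg_level (hz : IsStream P z ν) (h : CenteredLaw ν H σ R)
    (hκ : 0 ≤ γ * (2 - γ * R ^ 2)) (δ : ℝ) (v : Vec d) {k s : ℕ} (hs : s < k) (l : ℕ) :
    MemLp (fun ω => zAvg γ δ v k s (fun t => z t ω) l) 2 P := by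
  simp only [zAvg]
  exact ((hz.memLp_fAvg h hκ v hs (l + 1)).sub (hz.memLp_fAvg h hκ v hs l)).const_smul
    (levelProb δ l)⁻¹

theorem integral_quadForm_zAvg_level_le (hz : IsStream P z ν) (h : CenteredLaw ν H σ R)
    (hκ : 0 < γ * (2 - γ * R ^ 2)) {a : ℝ} (ha : 0 ≤ a)
    (haκ : γ ^ 2 * σ ^ 2 ≤ a * (γ * (2 - γ * R ^ 2)))
    {lam : ℝ} (hlam0 : 0 ≤ lam) (hlam : ∀ v, lam * ‖v‖ ^ 2 ≤ inner ℝ v (H v))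
    (hξ : γ * (2 - γ * R ^ 2) * lam ≤ 1) (δ : ℝ) (v : Vec d) {k s : ℕ} (hs : s < k) (l : ℕ) :
    ∫ ω, inner ℝ (zAvg γ δ v k s (fun t => z t ω) l)
      (H (zAvg γ δ v k s (fun t => z t ω) l)) ∂P ≤
      ((levelProb δ l)⁻¹) ^ 2 * (8 * ((a * d + ‖v‖ ^ 2) / (γ * (2 - γ * R ^ 2))) *
        ((1 - γ * (2 - γ * R ^ 2) * lam) ^ lagLo k s l / (lagSet k s l).card)) := by
  simp only [zAvg, CenteredLaw.quadForm_smul, fAvg_eq_startAvg γ v hs]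
  rw [integral_const_mul]
  gcongr
  exact hz.integral_quadForm_startAvg_sub_le h hκ ha haκ hlam0 hlam hξ v (lagLo_le_lagHi hs l)
    (lagLo_le_lagHi hs (l + 1)) (lagHi_le_lagLo_succ k s l) (card_lagSet_le_succ hs l)

/-- A level has weight p_l and normalization p_l⁻², so its contribution carries p_l⁻¹, which is what
`hC` sums. -/
theorem integrable_quadForm_zAvg (hz : IsStream P z ν) (h : CenteredLaw ν H σ R)
    (hκ : 0 < γ * (2 - γ * R ^ 2)) {a : ℝ} (ha : 0 ≤ a)
    (haκ : γ ^ 2 * σ ^ 2 ≤ a * (γ * (2 - γ * R ^ 2)))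
    {lam : ℝ} (hlam0 : 0 ≤ lam) (hlam : ∀ v, lam * ‖v‖ ^ 2 ≤ inner ℝ v (H v))
    (hξ : γ * (2 - γ * R ^ 2) * lam ≤ 1) {δ : ℝ} (hδ : 0 ≤ δ) (v : Vec d) {k s : ℕ} (hs : s < k)
    {N : Ω → ℕ} (hN : Measurable N) (hNlaw : ∀ l, P.real (N ⁻¹' {l}) = levelProb δ l)
    (hNind : IndepFun N (fun ω t => z t ω) P) {C : ℝ}
    (hC : ∀ n, ∑ l ∈ Finset.range n, (levelProb δ l)⁻¹ *
      ((1 - γ * (2 - γ * R ^ 2) * lam) ^ lagLo k s l / (lagSet k s l).card) ≤ C) :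
    Integrable (fun ω => inner ℝ (zAvg γ δ v k s (fun t => z t ω) (N ω))
      (H (zAvg γ δ v k s (fun t => z t ω) (N ω)))) P ∧
    ∫ ω, inner ℝ (zAvg γ δ v k s (fun t => z t ω) (N ω))
      (H (zAvg γ δ v k s (fun t => z t ω) (N ω))) ∂P ≤
      8 * ((a * d + ‖v‖ ^ 2) / (γ * (2 - γ * R ^ 2))) * C := by
  set c := (a * d + ‖v‖ ^ 2) / (γ * (2 - γ * R ^ 2)) with hc
  have hc0 : 0 ≤ c := by positivity
  set w : ℕ → ℝ := fun l =>
    (1 - γ * (2 - γ * R ^ 2) * lam) ^ lagLo k s l / (lagSet k s l).card with hw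
  have hw0 : ∀ l, 0 ≤ w l := fun l =>
    div_nonneg (pow_nonneg (sub_nonneg.2 hξ) _) (Nat.cast_nonneg _)
  set G : ℕ → ℝ := fun l => ((levelProb δ l)⁻¹) ^ 2 * (8 * c * w l) with hG
  have hG0 : ∀ l, 0 ≤ G l := fun l => mul_nonneg (sq_nonneg _) (mul_nonneg (by positivity) (hw0 l))
  have hsum : ∀ n, ∑ l ∈ Finset.range n, levelProb δ l * G l ≤ 8 * c * C := by
    intro n
    have h1 : ∀ l, levelProb δ l * G l = 8 * c * ((levelProb δ l)⁻¹ * w l) := by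
      intro l
      have := (levelProb_pos hδ l).ne'
      simp only [hG]
      field_simp
    simp only [h1]
    rw [← Finset.mul_sum]
    exact mul_le_mul_of_nonneg_left (hC n) (by positivity)
  obtain ⟨hGint, hGle⟩ := integrable_and_integral_comp_level_le hδ hN hNlaw hG0 hsum
  have hqm : Measurable fun u : Vec d => inner ℝ u (H u) := by fun_prop
  have hpm := hz.measurable_path
  have hm := measurable_zAvg_path γ δ v hs
  have hml : ∀ l, Measurable fun p : ℤ → Sample d =>
      inner ℝ (zAvg γ δ v k s p l) (H (zAvg γ δ v k s p l)) := fun l =>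
    hqm.comp (measurable_zAvg_level_path γ δ v hs l)
  have key := integrable_and_integral_le_of_indepFun (P := P)
    (f := fun (l : ℕ) (p : ℤ → Sample d) =>
      inner ℝ (zAvg γ δ v k s p l) (H (zAvg γ δ v k s p l))) (g := G)
    hN.aemeasurable hpm.aemeasurable hNind (hqm.comp hm) (fun l p => h.quadForm_nonneg _)
    (measurable_of_countable G)
    (fun l => (integrable_map_measure (hml l).aestronglyMeasurable hpm.aemeasurable).2
      (integrable_quadForm H (hz.memLp_zAvg_level h hκ.le δ v hs l)))
    (fun l => by
      rw [integral_map hpm.aemeasurable (hml l).aestronglyMeasurable]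
      exact hz.integral_quadForm_zAvg_level_le h hκ ha haκ hlam0 hlam hξ δ v hs l) hGint
  exact ⟨key.1, key.2.trans hGle⟩

theorem measurable_zAvg (hz : IsStream P z ν) (γ δ : ℝ) (v : Vec d) {k s : ℕ} (hs : s < k)
    {N : Ω → ℕ} (hN : Measurable N) :
    Measurable fun ω => zAvg γ δ v k s (fun t => z t ω) (N ω) := by
  have h := (measurable_zAvg_path γ δ v hs).comp (hN.prodMk hz.measurable_path)
  simpa only [Function.comp_def, Function.uncurry] using h

theorem memLp_of_integrable_quadForm {lam : ℝ} (hlam0 : 0 < lam)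
    (hlam : ∀ v, lam * ‖v‖ ^ 2 ≤ inner ℝ v (H v)) {V : Ω → Vec d} (hV : Measurable V)
    (hint : Integrable (fun ω => inner ℝ (V ω) (H (V ω))) P) : MemLp V 2 P := by
  rw [memLp_two_iff_integrable_sq_norm hV.aestronglyMeasurable]
  refine (hint.const_mul lam⁻¹).mono' (hV.norm.pow_const 2).aestronglyMeasurable
    (ae_of_all _ fun ω => ?_)
  rw [Real.norm_of_nonneg (by positivity), ← div_eq_inv_mul, le_div_iff₀' hlam0]
  exact hlam _

/-- The weight p_l cancels the division by p_l, so the series of level means telescopes to lim E f_l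
- E f_0, with limit 0 in centred coordinates. -/
theorem integral_zAvg (hz : IsStream P z ν) (h : CenteredLaw ν H σ R)
    (hκ : 0 < γ * (2 - γ * R ^ 2)) {lam : ℝ} (hlam0 : 0 < lam)
    (hlam : ∀ v, lam * ‖v‖ ^ 2 ≤ inner ℝ v (H v)) (hξ : γ * (2 - γ * R ^ 2) * lam ≤ 1)
    {δ : ℝ} (hδ : 0 ≤ δ) (v : Vec d) {k s : ℕ} (hs : s < k)
    {N : Ω → ℕ} (hN : Measurable N) (hNlaw : ∀ l, P.real (N ⁻¹' {l}) = levelProb δ l)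
    (hNind : IndepFun N (fun ω t => z t ω) P)
    (hint : Integrable (fun ω => zAvg γ δ v k s (fun t => z t ω) (N ω)) P) :
    ∫ ω, zAvg γ δ v k s (fun t => z t ω) (N ω) ∂P =
      -∫ ω, thetaBar γ v k s (fun t => z t ω) ∂P := by
  set μ : ℕ → Vec d := fun l => ∫ ω, fAvg γ v k s (fun t => z t ω) l ∂P with hμ
  set g : ℕ → Vec d := fun l => (levelProb δ l)⁻¹ • (μ (l + 1) - μ l) with hg
  have hpm := hz.measurable_path
  have hm := measurable_zAvg_path γ δ v hs
  have hfi : ∀ l, Integrable (fun ω => fAvg γ v k s (fun t => z t ω) l) P := fun l =>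
    (hz.memLp_fAvg h hκ.le v hs l).integrable one_le_two
  obtain ⟨hgi, hEg⟩ := integral_eq_of_indepFun (P := P)
    (f := fun (l : ℕ) (p : ℤ → Sample d) => zAvg γ δ v k s p l) (g := g)
    hN.aemeasurable hpm.aemeasurable hNind hm (measurable_of_countable g) hint
    (fun l => by
      rw [integral_map hpm.aemeasurable 
        (measurable_zAvg_level_path γ δ v hs l).aestronglyMeasurable]
      simp only [zAvg]
      rw [integral_smul, integral_sub (hfi (l + 1)) (hfi l)])
  rw [hEg, ← integral_map hN.aemeasurable (measurable_of_countable g).aestronglyMeasurable,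
    ← hz.integral_fAvg_zero h hκ.le]
  have h1 := (hasSum_integral_nat hgi).tendsto_sum_nat
  have h2 : ∀ l, (P.map N).real {l} • g l = μ (l + 1) - μ l := by
    intro l
    rw [map_measureReal_apply hN (measurableSet_singleton l), hNlaw, hg, smul_smul,
      mul_inv_cancel₀ (levelProb_pos hδ l).ne', one_smul]
  simp only [h2, Finset.sum_range_sub] at h1
  have h3 : Filter.Tendsto (fun n => μ n - μ 0) Filter.atTop (nhds (0 - μ 0)) :=
    (hz.tendsto_integral_fAvg h hκ hlam0 hlam hξ v hs).sub_const _
  rw [tendsto_nhds_unique h1 h3, zero_sub]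

end IsStream

/-! ### Combination with the Bernoulli variable -/

section Combine

variable {Ω : Type*} [MeasurableSpace Ω] {P : Measure Ω} [IsProbabilityMeasure P]
  {T Z : Ω → Vec d} {Q : Ω → Bool} {q : ℝ}

theorem fHat_add (q : ℝ) (θ T Z : Vec d) (Q : Bool) :
    fHat q (θ + T) Q Z = θ + fHat q T Q Z := by
  simp only [fHat, add_assoc]

theorem integral_bernoulli (hQ : Measurable Q) (hQlaw : P.real (Q ⁻¹' {true}) = q) :
    Integrable (fun ω => if Q ω then (1 : ℝ) else 0) P ∧
      ∫ ω, (if Q ω then (1 : ℝ) else 0) ∂P = q := by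
  have hms : MeasurableSet (Q ⁻¹' {true}) := hQ (measurableSet_singleton _)
  have h1 : (fun ω => if Q ω then (1 : ℝ) else 0) = (Q ⁻¹' {true}).indicator fun _ => 1 := by
    funext ω
    by_cases h : Q ω = true <;> simp [h]
  rw [h1]
  refine ⟨(integrable_const _).indicator hms, ?_⟩
  rw [integral_indicator_const _ hms, hQlaw]
  simp

theorem memLp_ite_smul (hQ : Measurable Q) (hZ : MemLp Z 2 P) :
    MemLp (fun ω => (if Q ω then (1 : ℝ) else 0) • Z ω) 2 P := by
  have h1 : (fun ω => (if Q ω then (1 : ℝ) else 0) • Z ω) = (Q ⁻¹' {true}).indicator Z := by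
    funext ω
    by_cases h : Q ω = true <;> simp [h]
  rw [h1]
  exact hZ.indicator (hQ (measurableSet_singleton _))

theorem memLp_fHat (hQ : Measurable Q) (hT : MemLp T 2 P) (hZ : MemLp Z 2 P) (q : ℝ) :
    MemLp (fun ω => fHat q (T ω) (Q ω) (Z ω)) 2 P := by
  simp only [fHat, mul_smul]
  exact hT.add ((memLp_ite_smul hQ hZ).const_smul q⁻¹)

theorem integral_fHat (hq : q ≠ 0) (hQ : Measurable Q) (hQlaw : P.real (Q ⁻¹' {true}) = q)
    (hT : MemLp T 2 P) (hZ : MemLp Z 2 P) (hZQ : IndepFun Z (fun ω => (T ω, Q ω)) P) :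
    ∫ ω, fHat q (T ω) (Q ω) (Z ω) ∂P = ∫ ω, T ω ∂P + ∫ ω, Z ω ∂P := by
  obtain ⟨hb, hbq⟩ := integral_bernoulli hQ hQlaw
  have hite : Measurable fun c : Bool => if c then (1 : ℝ) else 0 := measurable_of_countable _
  have hind : IndepFun (fun ω => if Q ω then (1 : ℝ) else 0) Z P :=
    (hZQ.comp measurable_id (hite.comp measurable_snd)).symm
  simp only [fHat, mul_smul]
  have hi : Integrable (fun ω => q⁻¹ • (if Q ω then (1 : ℝ) else 0) • Z ω) P :=
    ((memLp_ite_smul hQ hZ).const_smul q⁻¹).integrable one_le_two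
  rw [integral_add (hT.integrable one_le_two) hi, integral_smul,
    hind.integral_fun_smul_eq_smul_integral hb.1 hZ.1, hbq, smul_smul, inv_mul_cancel₀ hq, one_smul]

/-- By independence the cross term is 2 (ET)ᵀH(EZ) = -2 (ET)ᵀH(ET) ≤ 0 and can be dropped. Since Q²
= Q, the factor q⁻² of the last term becomes q⁻¹. -/
theorem integral_quadForm_fHat_le (h : CenteredLaw ν H σ R) (hq : 0 < q) (hQ : Measurable Q)
    (hQlaw : P.real (Q ⁻¹' {true}) = q) (hT : MemLp T 2 P) (hZ : MemLp Z 2 P)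
    (hTQ : IndepFun Q T P) (hZQ : IndepFun Z (fun ω => (T ω, Q ω)) P)
    (hmean : ∫ ω, Z ω ∂P = -∫ ω, T ω ∂P) :
    ∫ ω, inner ℝ (fHat q (T ω) (Q ω) (Z ω)) (H (fHat q (T ω) (Q ω) (Z ω))) ∂P ≤
      ∫ ω, inner ℝ (T ω) (H (T ω)) ∂P + q⁻¹ * ∫ ω, inner ℝ (Z ω) (H (Z ω)) ∂P := by
  obtain ⟨hb, hbq⟩ := integral_bernoulli hQ hQlaw
  set b : Ω → ℝ := fun ω => if Q ω then (1 : ℝ) else 0 with hbdef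
  have hite : Measurable fun c : Bool => if c then (1 : ℝ) else 0 := measurable_of_countable _
  have hbT : MemLp (fun ω => b ω • T ω) 2 P := memLp_ite_smul hQ hT
  have hbsq : ∀ ω, b ω ^ 2 = b ω := fun ω => by simp only [hbdef]; split_ifs <;> norm_num
  have hpt : ∀ ω, inner ℝ (fHat q (T ω) (Q ω) (Z ω)) (H (fHat q (T ω) (Q ω) (Z ω))) =
      inner ℝ (T ω) (H (T ω)) + 2 * q⁻¹ * inner ℝ (b ω • T ω) (H (Z ω)) +
        q⁻¹ ^ 2 * (b ω * inner ℝ (Z ω) (H (Z ω))) := by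
    intro ω
    have h1 : fHat q (T ω) (Q ω) (Z ω) = T ω + (q⁻¹ * b ω) • Z ω := rfl
    rw [h1, h.quadForm_add, CenteredLaw.quadForm_smul, map_smul, real_inner_smul_right,
      real_inner_smul_left, mul_pow, hbsq]
    ring
  have iT := integrable_quadForm H hT
  have iTZ : Integrable (fun ω => 2 * q⁻¹ * inner ℝ (b ω • T ω) (H (Z ω))) P :=
    (integrable_bilin H hbT hZ).const_mul _
  have iZ := integrable_quadForm H hZ
  have hqm : Measurable fun u : Vec d => inner ℝ u (H u) := by fun_prop
  have hind1 : IndepFun b (fun ω => inner ℝ (Z ω) (H (Z ω))) P :=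
    (hZQ.comp hqm (hite.comp measurable_snd)).symm
  have ibZ : Integrable (fun ω => b ω * inner ℝ (Z ω) (H (Z ω))) P := hind1.integrable_mul hb iZ
  have iTTZ : Integrable (fun ω => inner ℝ (T ω) (H (T ω)) +
      2 * q⁻¹ * inner ℝ (b ω • T ω) (H (Z ω))) P := iT.add iTZ
  have hEb : ∫ ω, b ω * inner ℝ (Z ω) (H (Z ω)) ∂P = q * ∫ ω, inner ℝ (Z ω) (H (Z ω)) ∂P := by
    rw [hind1.integral_fun_mul_eq_mul_integral hb.1 iZ.1, hbq]
  have hEbT : ∫ ω, b ω • T ω ∂P = q • ∫ ω, T ω ∂P := by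
    have hind2 : IndepFun b T P := hTQ.comp hite measurable_id
    rw [hind2.integral_fun_smul_eq_smul_integral hb.1 hT.1, hbq]
  have hcross : ∫ ω, inner ℝ (b ω • T ω) (H (Z ω)) ∂P =
      -(q * inner ℝ (∫ ω, T ω ∂P) (H (∫ ω, T ω ∂P))) := by
    have hm : Measurable fun p : Vec d × Bool => (if p.2 then (1 : ℝ) else 0) • p.1 :=
      (hite.comp measurable_snd).smul measurable_fst
    have hind3 : IndepFun (fun ω => b ω • T ω) (fun ω => H (Z ω)) P :=
      (hZQ.comp H.continuous.measurable hm).symm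
    have h1 : ∫ ω, inner ℝ (b ω • T ω) (H (Z ω)) ∂P =
        inner ℝ (∫ ω, b ω • T ω ∂P) (∫ ω, H (Z ω) ∂P) := hind3.integral_bilin (hbT.integrable one_le_two)
      (H.integrable_comp (hZ.integrable one_le_two)) (innerSL ℝ)
    rw [h1, H.integral_comp_comm (hZ.integrable one_le_two), hEbT, hmean, map_neg, inner_neg_right,
      real_inner_smul_left]
  simp only [hpt]
  rw [integral_add iTTZ (ibZ.const_mul _), integral_add iT iTZ, integral_const_mul,
    integral_const_mul, hEb, hcross]
  have hnn := h.quadForm_nonneg (∫ ω, T ω ∂P)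
  have e1 : 2 * q⁻¹ * -(q * inner ℝ (∫ ω, T ω ∂P) (H (∫ ω, T ω ∂P))) =
      -(2 * inner ℝ (∫ ω, T ω ∂P) (H (∫ ω, T ω ∂P))) := by field_simp
  have e2 : ∀ r : ℝ, q⁻¹ ^ 2 * (q * r) = q⁻¹ * r := fun r => by field_simp
  rw [e1, e2]
  linarith

end Combine

end Estimator

/-- The form (ad + ‖θ₀ - θ*‖²)/κ in which the moment bounds produce the constant. -/
theorem constC_eq {d : ℕ} {γ R : ℝ} (hγ : γ ≠ 0) (hR : 2 - γ * R ^ 2 ≠ 0) (σ : ℝ)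
    (θ₀ θs : Vec d) :
    constC γ σ R θ₀ θs = (γ * σ ^ 2 / (2 - γ * R ^ 2) * d + ‖θ₀ - θs‖ ^ 2) /
      (γ * (2 - γ * R ^ 2)) := by
  rw [constC]
  field_simp

end AvgStartSGD

/-! ### Assembly of the claims -/

theorem mainTheorem2
    {d : ℕ}
    -- the pair `(x, y)`
    {Ω₀ : Type*} [MeasurableSpace Ω₀] (P₀ : Measure Ω₀) [IsProbabilityMeasure P₀]
    (x : Ω₀ → Vec d) (y : Ω₀ → ℝ) (hx : MemLp x 2 P₀) (hy : MemLp y 2 P₀)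
    (hH : (hessian P₀ x).PosDef)
    (θstar : Vec d) (hθstar : NormalEq P₀ x y θstar)
    (σ R : ℝ) (hσ : 0 < σ) (hR : 0 < R) (hmom : MomentAssumption P₀ x y θstar σ R)
    -- the parameters; `s = αk` up to rounding
    (θ₀ : Vec d) (γ α δ q : ℝ) (hγ : 0 < γ) (hγR : γ < 2 / R ^ 2)
    (hα : 0 < α) (hα' : α ≤ 1 / 2) (hδ : 1 < δ) (hq : 0 < q) (hq' : q ≤ 1)
    (k : ℕ) (hk : 2 ≤ k) (s : ℕ) (hs : s = ⌊α * k⌋₊ ∨ s = ⌈α * k⌉₊)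
    -- the independent copies `z t = (x_t, y_t)` of `(x, y)`, and the variables `N` and `Q`
    {Ω : Type*} [MeasurableSpace Ω] (P : Measure Ω) [IsProbabilityMeasure P]
    (z : ℤ → Ω → Sample d) (hz : ∀ t, Measurable (z t)) (hzindep : iIndepFun z P)
    (hzid : ∀ t, IdentDistrib (z t) (fun ω => (x ω, y ω)) P P₀)
    (N : Ω → ℕ) (hN : Measurable N) (hNlaw : ∀ l, P.real (N ⁻¹' {l}) = levelProb δ l)
    (hNindep : IndepFun N (fun ω t => z t ω) P)
    (Q : Ω → Bool) (hQ : Measurable Q) (hQlaw : P.real (Q ⁻¹' {true}) = q)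
    (hQindep : IndepFun Q (fun ω => thetaBar γ θ₀ k s (fun t => z t ω)) P) :
    -- `f_{avg,k,l}` is a conditional expectation of `f_{k,l} = θ_{-τ(k,l):0}`
    (∀ (l : ℕ) (τ : Ω → ℕ), Measurable τ →
      (∀ t ∈ lagSet k s l, P.real (τ ⁻¹' {t}) = 1 / (lagSet k s l).card) →
      IndepFun τ (fun ω t => z t ω) P →
      ∀ j : ℕ, k * (2 ^ (l + 1) - 1) ≤ j →
        (fun ω => fAvg γ θ₀ k s (fun t => z t ω) l) =ᵐ[P]
          P[fun ω => theta γ θ₀ (fun t => z t ω) (-(τ ω : ℤ)) 0 |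
            ⨆ t ∈ Set.Icc (-(j : ℤ)) 0, MeasurableSpace.comap (z t) inferInstance]) ∧
    -- the simulation of `Z_{avg,k}` is correct, and `T_{avg,k} ≤ 4δk/(δ-1)`
    (∀ ω, (zAvgProg γ δ θ₀ k s id (N ω)).eval (fun t => z t ω) =
      zAvg γ δ θ₀ k s (fun t => z t ω) (N ω)) ∧
    expectedTimeZ P γ δ θ₀ k s z N ≤ ENNReal.ofReal (4 * δ * k / (δ - 1)) ∧
    -- the simulation of `f̂_{avg,k}` is correct, and `T̂_{avg,k} ≤ k + q T_{avg,k}`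
    (∀ (z' : ℤ → Ω → Sample d) (N' : Ω → ℕ),
      IdentDistrib (fun ω => ((fun t => z' t ω), N' ω)) (fun ω => ((fun t => z t ω), N ω)) P P →
      IndepFun (fun ω => ((fun t => z' t ω), N' ω))
        (fun ω => (thetaBar γ θ₀ k s (fun t => z t ω), Q ω)) P →
      (∀ ω, (fHatProg γ δ q θ₀ k s (Q ω) (N' ω)).eval
          (Sum.elim (fun t => z t ω) (fun t => z' t ω)) =
        fHat q (thetaBar γ θ₀ k s (fun t => z t ω)) (Q ω)
          (zAvg γ δ θ₀ k s (fun t => z' t ω) (N' ω))) ∧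
      expectedTimeFHat P γ δ q θ₀ k s z z' Q N' ≤
        k + ENNReal.ofReal q * expectedTimeZ P γ δ θ₀ k s z N) ∧
    -- for every copy `Z'` of `Z_{avg,k}` independent of `(θ̄_k, Q)`, the estimator `f̂_{avg,k}` is
    -- unbiased, with the stated bound on its expected excess risk
    (∀ Z' : Ω → Vec d,
      IdentDistrib Z' (fun ω => zAvg γ δ θ₀ k s (fun t => z t ω) (N ω)) P P →
      IndepFun Z' (fun ω => (thetaBar γ θ₀ k s (fun t => z t ω), Q ω)) P →
      let fhat : Ω → Vec d := fun ω => fHat q (thetaBar γ θ₀ k s (fun t => z t ω)) (Q ω) (Z' ω)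
      let c := constC γ σ R θ₀ θstar
      let ξ := constXi γ R (hessian P₀ x)
      MemLp fhat 2 P ∧
      ∫ ω, fhat ω ∂P = θstar ∧
      Integrable (fun ω => risk P₀ x y (fhat ω)) P ∧
      ∫ ω, risk P₀ x y (fhat ω) ∂P - risk P₀ x y θstar ≤
        1 / (2 * q * k) *
          (27 * c / α + 6 * c * (4 * Real.log ((4 * δ + 8) / (α * ξ))) ^ (δ + 1))) := by
  obtain ⟨hsk, hks⟩ := burnIn_bounds hα' hk hs
  have h2R : 0 < 2 - γ * R ^ 2 := by
    rw [lt_div_iff₀ (by positivity)] at hγR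
    linarith
  have hκ : 0 < γ * (2 - γ * R ^ 2) := mul_pos hγ h2R
  have hlaw := centeredLaw_residual hx hy hθstar hmom
  have hstream := isStream_residual (P₀ := P₀) (x := x) (y := y) θstar hz hzindep hzid
  have := hstream.isProbabilityMeasure
  refine ⟨?_, ?_, expectedTimeZ_le hδ γ θ₀ k s z hN hNlaw, ?_, ?_⟩
  · intro l τ hτ hτlaw hτind j hj
    refine fAvg_eq_condExp hsk hz (fun t => ?_) l hτ hτlaw hτind hj
    have h1 := ((hstream.memLp_sgdIter hlaw hκ.le (θ₀ - θstar) (-(t : ℤ)) t).integrable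
      one_le_two).add (integrable_const θstar)
    refine h1.congr (ae_of_all _ fun ω => ?_)
    simp only [Pi.add_apply, ← sgdIter_sub_eq_residual, sub_add_cancel]
  · exact fun ω => eval_zAvgProg γ δ θ₀ hsk id (N ω) fun t => z t ω
  · intro z' N' hid hind
    exact ⟨fun ω => eval_fHatProg γ δ q θ₀ hsk (Q ω) (N' ω) _ _,
      expectedTimeFHat_le θ₀ k s z z' hQ hQlaw (hid.comp measurable_snd)
        (hind.comp measurable_snd measurable_snd)⟩
  · intro Z' hZ'id hZ'ind fhat c ξ
    rcases Nat.eq_zero_or_pos d with rfl | hd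
    -- In dimension 0 the spectrum is empty and ξ takes a default value, but all vectors coincide
    -- and c = 0.
    · have hconst : fhat = fun _ => θstar := funext fun ω => Subsingleton.elim _ _
      have hc0 : c = 0 := by
        simp [c, constC, Subsingleton.elim θ₀ θstar]
      rw [hconst, hc0]
      refine ⟨memLp_const _, by simp, integrable_const _, by simp⟩
    obtain ⟨hlam0, hlam⟩ := lambdaMin_spec hH hd
    have hξ1 : γ * (2 - γ * R ^ 2) * lambdaMin (hessian P₀ x) ≤ 1 :=
      hlaw.xi_le_one hlam hκ.le hd
    have hξ0 : 0 < γ * (2 - γ * R ^ 2) * lambdaMin (hessian P₀ x) := mul_pos hκ hlam0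
    -- The covariance level a for which the contraction loss aκ balances the injected noise γ²σ²
    -- exactly.
    have ha : 0 ≤ γ * σ ^ 2 / (2 - γ * R ^ 2) := by positivity
    have haκ : γ ^ 2 * σ ^ 2 ≤ γ * σ ^ 2 / (2 - γ * R ^ 2) * (γ * (2 - γ * R ^ 2)) :=
      le_of_eq (by field_simp)
    set T : Ω → Vec d := fun ω => thetaBar γ (θ₀ - θstar) k s (fun t => residual θstar (z t ω))
      with hT
    have hTeq : ∀ ω, T ω = thetaBar γ θ₀ k s (fun t => z t ω) - θstar := fun ω =>
      thetaBar_residual γ θ₀ θstar hsk _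
    have hfhat : ∀ ω, fhat ω = θstar + fHat q (T ω) (Q ω) (Z' ω) := by
      intro ω
      rw [← fHat_add, hTeq, add_sub_cancel]
    have hTmem : MemLp T 2 P := hstream.memLp_thetaBar hlaw hκ.le (θ₀ - θstar) k s
    have hsubm : Measurable fun θ : Vec d => θ - θstar := measurable_id.sub_const _
    have hQT : IndepFun Q T P := by
      rw [funext hTeq]
      exact hQindep.comp measurable_id hsubm
    have hZ'T : IndepFun Z' (fun ω => (T ω, Q ω)) P := by
      simpa only [hTeq] using! hZ'ind.comp measurable_id
        ((hsubm.comp measurable_fst).prodMk measurable_snd)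
    simp only [zAvg_residual γ δ θ₀ θstar hsk] at hZ'id
    have hNind : IndepFun N (fun ω t => residual θstar (z t ω)) P :=
      hNindep.comp measurable_id
        (measurable_pi_lambda _ fun t => (measurable_residual θstar).comp (measurable_pi_apply t))
    obtain ⟨hZint, hZle⟩ := hstream.integrable_quadForm_zAvg hlaw hκ ha haκ hlam0.le hlam hξ1
      (by linarith : 0 ≤ δ) (θ₀ - θstar) hsk hN hNlaw hNind
      (sum_levelTerm_le hδ hα hα' hξ0 hξ1 hk hsk hks)
    have hZmem := IsStream.memLp_of_integrable_quadForm hlam0 hlam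
      (hstream.measurable_zAvg γ δ (θ₀ - θstar) hsk hN) hZint
    have hZ'mem : MemLp Z' 2 P := hZ'id.memLp_iff.2 hZmem
    have hZ'mean : ∫ ω, Z' ω ∂P = -∫ ω, T ω ∂P := by
      rw [hZ'id.integral_eq]
      exact hstream.integral_zAvg hlaw hκ hlam0 hlam hξ1 (by linarith) (θ₀ - θstar) hsk hN hNlaw
        hNind (hZmem.integrable one_le_two)
    have hZ'quad := (hZ'id.comp (u := fun v => inner ℝ v (hessianOp P₀ x v))
      (by fun_prop)).integral_eq.le.trans hZle
    have hFmem : MemLp (fun ω => fHat q (T ω) (Q ω) (Z' ω)) 2 P :=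
      memLp_fHat hQ hTmem hZ'mem q
    have hFquad := integrable_quadForm (hessianOp P₀ x) hFmem
    have hrisk : ∀ ω, risk P₀ x y (fhat ω) = risk P₀ x y θstar + 1 / 2 *
        inner ℝ (fHat q (T ω) (Q ω) (Z' ω)) (hessianOp P₀ x (fHat q (T ω) (Q ω) (Z' ω))) := by
      intro ω
      rw [risk_eq hx hy hθstar (fhat ω), hfhat, add_sub_cancel_left]
    refine ⟨?_, ?_, ?_, ?_⟩
    · simp only [funext hfhat]
      exact (memLp_const θstar).add hFmem
    · simp only [hfhat]
      rw [integral_add (integrable_const _) (hFmem.integrable one_le_two),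
        integral_fHat hq.ne' hQ hQlaw hTmem hZ'mem hZ'T, hZ'mean]
      simp
    · simp only [hrisk]
      exact (integrable_const _).add (hFquad.const_mul _)
    · simp only [hrisk]
      rw [integral_add (integrable_const _) (hFquad.const_mul _), integral_const_mul]
      simp only [integral_const, probReal_univ, one_smul, add_sub_cancel_left]
      have hcomb := integral_quadForm_fHat_le hlaw hq hQ hQlaw hTmem hZ'mem hQT hZ'T hZ'mean
      have hTle := hstream.integral_quadForm_thetaBar_le hlaw hγ hκ ha haκ (θ₀ - θstar) hsk
      refine (mul_le_mul_of_nonneg_left hcomb (by norm_num)).trans ?_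
      have hc : c = _ := constC_eq hγ.ne' h2R.ne' σ θ₀ θstar
      rw [hc]
      exact excessRisk_bound hδ hα hα' hξ0 hξ1 hq hq' (by positivity) (by positivity) hks hTle
        hZ'quad
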